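/- Let $\mathbb{D}$ be the open unit disk in $\mathbb{C}$. For $\lambda\in\mathbb{D}$ let $\mathsf{A}_\lambda=\{\sum_{n\ge 0}a_n\lambda^n : a_n\in\{-1,+1\}\}$ be the attractor of the iterated function system $\{z\mapsto -1+\lambda z,\ z\mapsto 1+\lambda z\}$, and let $\mathcal{M}=\{\lambda\in\mathbb{D} : \mathsf{A}_\lambda\text{ is connected}\}$. Let $\mathcal{P}$ be the set of power series $f(z)=\sum_{j\ge0}c_jz^j$ with $c_j\in\{-1,0,+1\}$ and $c_0=1$, and let $\mathcal{F}_\lambda=\{f\in\mathcal{P} : f(\lambda)=0\}$. A series $f\in\mathcal{P}$ is of rational type $(\ell,p)$ if $\ell\ge 0$ and $p\ge1$ are the minimal integers such that $$f(z)=\sum_{j=0}^{\ell}c_jz^j+\frac{c_{\ell+1}z^{\ell+1}+\dots+c_{\ell+p}z^{\ell+p}}{1-z^p}.$$ **Theorem 4.4.** Let $\lambda\in\mathcal{M}\setminus\mathbb{R}$ with $|\lambda|\le 2^{-1/2}$ be such that $\mathcal{F}_\lambda=\{f\}$, where $f(z)=\sum_{j\ge0}c_jz^j$ is of rational type $(\ell,p)$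 and has only finitely many zero coefficients. Let $f_k(z)=\sum_{j=0}^kc_jz^j$ denote its Taylor polynomials, and assume that for every $0\le n\le p-1$: 1. $\displaystyle |f_{\ell+1+n}(\lambda)|>\frac12\,\frac{|\lambda^{\ell+1+n+1}|}{1-|\lambda|}$; 2. $\displaystyle |f_{\ell+1+n}(\lambda)|+|f_{\ell+1+n+1}(\lambda)|>\frac{|\lambda^{\ell+1+n+1}|}{1-|\lambda|}$; 3. if $Q$ is the polynomial with $2f_\ell(z)+z^{\ell+1}Q(z)=2f_{\ell+1+n}(z)$, then for every polynomial $P\neq Q$ of degree at most $n$ with coefficients in $\{-2,-1,0,+1,+2\}$, $$2|f_{\ell+1+n}(\lambda)|<|2f_\ell(\lambda)+\lambda^{\ell+1}P(\lambda)|.$$ Then $\lambda\in\partial\mathcal{M}$, and $\lambda$ is path accessible from a connected component $U$ of $\mathbb{D}\setminus\mathcal{M}$: there is a continuous $\gamma:[0,1]\to\mathbb{C}$ with $\gamma(1)=\lambda$ and $\gamma(t)\in U$ for all $t\in[0,1)$. -/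

import Mathlib

noncomputable section

namespace TwoMapIFS

/-- The attractor of the iterated function system `z ↦ -1 + lam z`, `z ↦ 1 + lam z`: the set of all
sums `∑ aₙ lamⁿ` with `aₙ ∈ {-1, 1}`. -/
def attractor (lam : ℂ) : Set ℂ :=
  {z | ∃ a : ℕ → ℤ, (∀ n, a n ∈ ({-1, 1} : Set ℤ)) ∧ HasSum (fun n => (a n : ℂ) * lam ^ n) z}

/-- The connectedness locus: all `lam` in the open unit disk whose attractor is connected. -/
def connectednessLocus : Set ℂ :=
  {lam | lam ∈ Metric.ball (0 : ℂ) 1 ∧ IsConnected (attractor lam)}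

/-- Normalized power series with coefficients in `{-1, 0, 1}` and constant coefficient `1`. -/
def normalizedSeries : Set (PowerSeries ℤ) :=
  {f | (∀ j, PowerSeries.coeff j f ∈ ({-1, 0, 1} : Set ℤ)) ∧ PowerSeries.coeff 0 f = 1}

/-- The normalized power series that vanish at `lam`. -/
def seriesVanishingAt (lam : ℂ) : Set (PowerSeries ℤ) :=
  {f | f ∈ normalizedSeries ∧
    HasSum (fun j => ((PowerSeries.coeff j f : ℤ) : ℂ) * lam ^ j) 0}

/-- The Taylor polynomial `∑_{j ≤ k} c_j X^j` of `f = ∑ c_j X^j`. -/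
def taylorPoly (f : PowerSeries ℤ) (k : ℕ) : Polynomial ℤ :=
  PowerSeries.trunc (k + 1) f

/-- `f = ∑_{j ≤ l} c_j X^j + (c_{l+1} X^{l+1} + ⋯ + c_{l+p} X^{l+p}) / (1 - X^p)` with `p ≥ 1`
(the denominator has been cleared; `1 - X^p` is invertible as a power series). -/
def HasRationalForm (f : PowerSeries ℤ) (l p : ℕ) : Prop :=
  1 ≤ p ∧
    (1 - PowerSeries.X ^ p) * (f - (taylorPoly f l : PowerSeries ℤ)) =
      ∑ i ∈ Finset.Icc (l + 1) (l + p), PowerSeries.monomial i (PowerSeries.coeff i f)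

/-- `f` is of rational type `(l, p)`: `l` and `p` are the minimal integers for which `f` has the
rational form above. -/
def IsRationalType (f : PowerSeries ℤ) (l p : ℕ) : Prop :=
  HasRationalForm f l p ∧ ∀ l' p', HasRationalForm f l' p' → l ≤ l' ∧ p ≤ p'

/-- The value of an integer polynomial at a complex number. -/
def evalAt (lam : ℂ) (P : Polynomial ℤ) : ℂ := Polynomial.aeval lam P

/-- `lam` is path accessible from `U`: some path ends at `lam` and stays in `U` before its end. -/
def PathAccessibleFrom (U : Set ℂ) (lam : ℂ) : Prop :=
  ∃ (a : ℂ) (γ : Path a lam), ∀ t : unitInterval, t < 1 → γ t ∈ U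

/-- `U` is a connected component of the subset `S` of the plane. -/
def IsComponentOf (S U : Set ℂ) : Prop :=
  ∃ x ∈ S, U = connectedComponentIn S x

end TwoMapIFS

end

/-! Let `c` be the coefficients of `f` and `u_k` the value at `λ` of the series shifted by `k`, so
that `λ u_{k+1} = u_k - c_k` and `f_{k-1}(λ) = -λ^k u_k`. Beyond the preperiod `c_k = ±1`, and the
conditions on Taylor polynomials yield `|u_k| + |u_k - c_k| > 1/(1-|λ|)` and `c_k Re u_k > 3/4`:
`u_k` lies outside an ellipse with foci `0`, `c_k` and inside a half-plane
(`admissible_of_taylorPoly`).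

By compactness and the uniqueness of `f`, every point of the connectedness locus near `λ` is a zero
of a series `g` agreeing with `f` up to index `l` (`exists_vanishing`, `eventually_eq_coeff`). It
suffices to approach `λ` through points `w` where no such `g` vanishes. These are prescribed by the
value `f(w)`, which runs along the polygonal line with vertices `-(2/5) λ^m u_m`, tending to `0`.
Since consecutive vertices never have a ratio on the negative real axis (`Admissible.tail_ratio`),
the line can be lifted through `f`, even at a multiple zero (`exists_local_root`,
`exists_root_along_polygon`).

If `g(w) = 0` with `f(w)` on the edge from vertex `m` to `m+1`, let `q` be the first index where `f`
and `g` differ, or `m` if there is none up to `m`. Then `f(w) = f(w) - g(w) = w^q ∑ d_j c_{q+j} w^j`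
with `d_j ∈ [0,2]`. Replacing `w` by `λ` costs `O((q+1)|w-λ|)`, which is small because `|w-λ|`
decays geometrically in `m`. Hence `5 ∑ d_j c_{q+j} λ^j` plus twice a point of the segment between
`λ^{m-q} u_m` and `λ^{m-q+1} u_{m+1}` would be nearly zero, which `Separated` forbids
(`not_vanishing`, `exists_path`). Periodicity makes the separation constant uniform in `q`.

Separation holds for every admissible sequence at every `z` with `1/2 ≤ |z| ≤ 1/√2`
(`Admissible.separates`) and is proved by a verified computation. Symmetries reduce it to the first
quadrant, which is cut into squares. On each square, the sign words surviving the ellipse and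
half-plane tests include the beginning of every admissible sequence. For each survivor, pairing with
an approximation of `u_0` (for edges, of `u_0 - 7/8`) is bounded below at the four corners, and
bilinear interpolation carries the bounds to the whole square with a second-order error
(`CellData.run_sound`, `check_sound`). -/

section

/-! ### The checker: integer arithmetic evaluated by the kernel -/

namespace CellCheck

/-- A point of the plane in fixed-point representation: `(x, y)` stands for
`((x - 2^23) + (y - 2^23) i) / 2^20`. -/
inductive Pt | mk (x y : ℕ)

/-- Signs, as seen from the previous entry or from the first one. -/
inductive Signs
  | nil
  | pos (s : Signs)
  | neg (s : Signs)

/-- Rows `(x, y, 2^25 (x + y))` for the successive powers of a point `(x, y)`. -/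
inductive Table
  | nil
  | cons (x y w : ℕ) (T : Table)

/-- Data attached to the four corners of a square cell. -/
inductive Four (α : Type) | mk (p q r t : α)

/-- A sign word together with the values of its polynomial at the four corners. -/
inductive Word | mk (s : Signs) (P : Four Pt)

/-- Coefficients of an ellipse with foci `0` and `1`. -/
inductive Ell | mk (a c d : ℕ)

/-- Subdivision tree of a square; the leaf `l 0` marks a square outside the annulus, the leaf
`l D` a square to be verified with words of length `D`. -/
inductive Cert
  | l (D : ℕ)
  | n (a b c d : Cert)

/-- Conditional choice. -/
noncomputable def sel {α : Type} (b : Bool) (x y : α) : α := Bool.rec y x b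

noncomputable def band (b c : Bool) : Bool := Bool.rec false c b

noncomputable def Pt.fst (p : Pt) : ℕ := Pt.rec (fun x _ => x) p

noncomputable def Pt.snd (p : Pt) : ℕ := Pt.rec (fun _ y => y) p

noncomputable def Four.map {α β : Type} (f : α → β) (P : Four α) : Four β :=
  Four.rec (fun p q r t => Four.mk (f p) (f q) (f r) (f t)) P

noncomputable def Four.map₂ {α β γ : Type} (f : α → β → γ) (P : Four α) (Q : Four β) : Four γ :=
  Four.rec (fun p q r t => Four.rec (fun p' q' r' t' =>
    Four.mk (f p p') (f q q') (f r r') (f t t')) Q) P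

noncomputable def Four.all {α : Type} (f : α → Bool) (P : Four α) : Bool :=
  Four.rec (fun p q r t => band (f t) (band (f p) (band (f q) (f r)))) P

noncomputable def Four.all₂ {α β : Type} (f : α → β → Bool) (P : Four α) (Q : Four β) : Bool :=
  Four.rec (fun p q r t => Four.rec (fun p' q' r' t' =>
    band (f t t') (band (f p p') (band (f q q') (f r r')))) Q) P

noncomputable def Four.sum (f : Pt → ℕ) (P : Four Pt) : ℕ :=
  Four.rec (fun p q r t => Nat.add (Nat.add (f p) (f q)) (Nat.add (f r) (f t))) P

noncomputable def sq (x : ℕ) : ℕ := Nat.mul x x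

noncomputable def dist (x y : ℕ) : ℕ := Nat.add (Nat.sub x y) (Nat.sub y x)

/-- The product of the lattice point `c / 1448` with `p`, with offset `2^24`. -/
noncomputable def mulPt (c p : Pt) : Pt :=
  Pt.rec (fun a b => Pt.rec (fun x y =>
    Pt.mk (Nat.div (Nat.add (Nat.add (Nat.mul a x) (Nat.mul b (Nat.sub 16777216 y)))
          (Nat.mul (Nat.sub 2896 (Nat.add a b)) 8388608)) 1448)
      (Nat.div (Nat.add (Nat.add (Nat.mul a y) (Nat.mul b x))
          (Nat.mul (Nat.sub 2896 (Nat.add a b)) 8388608)) 1448)) p) c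

/-- `v` comes from `mulPt` with offset `2^24`; the constants restore the offset `2^23` and insert
the unit `2^20`, as in `7340032 = 2^24 - 2^23 - 2^20`. -/
noncomputable def oneAdd (v : Pt) : Pt :=
  Pt.rec (fun x y => Pt.mk (Nat.sub x 7340032) (Nat.sub y 8388608)) v

noncomputable def oneSub (v : Pt) : Pt :=
  Pt.rec (fun x y => Pt.mk (Nat.sub 26214400 x) (Nat.sub 25165824 y)) v

noncomputable def recenter (v : Pt) : Pt :=
  Pt.rec (fun x y => Pt.mk (Nat.sub x 8388608) (Nat.sub y 8388608)) v

/-- `K` is the bound on the sum of distances to the foci `0` and `2^20`; `1099511627776 = 2^40` is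
the squared focal distance. -/
noncomputable def mkEll (K : ℕ) : Ell :=
  (fun C => (fun A => Ell.mk (Nat.mul 4 A) (Nat.mul 4 C) (Nat.mul C A))
    (Nat.sub C 1099511627776)) (sq K)

noncomputable def inEll (E : Ell) (p : Pt) : Bool :=
  Ell.rec (fun a c d => Pt.rec (fun x y =>
    Nat.blt (Nat.add (Nat.mul (sq (dist x 8912896)) a) (Nat.mul (sq (dist y 8388608)) c)) d) p) E

/-- The threshold is `2^23 + (3/4) 2^20`; `t` is the error margin. -/
noncomputable def inHalf (t : ℕ) (p : Pt) : Bool := Nat.ble (Nat.add (Pt.fst p) t) 9175040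

/-- The same test must succeed at all four corners, since only then does it pass to a weighted mean.
-/
noncomputable def pruned (E : Four Ell) (t : ℕ) (P : Four Pt) : Bool :=
  sel (Four.all₂ inEll E P) true (Four.all (inHalf t) P)

noncomputable def extend (E : Four Ell) (t : ℕ) (s : Signs) (P : Four Pt) (l : List Word) :
    List Word :=
  sel (pruned E t P) l (List.cons (Word.mk s P) l)

/-- Words grow at the front: a sequence starting with `1` is `1` followed by plus or minus a
sequence starting with `1`, so a value `P` yields `1 + zP` and `1 - zP`. -/
noncomputable def level (C : Four Pt) (E : Four Ell) (t : ℕ) (F : List Word) : List Word :=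
  List.rec List.nil (fun w _ ih => Word.rec (fun s P =>
    (fun V => extend E t (Signs.pos s) (Four.map oneAdd V)
        (extend E t (Signs.neg s) (Four.map oneSub V) ih))
      (Four.map₂ mulPt C P)) w) F

noncomputable def row (p : Pt) (T : Table) : Table :=
  Pt.rec (fun x y => Table.cons x y (Nat.mul 33554432 (Nat.add x y)) T) p

noncomputable def table (c : Pt) (n : ℕ) : Pt → Table :=
  Nat.rec (fun _ => Table.nil) (fun _ ih p => (fun v => row v (ih v)) (recenter (mulPt c p))) n

/-- Growing at the front may negate all later coefficients, so words store each sign relative to its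
predecessor; this recovers signs relative to the first one. The boolean is the current sign. -/
noncomputable def unwind (s : Signs) : Bool → Signs :=
  Signs.rec (fun _ => Signs.nil)
    (fun _ ih b => Bool.rec (Signs.neg (ih false)) (Signs.pos (ih true)) b)
    (fun _ ih b => Bool.rec (Signs.pos (ih true)) (Signs.neg (ih false)) b) s

noncomputable def maxNat (a b : ℕ) : ℕ := sel (Nat.ble a b) b a

/-- `g - h` is the pairing of the direction `(X, Y)` with a row. The accumulators hold the positive
parts, the negative parts and the largest prefix sum of the signed pairings; `k` judges the result.
-/
noncomputable def fold (X Y W : ℕ) (k : ℕ → ℕ → ℕ → Bool) (s : Signs) :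
    Table → ℕ → ℕ → ℕ → Bool :=
  Signs.rec (fun _ pos neg mx => k pos neg mx)
    (fun _ ih T pos neg mx => Table.rec false (fun x y w T _ =>
      (fun g h => ih T (Nat.add pos (Nat.sub g h)) (Nat.add neg (Nat.sub h g))
          (maxNat mx (Nat.sub pos neg)))
        (Nat.add (Nat.add (Nat.mul X x) (Nat.mul Y y)) 562949953421312) (Nat.add W w)) T)
    (fun _ ih T pos neg mx => Table.rec false (fun x y w T _ =>
      (fun g h => ih T (Nat.add pos (Nat.sub h g)) (Nat.add neg (Nat.sub g h))
          (maxNat mx (Nat.sub pos neg)))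
        (Nat.add (Nat.add (Nat.mul X x) (Nat.mul Y y)) 562949953421312) (Nat.add W w)) T) s

noncomputable def foldAll (T : Four Table) (err X Y : ℕ) (k : ℕ → ℕ → ℕ → ℕ → Bool)
    (s : Signs) : Bool :=
  (fun W b => Four.all (fun t => fold X Y W (k b) s t 0 0 0) T)
    (Nat.mul 8388608 (Nat.add X Y))
    (Nat.mul err (Nat.add (sq (dist X 33554432)) (sq (dist Y 33554432))))

/-- The worst digits contribute `-10 neg`, the summands from index `n` on at least `2 (pos - neg -
max prefix)`, and the leading digit at least `5 · 2^20 · Re e`. The square of this total must beat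
the squared error `b`; truncation to zero makes the test fail. -/
noncomputable def finalA (X b pos neg mx : ℕ) : Bool :=
  Nat.blt b (sq (Nat.sub (Nat.add (Nat.mul 5242880 (Nat.sub X 33554432)) (Nat.mul 2 pos))
    (Nat.add (Nat.mul 12 neg) (Nat.mul 2 (maxNat mx (Nat.sub pos neg))))))

/-- For `n ≤ 1` no prefix is lost; the constant term has weight `0` or `2` and costs at most `2 ·
2^20 · max 0 (-Re e)`. -/
noncomputable def finalB (X b pos neg _mx : ℕ) : Bool :=
  Nat.blt b (sq (Nat.sub (Nat.mul 2 pos)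
    (Nat.add (Nat.mul 12 neg) (Nat.mul 2097152 (Nat.sub 33554432 X)))))

/-- The sum of the corner values is four times an approximation of the series value `u`, with offset
`2^25`. Since `3670016 = 4 · (7/8) · 2^20`, the second direction approximates `4 (u - 7/8)`. -/
noncomputable def goodWord (T : Four Table) (err : ℕ) (w : Word) : Bool :=
  Word.rec (fun s P =>
    (fun X X' Y s => band (foldAll T err X Y (finalA X) s) (foldAll T err X' Y (finalB X') s))
      (Four.sum Pt.fst P) (Nat.sub (Four.sum Pt.fst P) 3670016) (Four.sum Pt.snd P)
      (unwind s true)) w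

noncomputable def allGood (T : Four Table) (err : ℕ) (F : List Word) : Bool :=
  List.rec true (fun w _ ih => band (goodWord T err w) ih) F

/-- `E` bounds the interpolation error and `tail` the truncation error at word length `D`; each
level multiplies `tail` by `r / 1448`, a bound for `|z|`. The `8` is the rounding error of one
fixed-point value. -/
noncomputable def run (C : Four Pt) (K : Four ℕ) (T : Four Table) (E r n : ℕ) :
    ℕ → ℕ → List Word → Bool :=
  Nat.rec
    (fun D tail F => allGood T (Nat.mul 144 (sq (Nat.add (Nat.add E tail) (Nat.mul 8 D)))) F)
    (fun _ ih D tail F =>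
      (fun tail => (fun t => ih (Nat.succ D) tail
          (level C (Four.map (fun k => mkEll (Nat.sub k (Nat.mul 2 t))) K) t F))
        (Nat.add (Nat.add tail E) 8))
      (Nat.add (Nat.div (Nat.mul tail r) 1448) 1)) n

noncomputable def sqrtAux (n k : ℕ) : ℕ → ℕ → ℕ :=
  Nat.rec (fun _ r => r)
    (fun _ ih b r => ih (Nat.div b 2) (sel (Nat.ble (sq (Nat.add r b)) n) (Nat.add r b) r)) k

/-- An upper bound for the square root (this is checked where it is used). -/
noncomputable def sqrtUp (n : ℕ) : ℕ := Nat.add (sqrtAux n 13 4096 0) 1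

/-- An affine minorant of `2^20 / (1 - |z|)` taken at a corner: the tangent of `1/(1-r)` at `r =
m/2896`, about the modulus of the cell's centre, composed with the projection of `z` on the
direction of the centre. -/
noncomputable def cornerK (cx cy m : ℕ) (c : Pt) : ℕ :=
  Pt.rec (fun a b => (fun d => Nat.div
      (Nat.mul 6073352192 (Nat.sub (Nat.add (Nat.mul d m) (Nat.add (Nat.mul cx a) (Nat.mul cy b)))
        (Nat.mul m 1448)))
      (Nat.mul (Nat.mul d d) m)) (Nat.sub 2896 m)) c

noncomputable def one : Pt := Pt.mk 9437184 8388608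

/-- `q`, `p`, `m` are proposed upper bounds for `1448 |z|` and `1448 |1 + z|` on the cell and for
`2896` times the modulus of its centre; the guards verify them. -/
noncomputable def cellAux (C : Four Pt) (cx cy xs ys s D q p m r : ℕ) : Bool :=
  band (Nat.ble (Nat.add (sq xs) (sq ys)) (sq q)) (band (Nat.ble (Nat.mul 5 q) 5792)
  (band (Nat.ble (Nat.add (sq (Nat.add 1448 xs)) (sq ys)) (sq p))
  (band (Nat.ble (Nat.add (sq cx) (sq cy)) (sq m))
    (run C (Four.map (cornerK cx cy m) C) (Four.map (fun c => table c D one) C)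
      (Nat.add (Nat.div (Nat.mul 1518338048 (sq s)) (Nat.mul 2 (Nat.mul (Nat.sub 1448 q)
        (sq (Nat.sub 1448 q))))) 1) r (Nat.pred D) 1
      (Nat.add (Nat.div (Nat.mul (Nat.add (Nat.div (Nat.mul 1518338048 p)
        (Nat.sub 2096704 (sq r))) 1) r) 1448) 1)
      (List.cons (Word.mk Signs.nil (Four.mk one one one one)) List.nil)))))

noncomputable def cell (x y s D : ℕ) : Bool :=
  (fun xs ys cx cy => (fun q => cellAux
      (Four.mk (Pt.mk x y) (Pt.mk xs y) (Pt.mk x ys) (Pt.mk xs ys)) cx cy xs ys s D q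
      (sqrtUp (Nat.add (sq (Nat.add 1448 xs)) (sq ys)))
      (sqrtUp (Nat.add (sq cx) (sq cy)))
      (sel (Nat.ble q 1024) q 1024))
    (sqrtUp (Nat.add (sq xs) (sq ys))))
  (Nat.add x s) (Nat.add y s) (Nat.add (Nat.mul 2 x) s) (Nat.add (Nat.mul 2 y) s)

noncomputable def outside (x y s : ℕ) : Bool :=
  sel (Nat.blt 2096704 (Nat.mul 2 (Nat.add (sq x) (sq y)))) true
    (Nat.blt (Nat.mul 4 (Nat.add (sq (Nat.add x s)) (sq (Nat.add y s)))) 2096704)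

noncomputable def check (T : Cert) : ℕ → ℕ → ℕ → Bool :=
  Cert.rec (fun D x y s => Nat.rec (outside x y s) (fun _ _ => cell x y s D) D)
    (fun _ _ _ _ ha hb hc hd x y s => (fun h =>
      band (Nat.beq (Nat.mul 2 h) s) (band (ha x y h) (band (hb (Nat.add x h) y h)
        (band (hc x (Nat.add y h) h) (hd (Nat.add x h) (Nat.add y h) h))))) (Nat.div s 2)) T

end CellCheck

end

/-! ### Subdivision certificates and their evaluation -/

section

namespace CellCheck
open Cert

/-! Certificates for the squares of side `256/1448` that meet the annulus `1/2 ≤ |z| ≤ 1/√2` in the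
first quadrant, named by their lower left corners. -/

def cert_256_256 : Cert :=
    n (l 0) (l 0) (l 0) (n (l 0) (l 0) (l 0) (l 6))

theorem check_cert_256_256 : check cert_256_256 256 256 256 = true := by decide +kernel

def cert_512_0 : Cert :=
    n (l 0) (l 6) (l 0) (l 7)

theorem check_cert_512_0 : check cert_512_0 512 0 256 = true := by decide +kernel

def cert_768_0 : Cert :=
    n (l 8) (l 12) (l 9) (l 14)

theorem check_cert_768_0 : check cert_768_0 768 0 256 = true := by decide +kernel

def cert_512_256 : Cert :=
    n (l 7) (l 8) (n (l 5) (l 6) (l 6) (l 7)) (n (l 7) (l 7) (l 8) (l 11))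

theorem check_cert_512_256 : check cert_512_256 512 256 256 = true := by decide +kernel

def cert_768_256 : Cert :=
    n (l 15) (n (l 9) (l 9) (l 9) (l 9)) (n (l 8) (l 12) (n (l 7) (l 8) (l 11) (l 12)) (n (l 11)
    (n (l 8) (l 12) (l 12) (l 18)) (n (l 10) (l 13) (l 17) (l 16)) (n (n (l 12) (l 17) (l 17) (l
    17)) (n (l 17) (l 18) (l 18) (n (l 17) (l 17) (l 15) (l 15))) (n (l 15) (l 16) (l 16) (l
    16)) (l 16)))) (n (n (l 8) (l 8) (l 13) (n (l 13) (l 0) (l 18) (l 0))) (l 0) (n (n (l 16) (n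
    (l 13) (l 16) (l 18) (l 0)) (n (l 17) (l 18) (n (l 17) (l 17) (l 17) (l 17)) (n (l 18) (l
    18) (l 17) (l 0))) (n (n (l 18) (l 0) (l 0) (l 0)) (l 0) (l 0) (l 0))) (l 0) (n (n (n (l 17)
    (l 17) (l 17) (n (l 17) (l 18) (l 15) (l 0))) (n (l 18) (l 0) (l 0) (l 0)) (l 17) (l 0)) (l
    0) (l 0) (l 0)) (l 0)) (l 0))

theorem check_cert_768_256 : check cert_768_256 768 256 256 = true := by decide +kernel

def cert_0_512 : Cert :=
    n (l 0) (l 0) (n (l 0) (l 0) (l 6) (l 9)) (n (l 6) (l 6) (l 8) (l 6))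

theorem check_cert_0_512 : check cert_0_512 0 512 256 = true := by decide +kernel

def cert_256_512 : Cert :=
    n (n (l 0) (l 0) (l 0) (l 6)) (n (l 10) (l 8) (l 7) (l 8)) (n (l 6) (l 7) (l 8) (l 8)) (n (l
    8) (l 9) (l 12) (l 10))

theorem check_cert_256_512 : check cert_256_512 256 512 256 = true := by decide +kernel

def cert_0_768 : Cert :=
    n (n (l 6) (l 11) (l 8) (l 12)) (n (l 10) (l 8) (l 10) (n (l 8) (l 8) (l 8) (l 8))) (n (l
    10) (n (l 8) (l 8) (l 8) (l 10)) (l 12) (l 16)) (n (n (l 9) (l 8) (l 10) (l 9)) (n (l 10) (l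
    10) (l 10) (l 12)) (n (l 11) (l 13) (l 11) (l 11)) (n (l 10) (l 12) (l 13) (n (l 9) (l 11)
    (l 0) (l 0))))

theorem check_cert_0_768 : check cert_0_768 0 768 256 = true := by decide +kernel

def cert_256_768 : Cert :=
    n (n (l 9) (l 17) (l 11) (n (l 9) (l 10) (l 9) (l 10))) (n (n (l 8) (l 9) (l 9) (l 9)) (n (l
    10) (l 12) (l 14) (l 15)) (n (l 9) (l 11) (l 9) (l 13)) (n (l 14) (n (l 16) (l 17) (l 16) (n
    (l 16) (l 13) (l 16) (l 16))) (l 16) (n (l 13) (l 16) (l 16) (l 16)))) (n (n (l 8) (l 10) (n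
    (l 10) (l 10) (l 10) (l 12)) (n (l 10) (l 11) (l 13) (l 11))) (n (l 10) (l 11) (l 13) (l
    11)) (n (n (l 12) (l 15) (l 17) (l 17)) (n (l 13) (l 16) (l 14) (l 15)) (l 0) (l 0)) (n (n
    (n (l 11) (l 11) (l 15) (l 13)) (l 11) (l 0) (l 0)) (n (l 10) (l 0) (l 0) (l 0)) (l 0) (l
    0))) (n (n (l 11) (l 12) (l 12) (l 12)) (n (l 18) (l 16) (l 0) (l 0)) (l 0) (l 0))

theorem check_cert_256_768 : check cert_256_768 256 768 256 = true := by decide +kernel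

def cert_512_512 : Cert :=
    n (n (l 14) (l 18) (n (l 8) (l 8) (l 7) (l 7)) (l 13)) (n (n (l 8) (l 9) (l 11) (l 11)) (n
    (l 10) (l 18) (l 11) (l 12)) (l 13) (n (l 12) (l 14) (l 12) (l 13))) (n (n (l 7) (l 7) (l 8)
    (l 9)) (l 13) (l 11) (n (l 13) (n (l 9) (l 10) (l 10) (l 10)) (l 9) (n (l 10) (l 11) (l 9)
    (l 11)))) (n (n (l 9) (l 11) (l 9) (l 11)) (n (n (l 11) (l 15) (l 10) (l 11)) (n (l 14) (n
    (l 14) (l 14) (l 13) (l 14)) (l 14) (n (l 16) (l 17) (l 13) (l 15))) (l 12) (l 14)) (n (l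
    14) (l 14) (n (l 11) (l 15) (l 14) (l 15)) (n (n (l 13) (l 14) (l 13) (l 14)) (l 17) (l 16)
    (n (n (l 15) (l 15) (l 13) (l 0)) (l 0) (l 0) (l 0)))) (n (l 17) (n (l 13) (l 0) (l 0) (l
    0)) (n (l 17) (l 0) (l 0) (l 0)) (l 0)))

theorem check_cert_512_512 : check cert_512_512 512 512 256 = true := by decide +kernel

def cert_768_512 : Cert :=
    n (n (n (n (l 11) (l 12) (l 11) (l 12)) (n (l 13) (l 15) (l 12) (l 12)) (l 14) (l 17)) (n (n
    (l 15) (l 15) (l 17) (l 17)) (l 18) (l 18) (n (l 18) (l 0) (l 0) (l 0))) (n (n (l 15) (l 15)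
    (l 11) (l 13)) (n (l 16) (l 17) (l 13) (l 18)) (l 15) (l 16)) (n (n (l 18) (l 0) (n (l 18)
    (l 0) (l 0) (l 0)) (l 0)) (l 0) (l 0) (l 0))) (l 0) (n (n (n (n (l 14) (l 14) (l 16) (n (l
    16) (l 15) (l 15) (l 16))) (n (l 14) (l 14) (n (l 15) (l 15) (l 17) (n (l 16) (l 0) (l 0) (l
    0))) (n (l 14) (l 0) (l 0) (l 0))) (n (l 16) (l 14) (l 16) (n (l 17) (l 0) (l 0) (l 0))) (n
    (l 16) (l 0) (l 0) (l 0))) (l 0) (n (n (l 14) (l 0) (l 0) (l 0)) (l 0) (l 0) (l 0)) (l 0))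
    (l 0) (l 0) (l 0)) (l 0)

theorem check_cert_768_512 : check cert_768_512 768 512 256 = true := by decide +kernel

def cert_512_768 : Cert :=
    n (n (n (l 11) (l 10) (n (l 12) (l 12) (l 11) (l 13)) (n (l 12) (l 10) (l 17) (l 13))) (n (l
    10) (l 11) (l 17) (l 13)) (n (n (l 15) (l 14) (l 18) (n (l 15) (l 13) (l 17) (l 16))) (n (l
    16) (n (l 16) (l 13) (l 17) (n (l 15) (l 14) (l 16) (l 15))) (l 15) (n (l 14) (n (l 16) (l
    16) (l 0) (l 0)) (l 13) (l 0))) (n (n (l 17) (l 17) (l 16) (l 17)) (n (l 17) (l 17) (l 16)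
    (l 16)) (l 16) (l 0)) (n (n (l 16) (l 0) (l 0) (l 0)) (l 0) (l 0) (l 0))) (n (n (l 16) (l
    15) (l 0) (l 0)) (l 0) (l 0) (l 0))) (n (n (n (l 12) (n (l 13) (l 15) (l 12) (l 13)) (l 11)
    (l 12)) (n (n (l 15) (l 0) (l 0) (l 0)) (l 0) (l 0) (l 0)) (l 0) (l 0)) (l 0) (l 0) (l 0))
    (l 0) (l 0)

theorem check_cert_512_768 : check cert_512_768 512 768 256 = true := by decide +kernel

/-- The certificate for the square of side `1024/1448` at the origin. -/
def cert : Cert :=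
    n (n (l 0) (l 0) (l 0) cert_256_256) (n cert_512_0 cert_768_0 cert_512_256 cert_768_256) (n
    cert_0_512 cert_256_512 cert_0_768 cert_256_768) (n cert_512_512 cert_768_512 cert_512_768
    (l 0))

end CellCheck

end

/-! ### Power series with bounded coefficients and interpolation estimates -/

section

open Finset

namespace TwoMapIFS

/-- The power series with real coefficients `c`, evaluated at `z`. -/
noncomputable def ser (c : ℕ → ℝ) (z : ℂ) : ℂ := ∑' j, (c j : ℂ) * z ^ j

/-- The tail of a sequence. -/
def shift (n : ℕ) (c : ℕ → ℝ) : ℕ → ℝ := fun j => c (n + j)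

/-- The real inner product of two complex numbers. -/
noncomputable def ip (e z : ℂ) : ℝ := e.re * z.re + e.im * z.im

lemma ip_eq_re (e z : ℂ) : ip e z = ((starRingEnd ℂ) e * z).re := by
  simp [ip, Complex.mul_re]

lemma ip_add (e z w : ℂ) : ip e (z + w) = ip e z + ip e w := by simp [ip]; ring

lemma ip_sub (e z w : ℂ) : ip e (z - w) = ip e z - ip e w := by simp [ip]; ring

lemma ip_smul (e z : ℂ) (a : ℝ) : ip e ((a : ℂ) * z) = a * ip e z := by simp [ip]; ring

lemma ip_sum {ι : Type*} (s : Finset ι) (e : ℂ) (f : ι → ℂ) :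
    ip e (∑ i ∈ s, f i) = ∑ i ∈ s, ip e (f i) := by
  classical
  induction s using Finset.induction_on with
  | empty => simp [ip]
  | insert i s hi ih => rw [sum_insert hi, sum_insert hi, ip_add, ih]

lemma abs_ip_le (e z : ℂ) : |ip e z| ≤ ‖e‖ * ‖z‖ := by
  rw [ip_eq_re]
  refine (Complex.abs_re_le_norm _).trans ?_
  simp

lemma summable_ser {c : ℕ → ℝ} {M : ℝ} (hc : ∀ j, |c j| ≤ M) {z : ℂ} (hz : ‖z‖ < 1) :
    Summable fun j => (c j : ℂ) * z ^ j := by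
  refine Summable.of_norm_bounded
    (g := fun j => M * ‖z‖ ^ j) ((summable_geometric_of_lt_one (norm_nonneg _) hz).mul_left M) ?_
  intro j
  rw [norm_mul, norm_pow, Complex.norm_real, Real.norm_eq_abs]
  exact mul_le_mul_of_nonneg_right (hc j) (by positivity)

lemma ser_eq_sum_add {c : ℕ → ℝ} {M : ℝ} (hc : ∀ j, |c j| ≤ M) {z : ℂ} (hz : ‖z‖ < 1) (n : ℕ) :
    ser c z = ∑ j ∈ range n, (c j : ℂ) * z ^ j + z ^ n * ser (shift n c) z := by
  rw [ser, ← (summable_ser hc hz).sum_add_tsum_nat_add n, ser, ← tsum_mul_left]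
  congr 2
  ext j
  rw [shift, add_comm j n, pow_add]
  ring

lemma ser_eq_head_add {c : ℕ → ℝ} {M : ℝ} (hc : ∀ j, |c j| ≤ M) {z : ℂ} (hz : ‖z‖ < 1) :
    ser c z = c 0 + z * ser (shift 1 c) z := by
  rw [ser_eq_sum_add hc hz 1]
  simp

lemma norm_ser_le {c : ℕ → ℝ} {M : ℝ} (hc : ∀ j, |c j| ≤ M) {z : ℂ} (hz : ‖z‖ < 1) :
    ‖ser c z‖ ≤ M / (1 - ‖z‖) := by
  have h := tsum_of_norm_bounded (f := fun j => (c j : ℂ) * z ^ j)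
    ((hasSum_geometric_of_lt_one (norm_nonneg z) hz).mul_left M) (by
      intro j
      rw [norm_mul, norm_pow, Complex.norm_real, Real.norm_eq_abs]
      exact mul_le_mul_of_nonneg_right (hc j) (by positivity))
  rwa [← div_eq_mul_inv] at h

/-- In `|a + bz|²` the product `ab` carries the nonnegative factor `2 Re z`, so `a = b = M` is
extremal. -/
lemma norm_add_mul_le {a b M : ℝ} (ha : |a| ≤ M) (hb : |b| ≤ M) {z : ℂ} (hz : 0 ≤ z.re) :
    ‖(a : ℂ) + b * z‖ ≤ M * ‖1 + z‖ := by
  have hM : 0 ≤ M := (abs_nonneg a).trans ha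
  refine le_of_sq_le_sq ?_ (by positivity)
  rw [mul_pow, ← Complex.normSq_eq_norm_sq, ← Complex.normSq_eq_norm_sq, Complex.normSq_apply,
    Complex.normSq_apply]
  simp only [Complex.add_re, Complex.add_im, Complex.ofReal_re, Complex.ofReal_im, Complex.mul_re,
    Complex.mul_im, Complex.one_re, Complex.one_im]
  have h1 : a ^ 2 ≤ M ^ 2 := sq_le_sq' (abs_le.1 ha).1 (abs_le.1 ha).2
  have h2 : b ^ 2 ≤ M ^ 2 := sq_le_sq' (abs_le.1 hb).1 (abs_le.1 hb).2
  have h3 : a * b ≤ M ^ 2 := by nlinarith [sq_nonneg (a - b)]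
  nlinarith [mul_le_mul_of_nonneg_right h3 hz,
    mul_le_mul_of_nonneg_right h2 (add_nonneg (sq_nonneg z.re) (sq_nonneg z.im))]

/-- Grouping the terms `2i` and `2i+1` leaves a geometric series of ratio `|z|²`. This improves on
`M/(1-|z|)` because `|1+z| ≤ 1+|z|`. -/
lemma norm_ser_le_of_re_nonneg {c : ℕ → ℝ} {M : ℝ} (hc : ∀ j, |c j| ≤ M) {z : ℂ} (hz : ‖z‖ < 1)
    (hre : 0 ≤ z.re) : ‖ser c z‖ ≤ M * ‖1 + z‖ / (1 - ‖z‖ ^ 2) := by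
  have hM : 0 ≤ M := (abs_nonneg _).trans (hc 0)
  have hlim := (summable_ser hc hz).hasSum.tendsto_sum_nat.comp
    (Filter.tendsto_id.const_mul_atTop' (show 0 < 2 by norm_num))
  refine le_of_tendsto hlim.norm (Filter.Eventually.of_forall fun n => ?_)
  have hsq : ‖z‖ ^ 2 < 1 := by nlinarith [norm_nonneg z]
  have hpart : ∀ n : ℕ, ∑ j ∈ range (2 * n), (c j : ℂ) * z ^ j =
      ∑ i ∈ range n, ((c (2 * i) : ℂ) + c (2 * i + 1) * z) * z ^ (2 * i) := by
    intro n
    induction n with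
    | zero => simp
    | succ n ih =>
      rw [show 2 * (n + 1) = 2 * n + 1 + 1 by ring, sum_range_succ, sum_range_succ, ih,
        sum_range_succ]
      ring
  simp only [Function.comp, id]
  rw [hpart]
  calc ‖∑ i ∈ range n, ((c (2 * i) : ℂ) + c (2 * i + 1) * z) * z ^ (2 * i)‖
      ≤ ∑ i ∈ range n, M * ‖1 + z‖ * (‖z‖ ^ 2) ^ i := by
        refine norm_sum_le_of_le _ fun i _ => ?_
        rw [norm_mul, norm_pow, pow_mul]
        exact mul_le_mul_of_nonneg_right (norm_add_mul_le (hc _) (hc _) hre) (by positivity)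
    _ = M * ‖1 + z‖ * ∑ i ∈ range n, (‖z‖ ^ 2) ^ i := by rw [mul_sum]
    _ ≤ M * ‖1 + z‖ * (1 - ‖z‖ ^ 2)⁻¹ := by
        refine mul_le_mul_of_nonneg_left ?_ (by positivity)
        rw [← tsum_geometric_of_lt_one (by positivity) hsq]
        exact (summable_geometric_of_lt_one (by positivity) hsq).sum_le_tsum _
          fun _ _ => by positivity
    _ = _ := by rw [div_eq_mul_inv]

/-- The Taylor remainders satisfy `R_{j+1} = z R_j + j w^{j-1} (z-w)²`, and Pascal's rule sums the
coefficients. -/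
lemma norm_pow_sub_le {z w : ℂ} {ρ : ℝ} (hz : ‖z‖ ≤ ρ) (hw : ‖w‖ ≤ ρ) (j : ℕ) :
    ‖z ^ j - w ^ j - j * w ^ (j - 1) * (z - w)‖ ≤
      (j.choose 2 : ℝ) * ρ ^ (j - 2) * ‖z - w‖ ^ 2 := by
  have hρ : 0 ≤ ρ := (norm_nonneg z).trans hz
  induction j with
  | zero => simp
  | succ j ih =>
    have key : z ^ (j + 1) - w ^ (j + 1) - ((j + 1 : ℕ) : ℂ) * w ^ (j + 1 - 1) * (z - w) =
        z * (z ^ j - w ^ j - j * w ^ (j - 1) * (z - w)) + j * w ^ (j - 1) * (z - w) ^ 2 := by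
      rcases j with _ | j
      · simp
      · simp only [Nat.add_sub_cancel]
        push_cast
        ring
    rw [key]
    refine (norm_add_le _ _).trans ?_
    have h1 : ‖z * (z ^ j - w ^ j - j * w ^ (j - 1) * (z - w))‖ ≤
        ρ * ((j.choose 2 : ℝ) * ρ ^ (j - 2) * ‖z - w‖ ^ 2) := by
      rw [norm_mul]
      exact mul_le_mul hz ih (norm_nonneg _) hρ
    have h2 : ‖(j : ℂ) * w ^ (j - 1) * (z - w) ^ 2‖ ≤ j * ρ ^ (j - 1) * ‖z - w‖ ^ 2 := by
      rw [norm_mul, norm_mul, norm_pow, norm_pow, Complex.norm_natCast]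
      gcongr
    refine (add_le_add h1 h2).trans (le_of_eq ?_)
    rcases j with _ | _ | j
    · simp
    · simp
    · have : ((j + 1 + 1 + 1).choose 2 : ℝ) = (j + 1 + 1).choose 2 + (j + 1 + 1 : ℕ) := by
        rw [Nat.choose_succ_succ' (j + 1 + 1) 1, Nat.choose_one_right]
        push_cast; ring
      rw [this]
      simp only [Nat.add_sub_cancel, show j + 1 + 1 + 1 - 2 = j + 1 by omega]
      simp only [show j + 1 + 1 - 2 = j by omega]
      ring

lemma sum_choose_two_le {ρ : ℝ} (h0 : 0 ≤ ρ) (h1 : ρ < 1) (n : ℕ) :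
    ∑ j ∈ range n, (j.choose 2 : ℝ) * ρ ^ (j - 2) ≤ 1 / (1 - ρ) ^ 3 := by
  have hρ : ‖ρ‖ < 1 := by rwa [Real.norm_of_nonneg h0]
  have hs := summable_choose_mul_geometric_of_norm_lt_one 2 hρ
  have ht := tsum_choose_mul_geometric_of_norm_lt_one 2 hρ
  rw [show (2 : ℕ) + 1 = 3 by norm_num] at ht
  rw [← ht]
  calc ∑ j ∈ range n, (j.choose 2 : ℝ) * ρ ^ (j - 2)
      ≤ ∑ j ∈ range (n + 2), (j.choose 2 : ℝ) * ρ ^ (j - 2) :=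
        sum_le_sum_of_subset_of_nonneg (range_subset_range.2 (by omega))
          fun _ _ _ => by positivity
    _ = ∑ j ∈ range n, ((j + 2).choose 2 : ℝ) * ρ ^ j := by
        rw [sum_range_succ', sum_range_succ']
        simp
    _ ≤ _ := hs.sum_le_tsum _ fun _ _ => by positivity

/-- The weights have barycentre `z`, so first-order terms cancel and only the variance `V` remains,
times `∑ C(j,2) ρ^{j-2} ≤ 1/(1-ρ)^3`. -/
lemma norm_interp_sub_le {ι : Type*} [Fintype ι] {w : ι → ℝ} (hw0 : ∀ i, 0 ≤ w i)
    (hw1 : ∑ i, w i = 1) {p : ι → ℂ} {z : ℂ} (hz : ∑ i, (w i : ℂ) * p i = z) {ρ : ℝ}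
    (hp : ∀ i, ‖p i‖ ≤ ρ) (hzρ : ‖z‖ ≤ ρ) (hρ : ρ < 1) {V : ℝ} (hV : ∑ i, w i * ‖p i - z‖ ^ 2 ≤ V)
    {b : ℕ → ℝ} {M : ℝ} (hb : ∀ j, |b j| ≤ M) (n : ℕ) :
    ‖∑ i, (w i : ℂ) * ∑ j ∈ range n, (b j : ℂ) * p i ^ j - ∑ j ∈ range n, (b j : ℂ) * z ^ j‖ ≤
      M * (V / (1 - ρ) ^ 3) := by
  have h0 : 0 ≤ ρ := (norm_nonneg z).trans hzρ
  have hM : 0 ≤ M := (abs_nonneg _).trans (hb 0)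
  have hw1' : ∑ i, (w i : ℂ) = 1 := by exact_mod_cast hw1
  have hterm : ∀ j, ‖∑ i, (w i : ℂ) * p i ^ j - z ^ j‖ ≤
      (j.choose 2 : ℝ) * ρ ^ (j - 2) * V := by
    intro j
    have h1 : ∑ i, (w i : ℂ) * p i ^ j - z ^ j =
        ∑ i, (w i : ℂ) * (p i ^ j - z ^ j - j * z ^ (j - 1) * (p i - z)) := by
      have : ∑ i, (w i : ℂ) * (p i - z) = 0 := by
        simp only [mul_sub, sum_sub_distrib]
        rw [hz, ← sum_mul, hw1', one_mul, sub_self]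
      calc ∑ i, (w i : ℂ) * p i ^ j - z ^ j
          = ∑ i, (w i : ℂ) * p i ^ j - (∑ i, (w i : ℂ)) * z ^ j
            - j * z ^ (j - 1) * ∑ i, (w i : ℂ) * (p i - z) := by rw [hw1', this]; ring
        _ = _ := by
          rw [sum_mul, mul_sum, ← sum_sub_distrib, ← sum_sub_distrib]
          exact sum_congr rfl fun i _ => by ring
    rw [h1]
    calc _ ≤ ∑ i, (j.choose 2 : ℝ) * ρ ^ (j - 2) * (w i * ‖p i - z‖ ^ 2) := by
          refine norm_sum_le_of_le _ fun i _ => ?_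
          rw [norm_mul, Complex.norm_real, Real.norm_of_nonneg (hw0 i)]
          calc _ ≤ w i * ((j.choose 2 : ℝ) * ρ ^ (j - 2) * ‖p i - z‖ ^ 2) :=
                mul_le_mul_of_nonneg_left (norm_pow_sub_le (hp i) hzρ j) (hw0 i)
            _ = _ := by ring
      _ ≤ _ := by
          rw [← mul_sum]
          exact mul_le_mul_of_nonneg_left hV (by positivity)
  have hV0 : 0 ≤ V := le_trans (sum_nonneg fun i _ => mul_nonneg (hw0 i) (by positivity)) hV
  have h2 : ∑ i, (w i : ℂ) * ∑ j ∈ range n, (b j : ℂ) * p i ^ j - ∑ j ∈ range n, (b j : ℂ) * z ^ j =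
      ∑ j ∈ range n, (b j : ℂ) * (∑ i, (w i : ℂ) * p i ^ j - z ^ j) := by
    simp only [mul_sub, sum_sub_distrib, mul_sum]
    rw [sum_comm]
    congr 1
    exact sum_congr rfl fun j _ => sum_congr rfl fun i _ => by ring
  rw [h2]
  calc _ ≤ ∑ j ∈ range n, M * V * ((j.choose 2 : ℝ) * ρ ^ (j - 2)) := by
        refine norm_sum_le_of_le _ fun j _ => ?_
        rw [norm_mul, Complex.norm_real, Real.norm_eq_abs]
        calc _ ≤ M * ((j.choose 2 : ℝ) * ρ ^ (j - 2) * V) :=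
              mul_le_mul (hb j) (hterm j) (norm_nonneg _) hM
          _ = _ := by ring
    _ ≤ M * V * (1 / (1 - ρ) ^ 3) := by
        rw [← mul_sum]
        exact mul_le_mul_of_nonneg_left (sum_choose_two_le h0 hρ n) (by positivity)
    _ = _ := by ring

end TwoMapIFS

end

/-! ### Admissible sequences, separation, and transfer from corners -/

section

open Finset

namespace TwoMapIFS

/-- A sequence of signs all of whose tails satisfy the two lower bounds at `z`. -/
def Admissible (z : ℂ) (c : ℕ → ℝ) : Prop :=
  (∀ j, c j = 1 ∨ c j = -1) ∧ ∀ k,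
    1 / (1 - ‖z‖) < ‖ser (shift k c) z‖ + ‖z‖ * ‖ser (shift (k + 1) c) z‖ ∧
      3 / 4 < c k * (ser (shift k c) z).re

/-- A linear functional separates the partial sums with digits in `[0, 2]` and leading digit at
least `1` from `-2/5` times every tail. -/
def SeparatesTails (z : ℂ) (c : ℕ → ℝ) : Prop :=
  ∃ (e : ℂ) (η : ℝ), 0 < η ∧ ∀ d : ℕ → ℝ, (∀ j, 0 ≤ d j ∧ d j ≤ 2) → 1 ≤ d 0 → ∀ n : ℕ,
    η ≤ ip e (ser (fun j => (5 * d j + if n ≤ j then 2 else 0) * c j) z)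

/-- A linear functional separates the sums with digits in `[0, 2]` and leading digit `0` from
`-2/5` times the first two tails. -/
def SeparatesEdge (z : ℂ) (c : ℕ → ℝ) : Prop :=
  ∃ (e : ℂ) (η : ℝ), 0 < η ∧ ∀ d : ℕ → ℝ, (∀ j, 0 ≤ d j ∧ d j ≤ 2) → d 0 = 0 → ∀ n : ℕ, n ≤ 1 →
    η ≤ ip e (ser (fun j => (5 * d j + if n ≤ j then 2 else 0) * c j) z)

lemma shift_shift (m n : ℕ) (c : ℕ → ℝ) : shift m (shift n c) = shift (n + m) c := by
  funext j; simp [shift, add_assoc]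

lemma shift_zero (c : ℕ → ℝ) : shift 0 c = c := by
  funext j; simp [shift]

lemma ser_neg (c : ℕ → ℝ) (z : ℂ) : ser (fun j => -c j) z = -ser c z := by
  simp [ser, tsum_neg]

lemma Admissible.abs_le {z : ℂ} {c : ℕ → ℝ} (h : Admissible z c) (j : ℕ) : |c j| ≤ 1 := by
  rcases h.1 j with h | h <;> simp [h]

lemma Admissible.tail {z : ℂ} {c : ℕ → ℝ} (h : Admissible z c) (n : ℕ) :
    Admissible z (shift n c) := by
  refine ⟨fun j => h.1 _, fun k => ?_⟩
  rw [shift_shift, shift_shift]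
  exact h.2 (n + k)

lemma Admissible.neg {z : ℂ} {c : ℕ → ℝ} (h : Admissible z c) :
    Admissible z (fun j => -c j) := by
  refine ⟨fun j => ?_, fun k => ?_⟩
  · rcases h.1 j with h | h <;> simp [h]
  · have : ∀ n, shift n (fun j => -c j) = fun j => -shift n c j :=
      fun n => rfl
    rw [this, this, ser_neg, ser_neg, norm_neg, norm_neg, Complex.neg_re]
    simpa using h.2 k

/-- Interpolation of power series at `z` from their partial sums at the points `p i`. -/
structure Interpolates (z : ℂ) (p : Fin 4 → ℂ) (w : Fin 4 → ℝ) (n : ℕ) (E : ℝ) : Prop where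
  nonneg : ∀ i, 0 ≤ w i
  sum_eq : ∑ i, w i = 1
  approx : ∀ (b : ℕ → ℝ) (M : ℝ), (∀ j, |b j| ≤ M) →
    ‖∑ i, (w i : ℂ) * ∑ j ∈ range n, (b j : ℂ) * p i ^ j - ser b z‖ ≤ M * E

lemma Interpolates.sum_mul_le {z : ℂ} {p : Fin 4 → ℂ} {w : Fin 4 → ℝ} {n : ℕ} {E : ℝ}
    (h : Interpolates z p w n E) {g : Fin 4 → ℝ} {a : ℝ} (hg : ∀ i, g i ≤ a) :
    ∑ i, w i * g i ≤ a := by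
  calc ∑ i, w i * g i ≤ ∑ i, w i * a :=
        sum_le_sum fun i _ => mul_le_mul_of_nonneg_left (hg i) (h.nonneg i)
    _ = a := by rw [← sum_mul, h.sum_eq, one_mul]

/-- The corner inequalities are averaged with the weights; the margin `M ‖e‖ E` absorbs the
interpolation error. -/
lemma Interpolates.le_ip {z : ℂ} {p : Fin 4 → ℂ} {w : Fin 4 → ℝ} {n : ℕ} {E : ℝ}
    (h : Interpolates z p w n E) {b : ℕ → ℝ} {M : ℝ} (hb : ∀ j, |b j| ≤ M) {e : ℂ} {a : ℝ}
    (ha : ∀ i, a + M * ‖e‖ * E ≤ ip e (∑ j ∈ range n, (b j : ℂ) * p i ^ j)) :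
    a ≤ ip e (ser b z) := by
  have h1 := (abs_ip_le e _).trans (mul_le_mul_of_nonneg_left (h.approx b M hb) (norm_nonneg e))
  rw [ip_sub, ip_sum] at h1
  simp only [ip_smul] at h1
  have h2 := h.sum_mul_le (g := fun i => -ip e (∑ j ∈ range n, (b j : ℂ) * p i ^ j))
    (a := -(a + M * ‖e‖ * E)) fun i => neg_le_neg (ha i)
  simp only [mul_neg, sum_neg_distrib] at h2
  have h3 := (abs_le.1 h1).2
  nlinarith

lemma Interpolates.norm_le {z : ℂ} {p : Fin 4 → ℂ} {w : Fin 4 → ℝ} {n : ℕ} {E : ℝ}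
    (h : Interpolates z p w n E) {b : ℕ → ℝ} {M : ℝ} (hb : ∀ j, |b j| ≤ M) :
    ‖ser b z‖ ≤ ∑ i, w i * ‖∑ j ∈ range n, (b j : ℂ) * p i ^ j‖ + M * E := by
  have h1 : ‖∑ i, (w i : ℂ) * ∑ j ∈ range n, (b j : ℂ) * p i ^ j‖ ≤
      ∑ i, w i * ‖∑ j ∈ range n, (b j : ℂ) * p i ^ j‖ := by
    refine norm_sum_le_of_le _ fun i _ => ?_
    rw [norm_mul, Complex.norm_real, Real.norm_of_nonneg (h.nonneg i)]
  have h2 := h.approx b M hb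
  rw [norm_sub_rev] at h2
  have h3 := norm_le_insert' (ser b z) (∑ i, (w i : ℂ) * ∑ j ∈ range n, (b j : ℂ) * p i ^ j)
  linarith

/-- The word is excluded by the ellipse condition. -/
lemma Admissible.false_of_ellipse {z : ℂ} {c : ℕ → ℝ} (hc : Admissible z c) (hz : ‖z‖ < 1)
    (hc0 : c 0 = 1) {p : Fin 4 → ℂ} {w : Fin 4 → ℝ} {n : ℕ} {E : ℝ} (h : Interpolates z p w n E)
    {K : Fin 4 → ℝ} (hK : ∑ i, w i * K i ≤ 1 / (1 - ‖z‖))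
    (hs : ∀ i, ‖∑ j ∈ range n, (c j : ℂ) * p i ^ j‖ + ‖∑ j ∈ range n, (c j : ℂ) * p i ^ j - 1‖
      ≤ K i - 2 * E) : False := by
  have h1 := (hc.2 0).1
  have h2 : ser (shift 0 c) z = ser c z := by rw [shift_zero]
  -- As `z u_1 = u_0 - 1`, admissibility bounds the sum of the distances from `u_0` to the foci `0`
  -- and `1` from below.
  have h3 : ‖z‖ * ‖ser (shift (0 + 1) c) z‖ = ‖ser c z - 1‖ := by
    rw [← norm_mul, ser_eq_head_add hc.abs_le hz, hc0]
    simp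
  rw [h2, h3] at h1
  have h4 := h.norm_le hc.abs_le
  have hE : 0 ≤ E := by
    have := (norm_nonneg _).trans (h.approx c 1 hc.abs_le)
    linarith
  have h5 : ‖ser c z - 1‖ ≤ ∑ i, w i * ‖∑ j ∈ range n, (c j : ℂ) * p i ^ j - 1‖ + E := by
    have a1 := h.approx c 1 hc.abs_le
    have a2 : ‖∑ i, (w i : ℂ) * (∑ j ∈ range n, (c j : ℂ) * p i ^ j - 1)‖ ≤
        ∑ i, w i * ‖∑ j ∈ range n, (c j : ℂ) * p i ^ j - 1‖ := by
      refine norm_sum_le_of_le _ fun i _ => ?_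
      rw [norm_mul, Complex.norm_real, Real.norm_of_nonneg (h.nonneg i)]
    have a3 : ∑ i, (w i : ℂ) * (∑ j ∈ range n, (c j : ℂ) * p i ^ j - 1) =
        ∑ i, (w i : ℂ) * (∑ j ∈ range n, (c j : ℂ) * p i ^ j) - 1 := by
      have : ∑ i, (w i : ℂ) = 1 := by exact_mod_cast h.sum_eq
      simp only [mul_sub, sum_sub_distrib, mul_one, this]
    rw [a3] at a2
    rw [norm_sub_rev, one_mul] at a1
    have := norm_sub_le_norm_sub_add_norm_sub (ser c z)
      (∑ i, (w i : ℂ) * ∑ j ∈ range n, (c j : ℂ) * p i ^ j) 1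
    linarith
  have h6 : ∑ i, w i * ‖∑ j ∈ range n, (c j : ℂ) * p i ^ j‖ +
      ∑ i, w i * ‖∑ j ∈ range n, (c j : ℂ) * p i ^ j - 1‖ ≤ ∑ i, w i * K i - 2 * E := by
    rw [← sum_add_distrib]
    calc _ ≤ ∑ i, (w i * K i - w i * (2 * E)) := sum_le_sum fun i _ => by
          rw [← mul_add, ← mul_sub]
          exact mul_le_mul_of_nonneg_left (hs i) (h.nonneg i)
      _ = _ := by rw [sum_sub_distrib, ← sum_mul, h.sum_eq, one_mul]
  linarith

/-- The word is excluded by the half-plane condition. -/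
lemma Admissible.false_of_halfPlane {z : ℂ} {c : ℕ → ℝ} (hc : Admissible z c) 
    (hc0 : c 0 = 1) {p : Fin 4 → ℂ} {w : Fin 4 → ℝ} {n : ℕ} {E : ℝ} (h : Interpolates z p w n E)
    (hs : ∀ i, (∑ j ∈ range n, (c j : ℂ) * p i ^ j).re ≤ 3 / 4 - E) : False := by
  have h1 := (hc.2 0).2
  have h2 : ser (shift 0 c) z = ser c z := by rw [shift_zero]
  rw [h2, hc0, one_mul] at h1
  have h3 := h.le_ip (e := -1) (a := -(3 / 4)) hc.abs_le (fun i => by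
    have := hs i
    simp only [ip, norm_neg, norm_one, Complex.neg_re, Complex.one_re, Complex.neg_im,
      Complex.one_im]
    linarith)
  simp only [ip, Complex.neg_re, Complex.one_re, Complex.neg_im, Complex.one_im] at h3
  linarith

lemma abs_coeff_le {c d : ℕ → ℝ} (hc : ∀ j, |c j| ≤ 1) (hd : ∀ j, 0 ≤ d j ∧ d j ≤ 2) (n j : ℕ) :
    |(5 * d j + if n ≤ j then 2 else 0) * c j| ≤ 12 := by
  rw [abs_mul]
  have h1 : |5 * d j + (if n ≤ j then 2 else 0 : ℝ)| ≤ 12 := by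
    rw [abs_le]
    have := hd j
    split_ifs <;> constructor <;> linarith
  nlinarith [hc j, abs_nonneg (c j), abs_nonneg (5 * d j + (if n ≤ j then 2 else 0 : ℝ))]

lemma exists_common_pos (P : Fin 4 → ℝ → Prop) (hmono : ∀ i a b, a ≤ b → P i b → P i a)
    (h : ∀ i, ∃ η, 0 < η ∧ P i η) : ∃ η, 0 < η ∧ ∀ i, P i η := by
  choose η h0 hη using h
  refine ⟨univ.inf' univ_nonempty η, (lt_inf'_iff _).2 fun i _ => h0 i, fun i => ?_⟩
  exact hmono i _ _ (inf'_le _ (mem_univ i)) (hη i)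

lemma separatesTails_of_corners {z : ℂ} {c : ℕ → ℝ} (hc : ∀ j, |c j| ≤ 1) {p : Fin 4 → ℂ}
    {w : Fin 4 → ℝ} {n : ℕ} {E : ℝ} (h : Interpolates z p w n E) (e : ℂ)
    (he : ∀ i, ∃ η, 0 < η ∧ ∀ d : ℕ → ℝ, (∀ j, 0 ≤ d j ∧ d j ≤ 2) → 1 ≤ d 0 → ∀ m : ℕ,
      η + 12 * ‖e‖ * E ≤
        ip e (∑ j ∈ range n, (((5 * d j + if m ≤ j then 2 else 0) * c j : ℝ) : ℂ) * p i ^ j)) :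
    SeparatesTails z c := by
  obtain ⟨η, h0, hη⟩ := exists_common_pos _ (by
    intro i a b hab hb d hd hd0 m
    exact le_trans (by linarith) (hb d hd hd0 m)) he
  exact ⟨e, η, h0, fun d hd hd0 m => h.le_ip (abs_coeff_le hc hd m) fun i => hη i d hd hd0 m⟩

lemma separatesEdge_of_corners {z : ℂ} {c : ℕ → ℝ} (hc : ∀ j, |c j| ≤ 1) {p : Fin 4 → ℂ}
    {w : Fin 4 → ℝ} {n : ℕ} {E : ℝ} (h : Interpolates z p w n E) (e : ℂ)
    (he : ∀ i, ∃ η, 0 < η ∧ ∀ d : ℕ → ℝ, (∀ j, 0 ≤ d j ∧ d j ≤ 2) → d 0 = 0 → ∀ m : ℕ, m ≤ 1 →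
      η + 12 * ‖e‖ * E ≤
        ip e (∑ j ∈ range n, (((5 * d j + if m ≤ j then 2 else 0) * c j : ℝ) : ℂ) * p i ^ j)) :
    SeparatesEdge z c := by
  obtain ⟨η, h0, hη⟩ := exists_common_pos _ (by
    intro i a b hab hb d hd hd0 m hm
    exact le_trans (by linarith) (hb d hd hd0 m hm)) he
  exact ⟨e, η, h0, fun d hd hd0 m hm => h.le_ip (abs_coeff_le hc hd m)
    fun i => hη i d hd hd0 m hm⟩

end TwoMapIFS

end

/-! ### Fixed-point complex arithmetic -/

section

open Finset

namespace CellCheck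
open TwoMapIFS

/-- The fixed-point vector of `p`. -/
noncomputable def Pt.vec (p : Pt) : ℂ := ⟨(p.fst : ℝ) - 8388608, (p.snd : ℝ) - 8388608⟩

/-- `p` represents `z` up to an error of `8` units. -/
def Pt.Near (p : Pt) (z : ℂ) : Prop := ‖p.vec - 1048576 * z‖ ≤ 8

/-- The lattice point with coordinates in units of `1/1448`. -/
noncomputable def Pt.lattice (c : Pt) : ℂ := ⟨(c.fst : ℝ) / 1448, (c.snd : ℝ) / 1448⟩

lemma band_eq_true {b c : Bool} : band b c = true ↔ b = true ∧ c = true := by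
  cases b <;> simp [band]

lemma norm_le_three_halves {z : ℂ} (h1 : |z.re| ≤ 1) (h2 : |z.im| ≤ 1) : ‖z‖ ≤ 3 / 2 := by
  refine le_of_sq_le_sq ?_ (by norm_num)
  rw [← Complex.normSq_eq_norm_sq, Complex.normSq_apply]
  nlinarith [abs_le.1 h1, abs_le.1 h2, sq_nonneg z.re, sq_nonneg z.im, (sq_abs z.re), (sq_abs z.im),
    mul_le_mul h1 h1 (abs_nonneg _) zero_le_one, mul_le_mul h2 h2 (abs_nonneg _) zero_le_one,
    abs_mul_abs_self z.re, abs_mul_abs_self z.im]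

lemma cast_div_bounds (n m : ℕ) (hm : 0 < m) : (n : ℝ) / m - 1 ≤ ((n / m : ℕ) : ℝ) ∧
    ((n / m : ℕ) : ℝ) ≤ (n : ℝ) / m := by
  refine ⟨?_, Nat.cast_div_le⟩
  have h : n < m * (n / m + 1) := Nat.lt_mul_div_succ n hm
  have h' : (n : ℝ) < m * ((n / m : ℕ) + 1) := by exact_mod_cast h
  have hm' : (0 : ℝ) < m := by exact_mod_cast hm
  rw [sub_le_iff_le_add, div_le_iff₀ hm']
  linarith

lemma cast_mulPt_fst (a b x y k s B m : ℕ) (hy : y ≤ k) (hs : a + b ≤ s) (hm : 0 < m) :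
    |(((a * x + b * (k - y) + (s - (a + b)) * B) / m : ℕ) : ℝ) -
      ((a : ℝ) * x + b * (k - y) + (s - (a + b)) * B) / m| ≤ 1 := by
  have h := cast_div_bounds (a * x + b * (k - y) + (s - (a + b)) * B) m hm
  have e : ((a * x + b * (k - y) + (s - (a + b)) * B : ℕ) : ℝ) =
      (a : ℝ) * x + b * (k - y) + (s - (a + b)) * B := by
    push_cast [Nat.cast_sub hy, Nat.cast_sub hs]; ring
  rw [e] at h
  rw [abs_le]
  constructor <;> linarith

lemma cast_mulPt_snd (a b x y s B m : ℕ) (hs : a + b ≤ s) (hm : 0 < m) :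
    |(((a * y + b * x + (s - (a + b)) * B) / m : ℕ) : ℝ) -
      ((a : ℝ) * y + b * x + (s - (a + b)) * B) / m| ≤ 1 := by
  have h := cast_div_bounds (a * y + b * x + (s - (a + b)) * B) m hm
  have e : ((a * y + b * x + (s - (a + b)) * B : ℕ) : ℝ) =
      (a : ℝ) * y + b * x + (s - (a + b)) * B := by
    push_cast [Nat.cast_sub hs]; ring
  rw [e] at h
  rw [abs_le]
  constructor <;> linarith

lemma Pt.Near.bounds {p : Pt} {z : ℂ} (h : p.Near z) (hz : ‖z‖ ≤ 5) :
    |(p.fst : ℝ) - 8388608| ≤ 5242888 ∧ |(p.snd : ℝ) - 8388608| ≤ 5242888 := by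
  have h1 : ‖p.vec‖ ≤ 5242888 := by
    have := norm_le_insert' p.vec (1048576 * z)
    have h2 : ‖(1048576 : ℂ) * z‖ ≤ 5242880 := by
      rw [norm_mul]; norm_num; linarith
    unfold Pt.Near at h
    linarith
  exact ⟨(Complex.abs_re_le_norm p.vec).trans h1, (Complex.abs_im_le_norm p.vec).trans h1⟩

lemma natDiv_eq (a b : ℕ) : Nat.div a b = a / b := rfl

/-- Expanding, the operand offsets `2^23` combine with the added multiple of `2^23` into `2 · 1448 ·
2^23`, which after division is the offset `2^24`; no negative number occurs. -/
lemma mulPt_mk (a b x y : ℕ) : mulPt (.mk a b) (.mk x y) =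
    .mk ((a * x + b * (16777216 - y) + (2896 - (a + b)) * 8388608) / 1448)
      ((a * y + b * x + (2896 - (a + b)) * 8388608) / 1448) := by
  have h : mulPt (.mk a b) (.mk x y) = .mk (Nat.div (Nat.add (Nat.add (Nat.mul a x)
      (Nat.mul b (Nat.sub 16777216 y))) (Nat.mul (Nat.sub 2896 (Nat.add a b)) 8388608)) 1448)
      (Nat.div (Nat.add (Nat.add (Nat.mul a y) (Nat.mul b x))
          (Nat.mul (Nat.sub 2896 (Nat.add a b)) 8388608)) 1448) := rfl
  rw [h]
  simp only [Nat.add_eq, Nat.mul_eq, Nat.sub_eq, natDiv_eq]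

lemma oneAdd_mk (x y : ℕ) : oneAdd (.mk x y) = .mk (x - 7340032) (y - 8388608) := by
  have h : oneAdd (.mk x y) = .mk (Nat.sub x 7340032) (Nat.sub y 8388608) := rfl
  rw [h]; simp only [Nat.sub_eq]

lemma oneSub_mk (x y : ℕ) : oneSub (.mk x y) = .mk (26214400 - x) (25165824 - y) := by
  have h : oneSub (.mk x y) = .mk (Nat.sub 26214400 x) (Nat.sub 25165824 y) := rfl
  rw [h]; simp only [Nat.sub_eq]

lemma recenter_mk (x y : ℕ) : recenter (.mk x y) = .mk (x - 8388608) (y - 8388608) := by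
  have h : recenter (.mk x y) = .mk (Nat.sub x 8388608) (Nat.sub y 8388608) := rfl
  rw [h]; simp only [Nat.sub_eq]

lemma Pt.fst_mk (x y : ℕ) : (Pt.mk x y).fst = x := rfl

lemma Pt.snd_mk (x y : ℕ) : (Pt.mk x y).snd = y := rfl

/-- The error `8` reproduces itself: rounding down costs at most `1` per coordinate, hence `3/2` in
norm, and `3/2 + (4/5) · 8 ≤ 8`. -/
lemma mulPt_near {c p : Pt} {z : ℂ} (hc : c.fst + c.snd ≤ 2896) (hn : ‖c.lattice‖ ≤ 4 / 5)
    (hp : p.Near z) (hz : ‖z‖ ≤ 5) :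
    ‖(⟨((mulPt c p).fst : ℝ) - 16777216, ((mulPt c p).snd : ℝ) - 16777216⟩ : ℂ) -
      1048576 * (c.lattice * z)‖ ≤ 8 := by
  obtain ⟨hx, hy⟩ := hp.bounds hz
  obtain ⟨a, b⟩ := c
  obtain ⟨x, y⟩ := p
  rw [Pt.fst_mk] at hc hx
  rw [Pt.snd_mk] at hc hy
  have hy' : y ≤ 16777216 := by
    have := (abs_le.1 hy).2
    have : (y : ℝ) ≤ 16777216 := by linarith
    exact_mod_cast this
  rw [mulPt_mk, Pt.fst_mk, Pt.snd_mk]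
  have h1 := cast_mulPt_fst a b x y 16777216 2896 8388608 1448 hy' hc (by norm_num)
  have h2 := cast_mulPt_snd a b x y 2896 8388608 1448 hc (by norm_num)
  generalize (a * x + b * (16777216 - y) + (2896 - (a + b)) * 8388608) / 1448 = q1 at h1 ⊢
  generalize (a * y + b * x + (2896 - (a + b)) * 8388608) / 1448 = q2 at h2 ⊢
  clear hc hy'
  set v : ℂ := ⟨(q1 : ℝ) - 16777216, (q2 : ℝ) - 16777216⟩ with hv
  have e1 : ‖v - (Pt.mk a b).lattice * (Pt.mk x y).vec‖ ≤ 3 / 2 := by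
    have l1 : (Pt.mk a b).lattice = ⟨(a : ℝ) / 1448, (b : ℝ) / 1448⟩ := rfl
    have l2 : (Pt.mk x y).vec = ⟨(x : ℝ) - 8388608, (y : ℝ) - 8388608⟩ := rfl
    apply norm_le_three_halves
    · rw [Complex.sub_re, Complex.mul_re, l1, l2, hv]
      convert h1 using 2
      push_cast
      ring
    · rw [Complex.sub_im, Complex.mul_im, l1, l2, hv]
      convert h2 using 2
      push_cast
      ring
  have e2 : ‖(Pt.mk a b).lattice * ((Pt.mk x y).vec - 1048576 * z)‖ ≤ 4 / 5 * 8 := by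
    rw [norm_mul]
    exact mul_le_mul hn hp (norm_nonneg _) (by norm_num)
  have e3 : v - 1048576 * ((Pt.mk a b).lattice * z) =
      (v - (Pt.mk a b).lattice * (Pt.mk x y).vec) +
        (Pt.mk a b).lattice * ((Pt.mk x y).vec - 1048576 * z) := by ring
  rw [e3]
  exact (norm_add_le _ _).trans (by linarith)

/-- As `|cz| ≤ 4`, the product's coordinates stay within `4 · 2^20 + 8` of `2^24`, so none of the
natural subtractions truncates. -/
lemma near_of_mulPt {c p : Pt} {z : ℂ} (hc : c.fst + c.snd ≤ 2896) (hn : ‖c.lattice‖ ≤ 4 / 5)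
    (hp : p.Near z) (hz : ‖z‖ ≤ 5) :
    (oneAdd (mulPt c p)).Near (1 + c.lattice * z) ∧
    (oneSub (mulPt c p)).Near (1 - c.lattice * z) ∧
    (recenter (mulPt c p)).Near (c.lattice * z) := by
  have h := mulPt_near hc hn hp hz
  have hcz : ‖c.lattice * z‖ ≤ 4 := by
    rw [norm_mul]
    nlinarith [norm_nonneg z, norm_nonneg c.lattice]
  generalize mulPt c p = v at h
  obtain ⟨x, y⟩ := v
  rw [Pt.fst_mk, Pt.snd_mk] at h
  have hv : ‖(⟨(x : ℝ) - 16777216, (y : ℝ) - 16777216⟩ : ℂ)‖ ≤ 4194312 := by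
    have h1 := norm_le_insert' (⟨(x : ℝ) - 16777216, (y : ℝ) - 16777216⟩ : ℂ)
      (1048576 * (c.lattice * z))
    have h2 : ‖(1048576 : ℂ) * (c.lattice * z)‖ ≤ 4194304 := by
      rw [norm_mul]
      norm_num
      rw [norm_mul] at hcz
      linarith
    linarith
  have hx := abs_le.1 ((Complex.abs_re_le_norm _).trans hv)
  have hy := abs_le.1 ((Complex.abs_im_le_norm _).trans hv)
  have hx1 : 12582904 ≤ x := by
    have : (12582904 : ℝ) ≤ x := by linarith [hx.1]
    exact_mod_cast this
  have hx2 : x ≤ 20971528 := by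
    have : (x : ℝ) ≤ 20971528 := by linarith [hx.2]
    exact_mod_cast this
  have hy1 : 12582904 ≤ y := by
    have : (12582904 : ℝ) ≤ y := by linarith [hy.1]
    exact_mod_cast this
  have hy2 : y ≤ 20971528 := by
    have : (y : ℝ) ≤ 20971528 := by linarith [hy.2]
    exact_mod_cast this
  refine ⟨?_, ?_, ?_⟩
  · rw [oneAdd_mk, Pt.Near, Pt.vec, Pt.fst_mk, Pt.snd_mk, Nat.cast_sub (by omega),
      Nat.cast_sub (by omega)]
    convert h using 1
    congr 1
    apply Complex.ext <;> simp <;> ring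
  · rw [oneSub_mk, Pt.Near, Pt.vec, Pt.fst_mk, Pt.snd_mk, Nat.cast_sub (by omega),
      Nat.cast_sub (by omega), ← norm_neg]
    convert h using 1
    congr 1
    apply Complex.ext <;> simp <;> ring
  · rw [recenter_mk, Pt.Near, Pt.vec, Pt.fst_mk, Pt.snd_mk, Nat.cast_sub (by omega),
      Nat.cast_sub (by omega)]
    convert h using 1
    congr 1
    apply Complex.ext <;> simp <;> ring

end CellCheck

end

/-! ### Pruning tests and sign words -/

section

open Finset

namespace CellCheck
open TwoMapIFS

/-- The value at a given corner. -/
noncomputable def Four.get {α : Type} (P : Four α) (i : Fin 4) : α :=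
  Four.rec (fun p q r t => (![p, q, r, t] : Fin 4 → α) i) P

lemma Four.get_map {α β : Type} (f : α → β) (P : Four α) (i : Fin 4) :
    (P.map f).get i = f (P.get i) := by
  obtain ⟨p, q, r, t⟩ := P
  fin_cases i <;> rfl

lemma Four.get_map₂ {α β γ : Type} (f : α → β → γ) (P : Four α) (Q : Four β) (i : Fin 4) :
    (P.map₂ f Q).get i = f (P.get i) (Q.get i) := by
  obtain ⟨p, q, r, t⟩ := P
  obtain ⟨p', q', r', t'⟩ := Q
  fin_cases i <;> rfl

lemma Four.all_eq_true {α : Type} {f : α → Bool} {P : Four α} (h : P.all f = true) (i : Fin 4) :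
    f (P.get i) = true := by
  obtain ⟨p, q, r, t⟩ := P
  have h : band (f t) (band (f p) (band (f q) (f r))) = true := h
  simp only [band_eq_true] at h
  obtain ⟨h1, h2, h3, h4⟩ := h
  fin_cases i <;> assumption

lemma Four.all₂_eq_true {α β : Type} {f : α → β → Bool} {P : Four α} {Q : Four β}
    (h : P.all₂ f Q = true) (i : Fin 4) : f (P.get i) (Q.get i) = true := by
  obtain ⟨p, q, r, t⟩ := P
  obtain ⟨p', q', r', t'⟩ := Q
  have h : band (f t t') (band (f p p') (band (f q q') (f r r'))) = true := h
  simp only [band_eq_true] at h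
  obtain ⟨h1, h2, h3, h4⟩ := h
  fin_cases i <;> assumption

lemma sel_false {α : Type} (x y : α) : sel false x y = y := rfl

lemma sel_eq {α : Type} (b : Bool) (x y : α) : sel b x y = if b = true then x else y := by
  cases b <;> rfl

lemma sq_eq (x : ℕ) : sq x = x ^ 2 := by rw [pow_two]; rfl

lemma natBlt_eq_true {a b : ℕ} : Nat.blt a b = true ↔ a < b := by simp

lemma cast_dist_sq (x y : ℕ) : ((dist x y : ℕ) : ℝ) ^ 2 = ((x : ℝ) - y) ^ 2 := by
  have h : dist x y = (x - y) + (y - x) := rfl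
  rw [h]
  rcases le_total x y with hxy | hxy
  · rw [Nat.sub_eq_zero_of_le hxy, zero_add, Nat.cast_sub hxy]; ring
  · rw [Nat.sub_eq_zero_of_le hxy, add_zero, Nat.cast_sub hxy]

/-- The implicit equation says `(2Ka)² < (K² + a² - b²)²`; taking roots gives `b² < (K-a)²`. The
alternative `a ≥ K` would give `b < a - K`, against the triangle inequality `a ≤ b + U` and `U < K`.
-/
lemma ellipse_bound {X Y U K a b : ℝ} (hU : 0 < U) (hUK : U < K) (hb : 0 ≤ b)
    (ha2 : a ^ 2 = X ^ 2 + Y ^ 2) (hb2 : b ^ 2 = (X - U) ^ 2 + Y ^ 2)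
    (h : (2 * X - U) ^ 2 * (K ^ 2 - U ^ 2) + 4 * Y ^ 2 * K ^ 2 < K ^ 2 * (K ^ 2 - U ^ 2)) :
    a + b ≤ K := by
  have hKU : 0 < K ^ 2 - U ^ 2 := by nlinarith
  have h1 : (2 * X - U) ^ 2 < K ^ 2 := by
    by_contra hcon
    push Not at hcon
    nlinarith [mul_le_mul_of_nonneg_right hcon hKU.le, sq_nonneg (Y * K)]
  have h2 : -K < 2 * X - U := (abs_lt_of_sq_lt_sq' h1 (by linarith)).1
  have h3 : 0 < K ^ 2 + a ^ 2 - b ^ 2 := by nlinarith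
  have h4 : (2 * K * a) ^ 2 < (K ^ 2 + a ^ 2 - b ^ 2) ^ 2 := by
    have e : (K ^ 2 + a ^ 2 - b ^ 2) ^ 2 - (2 * K * a) ^ 2 =
        (K ^ 2 - U ^ 2) * (K ^ 2 - (2 * X - U) ^ 2) - 4 * K ^ 2 * Y ^ 2 := by
      rw [mul_pow, ha2, hb2]; ring
    nlinarith
  have h5 : 2 * K * a < K ^ 2 + a ^ 2 - b ^ 2 := lt_of_pow_lt_pow_left₀ 2 h3.le h4
  have h6 : b ^ 2 < (K - a) ^ 2 := by nlinarith
  have h7 : a ≤ b + U := by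
    refine le_of_sq_le_sq ?_ (by linarith)
    have : X - U ≤ b := by
      refine (le_abs_self _).trans (abs_le_of_sq_le_sq ?_ hb)
      nlinarith [sq_nonneg Y]
    nlinarith
  rcases lt_or_ge a K with h8 | h8
  · have := lt_of_pow_lt_pow_left₀ 2 (by linarith : 0 ≤ K - a) h6
    linarith
  · have h6' : b ^ 2 < (a - K) ^ 2 := by nlinarith
    have := lt_of_pow_lt_pow_left₀ 2 (by linarith : 0 ≤ a - K) h6'
    linarith

lemma inEll_mkEll_mk (K x y : ℕ) : inEll (mkEll K) (.mk x y) =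
    Nat.blt (dist x 8912896 ^ 2 * (4 * (K ^ 2 - 1099511627776)) +
      dist y 8388608 ^ 2 * (4 * K ^ 2)) (K ^ 2 * (K ^ 2 - 1099511627776)) := by
  have h : inEll (mkEll K) (.mk x y) = Nat.blt (Nat.add (Nat.mul (sq (dist x 8912896))
      (Nat.mul 4 (Nat.sub (sq K) 1099511627776))) (Nat.mul (sq (dist y 8388608))
      (Nat.mul 4 (sq K)))) (Nat.mul (sq K) (Nat.sub (sq K) 1099511627776)) := rfl
  rw [h]
  simp only [sq_eq, Nat.add_eq, Nat.mul_eq, Nat.sub_eq]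

lemma norm_sq_eq (z : ℂ) : ‖z‖ ^ 2 = z.re ^ 2 + z.im ^ 2 := by
  rw [← Complex.normSq_eq_norm_sq, Complex.normSq_apply]; ring

lemma inEll_sound {K : ℕ} {p : Pt} (h : inEll (mkEll K) p = true) :
    1048576 < (K : ℝ) ∧ ‖p.vec‖ + ‖p.vec - 1048576‖ ≤ K := by
  obtain ⟨x, y⟩ := p
  rw [inEll_mkEll_mk, natBlt_eq_true] at h
  -- Otherwise the truncated subtraction makes the right-hand side of the strict inequality zero.
  have hK : 1099511627776 < K ^ 2 := by
    by_contra hcon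
    rw [Nat.sub_eq_zero_of_le (by omega)] at h
    simp at h
  have hK' : (1048576 : ℝ) < K := by
    have : (1048576 : ℝ) ^ 2 < (K : ℝ) ^ 2 := by
      have : ((1099511627776 : ℕ) : ℝ) < ((K ^ 2 : ℕ) : ℝ) := by exact_mod_cast hK
      push_cast at this
      linarith
    exact lt_of_pow_lt_pow_left₀ 2 (Nat.cast_nonneg K) this
  have h' : ((dist x 8912896 : ℕ) : ℝ) ^ 2 * (4 * ((K : ℝ) ^ 2 - 1099511627776)) +
      ((dist y 8388608 : ℕ) : ℝ) ^ 2 * (4 * (K : ℝ) ^ 2) <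
      (K : ℝ) ^ 2 * ((K : ℝ) ^ 2 - 1099511627776) := by
    have := (Nat.cast_lt (α := ℝ)).2 h
    push_cast [Nat.cast_sub hK.le] at this
    exact this
  rw [cast_dist_sq, cast_dist_sq] at h'
  push_cast at h'
  refine ⟨hK', ellipse_bound (X := (x : ℝ) - 8388608) (Y := (y : ℝ) - 8388608) (U := 1048576)
    (by norm_num) hK' (norm_nonneg _) ?_ ?_ ?_⟩
  · rw [norm_sq_eq]; rfl
  · rw [norm_sq_eq]; simp [Pt.vec, Pt.fst_mk, Pt.snd_mk]
  · linarith

lemma inHalf_sound {t : ℕ} {p : Pt} (h : inHalf t p = true) : p.vec.re + t ≤ 786432 := by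
  obtain ⟨x, y⟩ := p
  have h1 : inHalf t (.mk x y) = Nat.ble (x + t) 9175040 := rfl
  rw [h1, Nat.ble_eq] at h
  have h2 : (x : ℝ) + t ≤ 9175040 := by exact_mod_cast h
  have h3 : (Pt.mk x y).vec.re = (x : ℝ) - 8388608 := rfl
  rw [h3]; linarith

lemma pruned_cases {E : Four Ell} {t : ℕ} {P : Four Pt} (h : pruned E t P = true) :
    (∀ i, inEll (E.get i) (P.get i) = true) ∨ ∀ i, inHalf t (P.get i) = true := by
  by_cases h1 : Four.all₂ inEll E P = true
  · exact Or.inl (Four.all₂_eq_true h1)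
  · have h2 : Four.all₂ inEll E P = false := by simpa using h1
    have e : pruned E t P = sel (Four.all₂ inEll E P) true (Four.all (inHalf t) P) := rfl
    rw [e, h2, sel_false] at h
    exact Or.inr (Four.all_eq_true h)

/-- The relative signs in `s` are those of `c`. -/
def Signs.Rel : Signs → (ℕ → ℝ) → Prop
  | .nil, _ => True
  | .pos s, c => c 1 = c 0 ∧ s.Rel (shift 1 c)
  | .neg s, c => c 1 = -c 0 ∧ s.Rel (shift 1 c)

/-- The absolute signs in `s` are those of `c`. -/
def Signs.Abs : Signs → (ℕ → ℝ) → Prop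
  | .nil, _ => True
  | .pos s, c => c 0 = 1 ∧ s.Abs (shift 1 c)
  | .neg s, c => c 0 = -1 ∧ s.Abs (shift 1 c)

/-- The length of a sign word. -/
def Signs.len : Signs → ℕ
  | .nil => 0
  | .pos s => s.len + 1
  | .neg s => s.len + 1

/-- Relative signs do not see a global sign; this lets one word serve a tail and its negative. -/
lemma Signs.Rel.neg {s : Signs} {c : ℕ → ℝ} (h : s.Rel c) : s.Rel fun j => -c j := by
  induction s generalizing c with
  | nil => trivial
  | pos s ih => exact ⟨by simp only [h.1], ih h.2⟩
  | neg s ih => exact ⟨by simp only [h.1], ih h.2⟩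

lemma unwind_pos (s : Signs) (b : Bool) : unwind (.pos s) b =
    if b then .pos (unwind s true) else .neg (unwind s false) := by cases b <;> rfl

lemma unwind_neg (s : Signs) (b : Bool) : unwind (.neg s) b =
    if b then .neg (unwind s false) else .pos (unwind s true) := by cases b <;> rfl

lemma len_unwind (s : Signs) (b : Bool) : (unwind s b).len = s.len := by
  induction s generalizing b with
  | nil => rfl
  | pos s ih => rw [unwind_pos]; cases b <;> simp [Signs.len, ih]
  | neg s ih => rw [unwind_neg]; cases b <;> simp [Signs.len, ih]

lemma Signs.Rel.abs_unwind {s : Signs} {c : ℕ → ℝ} (h : s.Rel c) (b : Bool)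
    (hb : c 0 = if b then 1 else -1) : (unwind s b).Abs (shift 1 c) := by
  induction s generalizing c b with
  | nil => trivial
  | pos s ih =>
    rw [unwind_pos]
    have h0 : shift 1 c 0 = c 0 := h.1
    cases b
    · simp only [Bool.false_eq_true, if_false] at hb ⊢
      exact ⟨h0.trans hb, ih h.2 _ (by simpa using h0.trans hb)⟩
    · simp only [if_true] at hb ⊢
      exact ⟨h0.trans hb, ih h.2 _ (by simpa using h0.trans hb)⟩
  | neg s ih =>
    rw [unwind_neg]
    have h0 : shift 1 c 0 = -c 0 := h.1
    cases b
    · simp only [Bool.false_eq_true, if_false] at hb ⊢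
      have h1 : shift 1 c 0 = 1 := by rw [h0, hb]; norm_num
      exact ⟨h1, ih h.2 _ (by simpa using h1)⟩
    · simp only [if_true] at hb ⊢
      have h1 : shift 1 c 0 = -1 := by rw [h0, hb]
      exact ⟨h1, ih h.2 _ (by simpa using h1)⟩

/-- `w` consists of the first `n` signs of `c` and of the values of the corresponding polynomial
at the lattice points `C`. -/
noncomputable def Word.Matches (C : Four Pt) (c : ℕ → ℝ) (n : ℕ) (w : Word) : Prop :=
  Word.rec (motive := fun _ => Prop) (fun s P => s.Rel c ∧ s.len + 1 = n ∧
    ∀ i, (P.get i).Near (∑ j ∈ range n, (c j : ℂ) * (C.get i).lattice ^ j)) w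

/-- Every normalised admissible sequence is matched by a word of `F`. -/
def Covers (z : ℂ) (C : Four Pt) (n : ℕ) (F : List Word) : Prop :=
  ∀ c, Admissible z c → c 0 = 1 → ∃ w ∈ F, w.Matches C c n

lemma extend_eq (E : Four Ell) (t : ℕ) (s : Signs) (P : Four Pt) (l : List Word) :
    extend E t s P l = if pruned E t P = true then l else .mk s P :: l := by
  have e : extend E t s P l = sel (pruned E t P) l (.mk s P :: l) := rfl
  rw [e, sel_eq]

lemma level_cons (C : Four Pt) (E : Four Ell) (t : ℕ) (s : Signs) (P : Four Pt) (F : List Word) :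
    level C E t (.mk s P :: F) =
      extend E t (.pos s) ((C.map₂ mulPt P).map oneAdd)
        (extend E t (.neg s) ((C.map₂ mulPt P).map oneSub) (level C E t F)) := rfl

lemma mem_level {C : Four Pt} {E : Four Ell} {t : ℕ} {s : Signs} {P : Four Pt} {F : List Word}
    (h : .mk s P ∈ F) :
    (¬ pruned E t ((C.map₂ mulPt P).map oneAdd) = true →
      .mk (.pos s) ((C.map₂ mulPt P).map oneAdd) ∈ level C E t F) ∧
    (¬ pruned E t ((C.map₂ mulPt P).map oneSub) = true →
      .mk (.neg s) ((C.map₂ mulPt P).map oneSub) ∈ level C E t F) := by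
  induction F with
  | nil => simp at h
  | cons w F ih =>
    obtain ⟨s', P'⟩ := w
    rw [level_cons, extend_eq, extend_eq]
    rcases List.mem_cons.1 h with h | h
    · obtain ⟨rfl, rfl⟩ := Word.mk.inj h
      constructor
      · intro hp; rw [if_neg hp]; simp
      · intro hp; rw [if_neg hp]; split_ifs <;> simp
    · obtain ⟨h1, h2⟩ := ih h
      constructor
      · intro hp; have := h1 hp; split_ifs <;> simp [this]
      · intro hp; have := h2 hp; split_ifs <;> simp [this]

lemma norm_sum_le_five {c : ℕ → ℝ} (hc : ∀ j, |c j| ≤ 1) {z : ℂ} (hz : ‖z‖ ≤ 4 / 5) (n : ℕ) :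
    ‖∑ j ∈ range n, (c j : ℂ) * z ^ j‖ ≤ 5 := by
  calc ‖∑ j ∈ range n, (c j : ℂ) * z ^ j‖ ≤ ∑ j ∈ range n, (4 / 5 : ℝ) ^ j := by
        refine norm_sum_le_of_le _ fun j _ => ?_
        rw [norm_mul, norm_pow, Complex.norm_real, Real.norm_eq_abs]
        calc _ ≤ 1 * (4 / 5 : ℝ) ^ j := by
              gcongr
              exact hc j
          _ = _ := one_mul _
    _ ≤ ∑' j, (4 / 5 : ℝ) ^ j :=
        (summable_geometric_of_lt_one (by norm_num) (by norm_num)).sum_le_tsum _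
          fun _ _ => by positivity
    _ = 5 := by rw [tsum_geometric_of_lt_one (by norm_num) (by norm_num)]; norm_num

end CellCheck

end

/-! ### Tables of powers and accumulated pairings -/

section

open Finset

namespace CellCheck
open TwoMapIFS

/-- The rows of the table represent `z ^ m`, `z ^ (m + 1)`, … -/
def Table.Near : Table → ℂ → ℕ → Prop
  | .nil, _, _ => True
  | .cons x y w T, z, m => (Pt.mk x y).Near (z ^ m) ∧ w = 33554432 * (x + y) ∧ T.Near z (m + 1)

lemma row_mk (x y : ℕ) (T : Table) : row (.mk x y) T = .cons x y (33554432 * (x + y)) T := by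
  have h : row (.mk x y) T = .cons x y (Nat.mul 33554432 (Nat.add x y)) T := rfl
  rw [h]; simp only [Nat.mul_eq, Nat.add_eq]

lemma table_near {c : Pt} (hc : c.fst + c.snd ≤ 2896) (hn : ‖c.lattice‖ ≤ 4 / 5) (n : ℕ) {p : Pt}
    {m : ℕ} (hp : p.Near (c.lattice ^ m)) : (table c n p).Near c.lattice (m + 1) := by
  induction n generalizing p m with
  | zero => trivial
  | succ n ih =>
    have h1 : table c (n + 1) p = row (recenter (mulPt c p)) (table c n (recenter (mulPt c p))) :=
      rfl
    have hm : ‖c.lattice ^ m‖ ≤ 5 := by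
      rw [norm_pow]
      exact (pow_le_one₀ (norm_nonneg _) (hn.trans (by norm_num))).trans (by norm_num)
    have h2 := (near_of_mulPt hc hn hp hm).2.2
    rw [← pow_succ'] at h2
    have h3 := ih h2
    rw [h1]
    generalize recenter (mulPt c p) = v at h2 h3 ⊢
    obtain ⟨x, y⟩ := v
    rw [row_mk]
    exact ⟨h2, rfl, h3⟩

lemma maxNat_eq (a b : ℕ) : maxNat a b = max a b := by
  have h : maxNat a b = sel (Nat.ble a b) b a := rfl
  rw [h, sel_eq, max_def]
  simp only [Nat.ble_eq]

lemma fold_pos (X Y W : ℕ) (k : ℕ → ℕ → ℕ → Bool) (s : Signs) (x y w : ℕ) (T : Table)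
    (pos neg mx : ℕ) : fold X Y W k (.pos s) (.cons x y w T) pos neg mx =
      fold X Y W k s T (pos + ((X * x + Y * y + 562949953421312) - (W + w)))
        (neg + ((W + w) - (X * x + Y * y + 562949953421312))) (max mx (pos - neg)) := by
  have h : fold X Y W k (.pos s) (.cons x y w T) pos neg mx =
      fold X Y W k s T (Nat.add pos (Nat.sub (Nat.add (Nat.add (Nat.mul X x) (Nat.mul Y y))
          562949953421312) (Nat.add W w)))
        (Nat.add neg (Nat.sub (Nat.add W w) (Nat.add (Nat.add (Nat.mul X x) (Nat.mul Y y))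
          562949953421312))) (maxNat mx (Nat.sub pos neg)) := rfl
  rw [h]; simp only [Nat.mul_eq, Nat.add_eq, Nat.sub_eq, maxNat_eq]

lemma fold_neg (X Y W : ℕ) (k : ℕ → ℕ → ℕ → Bool) (s : Signs) (x y w : ℕ) (T : Table)
    (pos neg mx : ℕ) : fold X Y W k (.neg s) (.cons x y w T) pos neg mx =
      fold X Y W k s T (pos + ((W + w) - (X * x + Y * y + 562949953421312)))
        (neg + ((X * x + Y * y + 562949953421312) - (W + w))) (max mx (pos - neg)) := by
  have h : fold X Y W k (.neg s) (.cons x y w T) pos neg mx =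
      fold X Y W k s T (Nat.add pos (Nat.sub (Nat.add W w) (Nat.add (Nat.add (Nat.mul X x)
          (Nat.mul Y y)) 562949953421312)))
        (Nat.add neg (Nat.sub (Nat.add (Nat.add (Nat.mul X x) (Nat.mul Y y))
          562949953421312) (Nat.add W w))) (maxNat mx (Nat.sub pos neg)) := rfl
  rw [h]; simp only [Nat.mul_eq, Nat.add_eq, Nat.sub_eq, maxNat_eq]

lemma cast_sub_sub (a b : ℕ) : ((a - b : ℕ) : ℝ) - ((b - a : ℕ) : ℝ) = (a : ℝ) - b ∧
    ((b - a : ℕ) : ℝ) = max 0 (-((a : ℝ) - b)) ∧ (a : ℝ) - b ≤ ((a - b : ℕ) : ℝ) := by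
  rcases le_total a b with h | h
  · have h' : (a : ℝ) ≤ b := by exact_mod_cast h
    rw [Nat.sub_eq_zero_of_le h, Nat.cast_sub h, max_eq_right (by linarith)]
    refine ⟨?_, ?_, ?_⟩ <;> push_cast <;> linarith
  · have h' : (b : ℝ) ≤ a := by exact_mod_cast h
    rw [Nat.sub_eq_zero_of_le h, Nat.cast_sub h, max_eq_left (by linarith)]
    refine ⟨?_, ?_, ?_⟩ <;> push_cast <;> linarith

/-- The direction with fixed-point coordinates `X`, `Y`. -/
noncomputable def direction (X Y : ℕ) : ℂ := ⟨(X : ℝ) - 33554432, (Y : ℝ) - 33554432⟩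

/-- The offsets are `2^25` for directions and `2^23` for points; `562949953421312 = 2 · 2^25 ·
2^23`. -/
lemma cast_row (X Y x y : ℕ) :
    ((X * x + Y * y + 562949953421312 : ℕ) : ℝ) -
      ((8388608 * (X + Y) + 33554432 * (x + y) : ℕ) : ℝ) = ip (direction X Y) (Pt.mk x y).vec := by
  simp only [ip, direction, Pt.vec, Pt.fst_mk, Pt.snd_mk]
  push_cast
  ring

/-- What `fold` accumulates: the summands `f j`, their negative parts and the prefix sums. -/
structure FoldSpec (e : ℂ) (z : ℂ) (c : ℕ → ℝ) (m n : ℕ) (a0 b0 r0 : ℕ) (f : ℕ → ℝ)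
    (a b r : ℕ) : Prop where
  near : ∀ j < n, |f j - 1048576 * (c j * ip e (z ^ (m + j)))| ≤ 8 * ‖e‖
  sum_eq : (a : ℝ) - b = a0 - b0 + ∑ j ∈ range n, f j
  neg_eq : (b : ℝ) = b0 + ∑ j ∈ range n, max 0 (-f j)
  le : r0 ≤ r
  prefix_le : ∀ i < n, (a0 : ℝ) - b0 + ∑ j ∈ range i, f j ≤ r

/-- The sequence `f0, f 0, f 1, …` -/
noncomputable def consSeq (f0 : ℝ) (f : ℕ → ℝ) (j : ℕ) : ℝ := Nat.casesOn j f0 f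

lemma consSeq_zero (f0 : ℝ) (f : ℕ → ℝ) : consSeq f0 f 0 = f0 := rfl

lemma consSeq_succ (f0 : ℝ) (f : ℕ → ℝ) (j : ℕ) : consSeq f0 f (j + 1) = f j := rfl

lemma FoldSpec.cons {e z : ℂ} {c : ℕ → ℝ} {m n a0 b0 r0 a1 b1 : ℕ} {f : ℕ → ℝ} {a b r : ℕ} {f0 : ℝ}
    (h : FoldSpec e z (shift 1 c) (m + 1) n a1 b1 (max r0 (a0 - b0)) f a b r)
    (h0 : |f0 - 1048576 * (c 0 * ip e (z ^ m))| ≤ 8 * ‖e‖)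
    (ha : (a1 : ℝ) - b1 = a0 - b0 + f0) (hb : (b1 : ℝ) = b0 + max 0 (-f0)) :
    FoldSpec e z c m (n + 1) a0 b0 r0 (consSeq f0 f) a b r := by
  refine ⟨fun j hj => ?_, ?_, ?_, (le_max_left _ _).trans h.le, fun i hi => ?_⟩
  · rcases j with _ | j
    · simpa [consSeq_zero] using h0
    · rw [consSeq_succ]
      have := h.near j (by omega)
      rw [show m + (j + 1) = m + 1 + j by ring, show c (j + 1) = shift 1 c j by
        simp [shift, add_comm]]
      exact this
  · rw [sum_range_succ', h.sum_eq, ha]; simp only [consSeq_zero, consSeq_succ]; ring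
  · rw [sum_range_succ', h.neg_eq, hb]; simp only [consSeq_zero, consSeq_succ]; ring
  · rcases i with _ | i
    · have h1 : ((a0 - b0 : ℕ) : ℝ) ≤ r := by exact_mod_cast (le_max_right r0 _).trans h.le
      have h2 := (cast_sub_sub a0 b0).2.2
      simp only [range_zero, sum_empty]
      linarith
    · have := h.prefix_le i (by omega)
      rw [sum_range_succ']
      simp only [consSeq_zero, consSeq_succ]
      linarith

lemma fold_sound {X Y : ℕ} {k : ℕ → ℕ → ℕ → Bool} {z : ℂ} {s : Signs} {c : ℕ → ℝ} {T : Table}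
    {m a0 b0 r0 : ℕ} (hs : s.Abs c) (hT : T.Near z m)
    (h : fold X Y (8388608 * (X + Y)) k s T a0 b0 r0 = true) :
    ∃ f a b r, FoldSpec (direction X Y) z c m s.len a0 b0 r0 f a b r ∧ k a b r = true := by
  have hrow : ∀ (x y : ℕ) (u : ℂ) (σ : ℝ), (Pt.mk x y).Near u → |σ| = 1 →
      |σ * ip (direction X Y) (Pt.mk x y).vec - 1048576 * (σ * ip (direction X Y) u)| ≤
        8 * ‖direction X Y‖ := by
    intro x y u σ hu hσ
    have h1 := abs_ip_le (direction X Y) ((Pt.mk x y).vec - 1048576 * u)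
    have h2 : ip (direction X Y) (1048576 * u) = 1048576 * ip (direction X Y) u := by
      have := ip_smul (direction X Y) u 1048576
      simpa using this
    rw [ip_sub, h2] at h1
    rw [show σ * ip (direction X Y) (Pt.mk x y).vec - 1048576 * (σ * ip (direction X Y) u) =
      σ * (ip (direction X Y) (Pt.mk x y).vec - 1048576 * ip (direction X Y) u) by ring, abs_mul,
      hσ, one_mul]
    refine h1.trans ?_
    rw [mul_comm]
    exact mul_le_mul_of_nonneg_right hu (norm_nonneg _)
  induction s generalizing c T m a0 b0 r0 with
  | nil =>
    refine ⟨fun _ => 0, a0, b0, r0, ⟨?_, ?_, ?_, le_rfl, ?_⟩, h⟩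
    · intro j hj; simp [Signs.len] at hj
    · simp [Signs.len]
    · simp [Signs.len]
    · intro j hj; simp [Signs.len] at hj
  | pos s ih =>
    rcases T with _ | ⟨x, y, w, T⟩
    -- A table that is too short makes `fold` fail, so its length needs no separate check.
    · exact absurd h (by simp [show fold X Y (8388608 * (X + Y)) k (.pos s) .nil a0 b0 r0 = false
        from rfl])
    · obtain ⟨hp, rfl, hT⟩ := hT
      rw [fold_pos] at h
      obtain ⟨f, a, b, r, hf, hk⟩ := ih hs.2 hT h
      have hc := cast_row X Y x y
      have hd := cast_sub_sub (X * x + Y * y + 562949953421312)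
        (8388608 * (X + Y) + 33554432 * (x + y))
      rw [hc] at hd
      refine ⟨_, a, b, r, hf.cons (f0 := ip (direction X Y) (Pt.mk x y).vec) ?_ ?_ ?_, hk⟩
      · have := hrow x y _ 1 hp (by simp)
        rw [hs.1]
        simpa using this
      · rw [Nat.cast_add, Nat.cast_add]; linarith [hd.1]
      · rw [Nat.cast_add, hd.2.1]
  | neg s ih =>
    rcases T with _ | ⟨x, y, w, T⟩
    · exact absurd h (by simp [show fold X Y (8388608 * (X + Y)) k (.neg s) .nil a0 b0 r0 = false
        from rfl])
    · obtain ⟨hp, rfl, hT⟩ := hT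
      rw [fold_neg] at h
      obtain ⟨f, a, b, r, hf, hk⟩ := ih hs.2 hT h
      have hc := cast_row X Y x y
      have hd := cast_sub_sub (8388608 * (X + Y) + 33554432 * (x + y))
        (X * x + Y * y + 562949953421312)
      have hc' : ((8388608 * (X + Y) + 33554432 * (x + y) : ℕ) : ℝ) -
          ((X * x + Y * y + 562949953421312 : ℕ) : ℝ) = -ip (direction X Y) (Pt.mk x y).vec := by
        rw [← hc]; ring
      rw [hc'] at hd
      refine ⟨_, a, b, r, hf.cons (f0 := -ip (direction X Y) (Pt.mk x y).vec) ?_ ?_ ?_, hk⟩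
      · have := hrow x y _ (-1) hp (by simp)
        rw [hs.1]
        simpa using this
      · rw [Nat.cast_add, Nat.cast_add]; linarith [hd.1]
      · rw [Nat.cast_add, hd.2.1]

end CellCheck

end

/-! ### Soundness of the test on a single word -/

section

open Finset

namespace CellCheck
open TwoMapIFS

lemma direction_norm_sq (X Y : ℕ) :
    ((sq (dist X 33554432) + sq (dist Y 33554432) : ℕ) : ℝ) = ‖direction X Y‖ ^ 2 := by
  rw [norm_sq_eq, Nat.cast_add, sq_eq, sq_eq, Nat.cast_pow, Nat.cast_pow, cast_dist_sq,
    cast_dist_sq]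
  simp [direction]

lemma foldAll_eq_true {T : Four Table} {err X Y : ℕ} {k : ℕ → ℕ → ℕ → ℕ → Bool} {s : Signs}
    (h : foldAll T err X Y k s = true) (i : Fin 4) :
    fold X Y (8388608 * (X + Y)) (k (err * (sq (dist X 33554432) + sq (dist Y 33554432)))) s
      (T.get i) 0 0 0 = true := by
  have h1 : foldAll T err X Y k s = Four.all (fun t => fold X Y (Nat.mul 8388608 (Nat.add X Y))
    (k (Nat.mul err (Nat.add (sq (dist X 33554432)) (sq (dist Y 33554432))))) s t 0 0 0) T := rfl
  rw [h1] at h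
  exact Four.all_eq_true h i

lemma finalA_eq (X b pos neg mx : ℕ) : finalA X b pos neg mx =
    Nat.blt b (((5242880 * (X - 33554432) + 2 * pos) -
      (12 * neg + 2 * max mx (pos - neg))) ^ 2) := by
  have h : finalA X b pos neg mx = Nat.blt b (sq (Nat.sub (Nat.add (Nat.mul 5242880
    (Nat.sub X 33554432)) (Nat.mul 2 pos)) (Nat.add (Nat.mul 12 neg) (Nat.mul 2
    (maxNat mx (Nat.sub pos neg)))))) := rfl
  rw [h, sq_eq]; simp only [Nat.add_eq, Nat.mul_eq, Nat.sub_eq, maxNat_eq]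

lemma finalB_eq (X b pos neg mx : ℕ) : finalB X b pos neg mx =
    Nat.blt b ((2 * pos - (12 * neg + 2097152 * (33554432 - X))) ^ 2) := by
  have h : finalB X b pos neg mx = Nat.blt b (sq (Nat.sub (Nat.mul 2 pos)
    (Nat.add (Nat.mul 12 neg) (Nat.mul 2097152 (Nat.sub 33554432 X))))) := rfl
  rw [h, sq_eq]; simp only [Nat.add_eq, Nat.mul_eq, Nat.sub_eq]

/-- A positive truncated difference whose square exceeds `144 (err ‖e‖)²`. -/
lemma lt_sub_of_sq_lt {err a b n : ℕ} {v : ℝ} (hn : (n : ℝ) = v ^ 2)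
    (h : 144 * err ^ 2 * n < (a - b) ^ 2) : 12 * err * v < (a : ℝ) - b ∧ b < a := by
  have hab : b < a := by
    by_contra hcon
    rw [Nat.sub_eq_zero_of_le (by omega)] at h
    simp at h
  refine ⟨?_, hab⟩
  have h' := (Nat.cast_lt (α := ℝ)).2 h
  push_cast [Nat.cast_sub hab.le, hn] at h'
  have hab' : (b : ℝ) < a := by exact_mod_cast hab
  refine lt_of_pow_lt_pow_left₀ 2 (by linarith) (lt_of_eq_of_lt ?_ h')
  ring

lemma ip_ofReal (e : ℂ) (a : ℝ) : ip e (a : ℂ) = a * e.re := by simp [ip, mul_comm]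

/-- Lower bound for a functional at a weighted partial sum in terms of the rounded summands. -/
lemma FoldSpec.le_ip {e z : ℂ} {c : ℕ → ℝ} {n : ℕ} {f : ℕ → ℝ} {a b r : ℕ}
    (h : FoldSpec e z (shift 1 c) 1 n 0 0 0 f a b r) (hc0 : c 0 = 1) {g : ℕ → ℝ}
    (hg : ∀ j, 0 ≤ g j ∧ g j ≤ 12) :
    1048576 * (g 0 * e.re) + ∑ j ∈ range n, g (j + 1) * f j - 96 * n * ‖e‖ ≤
      1048576 * ip e (∑ j ∈ range (n + 1), ((g j * c j : ℝ) : ℂ) * z ^ j) := by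
  rw [ip_sum, sum_range_succ']
  simp only [ip_smul, pow_zero, hc0, mul_one, ip_ofReal]
  have h1 : ∑ j ∈ range n, g (j + 1) * f j - 96 * n * ‖e‖ ≤
      ∑ j ∈ range n, 1048576 * (g (j + 1) * c (j + 1) * ip e (z ^ (j + 1))) := by
    rw [show 96 * n * ‖e‖ = ∑ _j ∈ range n, 96 * ‖e‖ by simp; ring, ← sum_sub_distrib]
    refine sum_le_sum fun j hj => ?_
    have h2 := abs_le.1 (h.near j (mem_range.1 hj))
    rw [show shift 1 c j = c (j + 1) by simp [shift, add_comm], add_comm 1 j] at h2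
    have h3 := hg (j + 1)
    have h4 : g (j + 1) * (f j - 1048576 * (c (j + 1) * ip e (z ^ (j + 1)))) ≤
        g (j + 1) * (8 * ‖e‖) := mul_le_mul_of_nonneg_left h2.2 h3.1
    have h5 := mul_le_mul_of_nonneg_right h3.2 (by positivity : 0 ≤ 8 * ‖e‖)
    linarith
  rw [mul_add, mul_sum]
  linarith

/-- The worst digits are `2` on negative summands and `0` on positive ones. -/
lemma FoldSpec.neg_le_sum {e z : ℂ} {c : ℕ → ℝ} {n : ℕ} {f : ℕ → ℝ} {a b r : ℕ}
    (h : FoldSpec e z c 1 n 0 0 0 f a b r) {d : ℕ → ℝ} (hd : ∀ j, 0 ≤ d j ∧ d j ≤ 2) :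
    -10 * (b : ℝ) ≤ ∑ j ∈ range n, 5 * d (j + 1) * f j := by
  rw [h.neg_eq, Nat.cast_zero, zero_add, mul_sum]
  refine sum_le_sum fun j _ => ?_
  have h1 := hd (j + 1)
  rcases le_total (f j) 0 with hf | hf
  · rw [max_eq_right (by linarith)]; nlinarith
  · rw [max_eq_left (by linarith)]; nlinarith [mul_nonneg h1.1 hf]

/-- The right-hand side is the full sum minus a prefix, and prefixes are at most `r`. -/
lemma sum_ite_le {n : ℕ} (f : ℕ → ℝ) (m : ℕ) {r : ℝ}
    (h : ∀ i ≤ n, ∑ j ∈ range i, f j ≤ r) (hr : 0 ≤ r) :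
    ∑ j ∈ range n, f j - r ≤ ∑ j ∈ range n, (if m ≤ j + 1 then 1 else 0) * f j := by
  induction n with
  | zero => simpa using hr
  | succ n ih =>
    rw [sum_range_succ, sum_range_succ]
    split_ifs with hm
    · have := ih fun i hi => h i (by omega)
      linarith
    · have h1 := h (n + 1) le_rfl
      rw [sum_range_succ] at h1
      have h2 : ∑ j ∈ range n, (if m ≤ j + 1 then (1 : ℝ) else 0) * f j = 0 := by
        refine sum_eq_zero fun j hj => ?_
        rw [if_neg (by have := mem_range.1 hj; omega), zero_mul]
      rw [h2]
      linarith

lemma ite_bounds (m j : ℕ) : (0 : ℝ) ≤ (if m ≤ j then 2 else 0) ∧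
    (if m ≤ j then (2 : ℝ) else 0) ≤ 2 := by
  split_ifs <;> norm_num

lemma weight_bounds {d : ℕ → ℝ} (hd : ∀ j, 0 ≤ d j ∧ d j ≤ 2) (m j : ℕ) :
    0 ≤ 5 * d j + (if m ≤ j then 2 else 0) ∧ 5 * d j + (if m ≤ j then 2 else 0) ≤ 12 := by
  have h1 := hd j
  have h2 := ite_bounds m j
  constructor <;> linarith

lemma sum_weight_eq (n m : ℕ) (d f : ℕ → ℝ) :
    ∑ j ∈ range n, (5 * d (j + 1) + if m ≤ j + 1 then 2 else 0) * f j =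
      ∑ j ∈ range n, 5 * d (j + 1) * f j +
        2 * ∑ j ∈ range n, (if m ≤ j + 1 then 1 else 0) * f j := by
  rw [mul_sum, ← sum_add_distrib]
  refine sum_congr rfl fun j _ => ?_
  split_ifs <;> ring

/-- Weights are at most `12 = 5 · 2 + 2`, and each table entry is off by at most `8`; whence the
rounding loss `96 n e`. The strict inequality leaves room for `η`. -/
lemma exists_gap {M err n e E : ℝ} {D : ℕ} (hE : 1048576 * E ≤ err) (he : 0 ≤ e)
    (hn : n ≤ D) (h : 12 * (err + 8 * D) * e < M) :
    ∃ η, 0 < η ∧ ∀ x, M - 96 * n * e ≤ 1048576 * x → η + 12 * e * E ≤ x := by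
  refine ⟨(M - 12 * (err + 8 * D) * e) / 1048576, by apply div_pos <;> linarith, fun x hx => ?_⟩
  have h1 := mul_le_mul_of_nonneg_right hE he
  have h2 := mul_le_mul_of_nonneg_right hn he
  rw [div_add' _ _ _ (by norm_num), div_le_iff₀ (by norm_num)]
  linarith

lemma corner_tails {X Y : ℕ} {c : ℕ → ℝ} {z : ℂ} {s : Signs} {T : Table} {err D : ℕ}
    {E : ℝ} (hs : s.Abs (shift 1 c)) (hc0 : c 0 = 1) (hD : s.len + 1 = D) (hT : T.Near z 1)
    (hE : 1048576 * E ≤ err)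
    (h : fold X Y (8388608 * (X + Y)) (finalA X (144 * (err + 8 * D) ^ 2 *
      (sq (dist X 33554432) + sq (dist Y 33554432)))) s T 0 0 0 = true) :
    ∃ η, 0 < η ∧ ∀ d : ℕ → ℝ, (∀ j, 0 ≤ d j ∧ d j ≤ 2) → 1 ≤ d 0 → ∀ m : ℕ,
      η + 12 * ‖direction X Y‖ * E ≤ ip (direction X Y)
        (∑ j ∈ range D, (((5 * d j + if m ≤ j then 2 else 0) * c j : ℝ) : ℂ) * z ^ j) := by
  obtain ⟨f, a, b, r, hf, hk⟩ := fold_sound hs hT h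
  rw [finalA_eq, natBlt_eq_true] at hk
  obtain ⟨h1, h2⟩ := lt_sub_of_sq_lt (direction_norm_sq X Y) hk
  -- This is `Re e ≥ 0`, needed to use the leading digit. For smaller `X` the test would demand `12
  -- neg + 2 (pos - neg) < 2 pos`, which is impossible.
  have hX : 33554432 ≤ X := by
    by_contra hcon
    rw [Nat.sub_eq_zero_of_le (show X ≤ 33554432 by omega)] at h2
    have h3 := le_max_right r (a - b)
    omega
  subst hD
  have hre : (direction X Y).re = (X : ℝ) - 33554432 := rfl
  have hXr : (33554432 : ℝ) ≤ X := by exact_mod_cast hX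
  push_cast [Nat.cast_sub hX] at h1
  rw [← hre] at h1
  set R : ℝ := max (r : ℝ) ((a - b : ℕ) : ℝ) with hR
  have hsum := hf.sum_eq
  simp only [Nat.cast_zero, sub_zero, zero_add] at hsum
  obtain ⟨η, h0, hη⟩ := exists_gap (n := s.len) (D := s.len + 1) hE
    (norm_nonneg (direction X Y)) (by push_cast; linarith) (by push_cast; exact h1)
  refine ⟨η, h0, fun d hd hd0 m => hη _ (le_trans ?_ (hf.le_ip hc0 (weight_bounds hd m)))⟩
  have h3 := hf.neg_le_sum hd
  have h4 := sum_ite_le f m (n := s.len) (r := R) (by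
    intro i hi
    rcases hi.lt_or_eq with hi | rfl
    · have := hf.prefix_le i hi
      simp only [Nat.cast_zero, sub_zero, zero_add] at this
      exact this.trans (le_max_left _ _)
    · rw [← hsum]
      exact (cast_sub_sub a b).2.2.trans (le_max_right _ _)) ((Nat.cast_nonneg r).trans
        (le_max_left _ _))
  have h5 : 5 * (direction X Y).re ≤
      (5 * d 0 + if m ≤ 0 then 2 else 0) * (direction X Y).re := by
    refine mul_le_mul_of_nonneg_right ?_ (by rw [hre]; linarith)
    have := (ite_bounds m 0).1
    linarith
  rw [sum_weight_eq]
  linarith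

lemma corner_edge {X Y : ℕ} {c : ℕ → ℝ} {z : ℂ} {s : Signs} {T : Table} {err D : ℕ}
    {E : ℝ} (hs : s.Abs (shift 1 c)) (hc0 : c 0 = 1) (hD : s.len + 1 = D) (hT : T.Near z 1)
    (hE : 1048576 * E ≤ err)
    (h : fold X Y (8388608 * (X + Y)) (finalB X (144 * (err + 8 * D) ^ 2 *
      (sq (dist X 33554432) + sq (dist Y 33554432)))) s T 0 0 0 = true) :
    ∃ η, 0 < η ∧ ∀ d : ℕ → ℝ, (∀ j, 0 ≤ d j ∧ d j ≤ 2) → d 0 = 0 → ∀ m : ℕ, m ≤ 1 →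
      η + 12 * ‖direction X Y‖ * E ≤ ip (direction X Y)
        (∑ j ∈ range D, (((5 * d j + if m ≤ j then 2 else 0) * c j : ℝ) : ℂ) * z ^ j) := by
  obtain ⟨f, a, b, r, hf, hk⟩ := fold_sound hs hT h
  rw [finalB_eq, natBlt_eq_true] at hk
  obtain ⟨h1, h2⟩ := lt_sub_of_sq_lt (direction_norm_sq X Y) hk
  subst hD
  have hre : (direction X Y).re = (X : ℝ) - 33554432 := rfl
  have hO : (33554432 : ℝ) - X ≤ ((33554432 - X : ℕ) : ℝ) := by
    simpa using (cast_sub_sub 33554432 X).2.2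
  push_cast at h1
  have hO0 : (0 : ℝ) ≤ ((33554432 - X : ℕ) : ℝ) := Nat.cast_nonneg _
  have hsum := hf.sum_eq
  simp only [Nat.cast_zero, sub_zero, zero_add] at hsum
  obtain ⟨η, h0, hη⟩ := exists_gap (n := s.len) (D := s.len + 1) hE
    (norm_nonneg (direction X Y)) (by push_cast; linarith) (by push_cast; exact h1)
  refine ⟨η, h0, fun d hd hd0 m hm => hη _ (le_trans ?_ (hf.le_ip hc0 (weight_bounds hd m)))⟩
  have h3 := hf.neg_le_sum hd
  -- With `m ≤ 1` the indicator can only remove the constant term.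
  have h4 : ∑ j ∈ range s.len, (if m ≤ j + 1 then 1 else 0) * f j = ∑ j ∈ range s.len, f j := by
    refine sum_congr rfl fun j _ => ?_
    rw [if_pos (by omega), one_mul]
  have h5 : -2 * ((33554432 - X : ℕ) : ℝ) ≤
      (5 * d 0 + if m ≤ 0 then 2 else 0) * (direction X Y).re := by
    rw [hd0, hre]
    split_ifs <;> linarith
  rw [sum_weight_eq, h4]
  linarith

/-- Soundness does not depend on how the directions were chosen; any directions passing both tests
would do. -/
lemma goodWord_mk (T : Four Table) (err : ℕ) (s : Signs) (P : Four Pt)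
    (h : goodWord T err (.mk s P) = true) : ∃ X X' Y,
      foldAll T err X Y (finalA X) (unwind s true) = true ∧
      foldAll T err X' Y (finalB X') (unwind s true) = true := by
  have h1 : goodWord T err (.mk s P) = band (foldAll T err (Four.sum Pt.fst P) (Four.sum Pt.snd P)
      (finalA (Four.sum Pt.fst P)) (unwind s true))
    (foldAll T err (Nat.sub (Four.sum Pt.fst P) 3670016) (Four.sum Pt.snd P)
      (finalB (Nat.sub (Four.sum Pt.fst P) 3670016)) (unwind s true)) := rfl
  rw [h1, band_eq_true] at h
  exact ⟨_, _, _, h⟩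

/-- The two separation properties hold when the word of `c` passes the test. -/
lemma goodWord_sound {z : ℂ} {c : ℕ → ℝ} (hc : ∀ j, |c j| ≤ 1) (hc0 : c 0 = 1) {C : Four Pt}
    {T : Four Table} {w : Fin 4 → ℝ} {err D : ℕ} {E : ℝ}
    (hT : ∀ i, (T.get i).Near (C.get i).lattice 1) (hE : 1048576 * E ≤ err)
    (hI : Interpolates z (fun i => (C.get i).lattice) w D E) {v : Word} (hv : v.Matches C c D)
    (h : goodWord T (144 * (err + 8 * D) ^ 2) v = true) :
    SeparatesTails z c ∧ SeparatesEdge z c := by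
  obtain ⟨s, P⟩ := v
  obtain ⟨hs, hD, -⟩ : s.Rel c ∧ s.len + 1 = D ∧
    ∀ i, (P.get i).Near (∑ j ∈ range D, (c j : ℂ) * (C.get i).lattice ^ j) := hv
  obtain ⟨X, X', Y, hA, hB⟩ := goodWord_mk _ _ _ _ h
  have hs' := hs.abs_unwind true (by simpa using hc0)
  have hD' : (unwind s true).len + 1 = D := by rw [len_unwind, hD]
  exact ⟨separatesTails_of_corners hc hI (direction X Y) fun i =>
      corner_tails hs' hc0 hD' (hT i) hE (foldAll_eq_true hA i),
    separatesEdge_of_corners hc hI (direction X' Y) fun i =>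
      corner_edge hs' hc0 hD' (hT i) hE (foldAll_eq_true hB i)⟩

end CellCheck

end

/-! ### From words of length `n` to words of length `n + 1` -/

section

open Finset

namespace CellCheck
open TwoMapIFS

/-- The tail bound `|z|ⁿ |1 + z| / (1 - |z|²)`. -/
noncomputable def tailBound (z : ℂ) (n : ℕ) : ℝ := ‖z‖ ^ n * (‖1 + z‖ / (1 - ‖z‖ ^ 2))

/-- The data of a cell containing `z`: corners `C`, weights `w`, ellipse sizes `K`, interpolation
error `E` and radius `r`, in fixed-point units. -/
structure CellData (z : ℂ) (C : Four Pt) (w : Fin 4 → ℝ) (K : Four ℕ) (E r : ℕ) : Prop where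
  norm_lt : ‖z‖ < 1
  corner_le : ∀ i, (C.get i).fst + (C.get i).snd ≤ 2896
  corner_norm : ∀ i, ‖(C.get i).lattice‖ ≤ 4 / 5
  interp : ∀ (n : ℕ) (E' : ℝ), E + 1048576 * tailBound z n ≤ 1048576 * E' →
    Interpolates z (fun i => (C.get i).lattice) w n E'
  sum_le : (∀ i, 1048576 < (K.get i : ℝ)) → ∑ i, w i * K.get i ≤ 1048576 * (1 / (1 - ‖z‖))
  norm_le : ‖z‖ ≤ r / 1448

variable {z : ℂ} {C : Four Pt} {w : Fin 4 → ℝ} {K : Four ℕ} {E r : ℕ}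

/-- The margin `tail + E + 8` covers truncation, interpolation and rounding. It counts twice for the
ellipse, where two distances are added. -/
lemma CellData.false_of_pruned (h : CellData z C w K E r) {c : ℕ → ℝ} (hc : Admissible z c)
    (hc0 : c 0 = 1) {n tail : ℕ} (ht : 1048576 * tailBound z n ≤ tail) {P : Four Pt}
    (hP : ∀ i, (P.get i).Near (∑ j ∈ range n, (c j : ℂ) * (C.get i).lattice ^ j))
    (hp : pruned (K.map fun k => mkEll (k - 2 * (tail + E + 8))) (tail + E + 8) P = true) :
    False := by
  have hI := h.interp n ((E + tail) / 1048576) (by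
    rw [mul_div_cancel₀ _ (by norm_num)]; linarith)
  rcases pruned_cases hp with hp | hp
  · have hK : ∀ i, 1048576 < (K.get i : ℝ) ∧ 1048576 * (‖∑ j ∈ range n,
        (c j : ℂ) * (C.get i).lattice ^ j‖ + ‖∑ j ∈ range n, (c j : ℂ) * (C.get i).lattice ^ j - 1‖)
          ≤ K.get i - 2 * (E + tail) := by
      intro i
      have h1 := hp i
      rw [Four.get_map] at h1
      obtain ⟨h2, h3⟩ := inEll_sound h1
      have h4 : 2 * (tail + E + 8) ≤ K.get i := by
        by_contra hcon
        rw [Nat.sub_eq_zero_of_le (by omega)] at h2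
        norm_num at h2
      rw [Nat.cast_sub h4] at h2 h3
      push_cast at h2 h3
      have h5 := hP i
      generalize (∑ j ∈ range n, (c j : ℂ) * (C.get i).lattice ^ j) = u at h5 ⊢
      have h6 : ‖(1048576 : ℂ) * u‖ ≤ ‖(P.get i).vec‖ + 8 := by
        have := norm_sub_norm_le ((1048576 : ℂ) * u) (P.get i).vec
        rw [norm_sub_rev] at this
        unfold Pt.Near at h5
        linarith
      have h7 : ‖(1048576 : ℂ) * (u - 1)‖ ≤ ‖(P.get i).vec - 1048576‖ + 8 := by
        have := norm_sub_norm_le ((1048576 : ℂ) * (u - 1)) ((P.get i).vec - 1048576)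
        rw [norm_sub_rev (1048576 * (u - 1)), show (P.get i).vec - 1048576 - 1048576 * (u - 1) =
          (P.get i).vec - 1048576 * u by ring] at this
        unfold Pt.Near at h5
        linarith
      rw [norm_mul] at h6 h7
      norm_num at h6 h7
      have h8 : (0 : ℝ) ≤ tail := Nat.cast_nonneg _
      have h9 : (0 : ℝ) ≤ E := Nat.cast_nonneg _
      constructor <;> linarith
    refine hc.false_of_ellipse h.norm_lt hc0 hI (K := fun i => K.get i / 1048576) ?_ fun i => ?_
    · have := h.sum_le fun i => (hK i).1
      simp only [← mul_div_assoc, ← sum_div]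
      rw [div_le_iff₀ (by norm_num)]
      linarith
    · have := (hK i).2
      rw [← mul_div_assoc, ← sub_div, le_div_iff₀ (by norm_num)]
      linarith
  · refine hc.false_of_halfPlane hc0 hI fun i => ?_
    have h1 := inHalf_sound (hp i)
    have h2 := (Complex.abs_re_le_norm _).trans (hP i)
    generalize (∑ j ∈ range n, (c j : ℂ) * (C.get i).lattice ^ j) = u at h2 ⊢
    have h3 : ((1048576 : ℂ) * u).re = 1048576 * u.re := by
      simp
    rw [Complex.sub_re, h3, abs_le] at h2
    push_cast at h1
    have : u.re ≤ (786432 - (E + tail)) / 1048576 := by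
      rw [le_div_iff₀ (by norm_num)]; linarith
    rw [sub_div] at this
    linarith

lemma partialSum_succ (c : ℕ → ℝ) (z : ℂ) (n : ℕ) :
    ∑ j ∈ range (n + 1), (c j : ℂ) * z ^ j =
      c 0 + z * ∑ j ∈ range n, (shift 1 c j : ℂ) * z ^ j := by
  rw [sum_range_succ', mul_sum, add_comm]
  congr 1
  · simp
  · refine sum_congr rfl fun j _ => ?_
    rw [shift, add_comm 1 j]; ring

/-- Admissibility is inherited by tails and by negatives, so the covering hypothesis applies to the
tail of `c` or to its negative, according to the sign of `c 1`. -/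
lemma CellData.covers_level (h : CellData z C w K E r) {n tail : ℕ}
    (ht : 1048576 * tailBound z (n + 1) ≤ tail) {F : List Word} (hF : Covers z C n F) :
    Covers z C (n + 1) (level C (K.map fun k => mkEll (k - 2 * (tail + E + 8)))
      (tail + E + 8) F) := by
  intro c hc hc0
  have hshift := hc.tail 1
  rcases hc.1 1 with h1 | h1
  · obtain ⟨⟨s, P⟩, hw, hs, hl, hP⟩ := hF (shift 1 c) hshift h1
    have hP' : ∀ i, (((C.map₂ mulPt P).map oneAdd).get i).Near
        (∑ j ∈ range (n + 1), (c j : ℂ) * (C.get i).lattice ^ j) := by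
      intro i
      rw [Four.get_map, Four.get_map₂, partialSum_succ, hc0, Complex.ofReal_one]
      exact (near_of_mulPt (h.corner_le i) (h.corner_norm i) (hP i)
        (norm_sum_le_five hshift.abs_le (h.corner_norm i) n)).1
    refine ⟨_, (mem_level hw).1 fun hp => h.false_of_pruned hc hc0 ht hP' hp, ⟨?_, hs⟩, ?_, hP'⟩
    · rw [hc0, h1]
    · rw [← hl]; rfl
  · obtain ⟨⟨s, P⟩, hw, hs, hl, hP⟩ := hF (fun j => -shift 1 c j) hshift.neg (by
      simp [shift, h1])
    have hP' : ∀ i, (((C.map₂ mulPt P).map oneSub).get i).Near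
        (∑ j ∈ range (n + 1), (c j : ℂ) * (C.get i).lattice ^ j) := by
      intro i
      have h2 : ∑ j ∈ range n, (shift 1 c j : ℂ) * (C.get i).lattice ^ j =
          -∑ j ∈ range n, (((fun j => -shift 1 c j) j : ℝ) : ℂ) * (C.get i).lattice ^ j := by
        simp
      rw [Four.get_map, Four.get_map₂, partialSum_succ, hc0, Complex.ofReal_one, h2, mul_neg,
        ← sub_eq_add_neg]
      exact (near_of_mulPt (h.corner_le i) (h.corner_norm i) (hP i)
        (norm_sum_le_five hshift.neg.abs_le (h.corner_norm i) n)).2.1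
    refine ⟨_, (mem_level hw).2 fun hp => h.false_of_pruned hc hc0 ht hP' hp, ⟨?_, ?_⟩, ?_, hP'⟩
    · rw [hc0, h1]
    · have h3 := hs.neg
      simpa using h3
    · rw [← hl]; rfl

lemma allGood_cons (T : Four Table) (err : ℕ) (v : Word) (F : List Word) :
    allGood T err (v :: F) = band (goodWord T err v) (allGood T err F) := rfl

lemma allGood_mem {T : Four Table} {err : ℕ} {F : List Word} (h : allGood T err F = true)
    {v : Word} (hv : v ∈ F) : goodWord T err v = true := by
  induction F with
  | nil => simp at hv
  | cons u F ih =>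
    rw [allGood_cons, band_eq_true] at h
    rcases List.mem_cons.1 hv with rfl | hv
    · exact h.1
    · exact ih h.2 hv

lemma run_zero (C : Four Pt) (K : Four ℕ) (T : Four Table) (E r D tail : ℕ) (F : List Word) :
    run C K T E r 0 D tail F = allGood T (144 * (E + tail + 8 * D) ^ 2) F := by
  have h : run C K T E r 0 D tail F =
    allGood T (Nat.mul 144 (sq (Nat.add (Nat.add E tail) (Nat.mul 8 D)))) F := rfl
  rw [h, sq_eq]; simp only [Nat.add_eq, Nat.mul_eq]

lemma run_succ (C : Four Pt) (K : Four ℕ) (T : Four Table) (E r n D tail : ℕ) (F : List Word) :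
    run C K T E r (n + 1) D tail F = run C K T E r n (D + 1) (tail * r / 1448 + 1)
      (level C (K.map fun k => mkEll (k - 2 * (tail * r / 1448 + 1 + E + 8)))
        (tail * r / 1448 + 1 + E + 8) F) := by
  have h : run C K T E r (n + 1) D tail F = run C K T E r n (Nat.succ D)
      (Nat.add (Nat.div (Nat.mul tail r) 1448) 1)
      (level C (K.map fun k => mkEll (Nat.sub k (Nat.mul 2 (Nat.add (Nat.add (Nat.add (Nat.div
        (Nat.mul tail r) 1448) 1) E) 8)))) (Nat.add (Nat.add (Nat.add (Nat.div
        (Nat.mul tail r) 1448) 1) E) 8) F) := rfl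
  rw [h]; simp only [Nat.add_eq, Nat.mul_eq, Nat.sub_eq, natDiv_eq, Nat.succ_eq_add_one]

lemma tailBound_nonneg {z : ℂ} (hz : ‖z‖ < 1) (n : ℕ) : 0 ≤ tailBound z n := by
  have : ‖z‖ ^ 2 ≤ 1 := pow_le_one₀ (norm_nonneg _) hz.le
  exact mul_nonneg (by positivity) (div_nonneg (norm_nonneg _) (by linarith))

/-- The added `1` pays for the rounding down in the division. -/
lemma tail_step {z : ℂ} (hz : ‖z‖ < 1) {r : ℕ} (hr : ‖z‖ ≤ r / 1448) {n tail : ℕ}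
    (ht : 1048576 * tailBound z n ≤ tail) :
    1048576 * tailBound z (n + 1) ≤ (tail * r / 1448 + 1 : ℕ) := by
  have h1 : tailBound z (n + 1) = ‖z‖ * tailBound z n := by simp only [tailBound]; ring
  have h2 := (cast_div_bounds (tail * r) 1448 (by norm_num)).1
  have h3 : ‖z‖ * (1048576 * tailBound z n) ≤ r / 1448 * tail :=
    mul_le_mul hr ht (mul_nonneg (by norm_num) (tailBound_nonneg hz n)) (by positivity)
  push_cast at h2 ⊢
  rw [h1]
  have h4 : (r : ℝ) / 1448 * tail = tail * r / 1448 := by ring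
  linarith

lemma CellData.run_sound (h : CellData z C w K E r) {T : Four Table}
    (hT : ∀ i, (T.get i).Near (C.get i).lattice 1) {n D tail : ℕ} {F : List Word}
    (hF : Covers z C D F) (ht : 1048576 * tailBound z D ≤ tail)
    (hrun : run C K T E r n D tail F = true) {c : ℕ → ℝ} (hc : Admissible z c) (hc0 : c 0 = 1) :
    SeparatesTails z c ∧ SeparatesEdge z c := by
  induction n generalizing D tail F with
  | zero =>
    rw [run_zero] at hrun
    obtain ⟨v, hv, hm⟩ := hF c hc hc0
    refine goodWord_sound hc.abs_le hc0 hT (err := E + tail) (E := ((E + tail : ℕ) : ℝ) / 1048576)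
      ?_ (h.interp D _ ?_) hm (allGood_mem hrun hv)
    · rw [mul_div_cancel₀ _ (by norm_num)]
    · rw [mul_div_cancel₀ _ (by norm_num)]; push_cast; linarith
  | succ n ih =>
    rw [run_succ] at hrun
    have ht' := tail_step h.norm_lt h.norm_le ht
    exact ih (h.covers_level ht' hF) ht' hrun

end CellCheck

end

/-! ### Geometry of a cell and soundness of the subdivision -/

section

open Finset

namespace CellCheck
open TwoMapIFS

/-- Bilinear weights. -/
noncomputable def bilinear (a b : ℝ) : Fin 4 → ℝ := ![(1 - a) * (1 - b), a * (1 - b), (1 - a) * b, a * b]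

lemma bilinear_nonneg {a b : ℝ} (ha : 0 ≤ a) (ha' : a ≤ 1) (hb : 0 ≤ b) (hb' : b ≤ 1) (i : Fin 4) :
    0 ≤ bilinear a b i := by
  have h1 : 0 ≤ 1 - a := by linarith
  have h2 : 0 ≤ 1 - b := by linarith
  fin_cases i <;> simp [bilinear] <;> positivity

lemma sum_bilinear (a b : ℝ) : ∑ i, bilinear a b i = 1 := by
  simp only [bilinear, Fin.sum_univ_four, Matrix.cons_val]; ring

/-- The corners of a square. -/
noncomputable def corners (x y s : ℕ) : Four Pt :=
  .mk (.mk x y) (.mk (x + s) y) (.mk x (y + s)) (.mk (x + s) (y + s))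

lemma corner_bounds (x y s : ℕ) (i : Fin 4) : ((corners x y s).get i).fst ≤ x + s ∧
    ((corners x y s).get i).snd ≤ y + s := by
  fin_cases i
  · exact ⟨Nat.le_add_right x s, Nat.le_add_right y s⟩
  · exact ⟨le_rfl, Nat.le_add_right y s⟩
  · exact ⟨Nat.le_add_right x s, le_rfl⟩
  · exact ⟨le_rfl, le_rfl⟩

lemma sum_corners (x y s : ℕ) (w : Fin 4 → ℝ) (g : ℕ → ℕ → ℝ) :
    ∑ i, w i * g ((corners x y s).get i).fst ((corners x y s).get i).snd =
      w 0 * g x y + w 1 * g (x + s) y + w 2 * g x (y + s) + w 3 * g (x + s) (y + s) := by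
  rw [Fin.sum_univ_four]; rfl

lemma norm_lattice_le {c : Pt} {q u v : ℕ} (h1 : c.fst ≤ u) (h2 : c.snd ≤ v)
    (h : u ^ 2 + v ^ 2 ≤ q ^ 2) : ‖c.lattice‖ ≤ q / 1448 := by
  refine le_of_sq_le_sq ?_ (by positivity)
  have h3 : c.fst ^ 2 + c.snd ^ 2 ≤ q ^ 2 :=
    le_trans (Nat.add_le_add (Nat.pow_le_pow_left h1 2) (Nat.pow_le_pow_left h2 2)) h
  have h4 : (c.fst : ℝ) ^ 2 + (c.snd : ℝ) ^ 2 ≤ (q : ℝ) ^ 2 := by exact_mod_cast h3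
  rw [norm_sq_eq]
  simp only [Pt.lattice, div_pow]
  rw [← add_div]
  exact div_le_div_of_nonneg_right h4 (by norm_num)

/-- The point with coordinates `X`, `Y` in lattice units. -/
noncomputable def scaled (X Y : ℝ) : ℂ := ⟨X / 1448, Y / 1448⟩

lemma norm_scaled_le {X Y q : ℝ} (hq : 0 ≤ q) (h : X ^ 2 + Y ^ 2 ≤ q ^ 2) :
    ‖scaled X Y‖ ≤ q / 1448 := by
  refine le_of_sq_le_sq ?_ (by positivity)
  rw [norm_sq_eq]
  simp only [scaled, div_pow]
  rw [← add_div]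
  exact div_le_div_of_nonneg_right h (by norm_num)

lemma sum_bilinear_corners (x y s : ℕ) (a b : ℝ) :
    ∑ i, (bilinear a b i : ℂ) * ((corners x y s).get i).lattice = scaled (x + a * s) (y + b * s) := by
  apply Complex.ext
  · rw [Complex.re_sum]
    simp only [Complex.re_ofReal_mul]
    refine (sum_corners x y s (bilinear a b) fun u v => (u : ℝ) / 1448).trans ?_
    simp only [bilinear, Matrix.cons_val, scaled]
    push_cast
    ring
  · rw [Complex.im_sum]
    simp only [Complex.im_ofReal_mul]
    refine (sum_corners x y s (bilinear a b) fun u v => (v : ℝ) / 1448).trans ?_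
    simp only [bilinear, Matrix.cons_val, scaled]
    push_cast
    ring

/-- The variance is `(s/1448)² (a(1-a) + b(1-b))`, and each product is at most `1/4`. -/
lemma variance_le (x y s : ℕ) (a b : ℝ) :
    ∑ i, bilinear a b i * ‖((corners x y s).get i).lattice - scaled (x + a * s) (y + b * s)‖ ^ 2 ≤
      (s : ℝ) ^ 2 / (2 * 1448 ^ 2) := by
  simp only [norm_sq_eq, Complex.sub_re, Complex.sub_im]
  rw [show ∑ i, bilinear a b i * ((((corners x y s).get i).lattice.re -
      (scaled (x + a * s) (y + b * s)).re) ^ 2 + (((corners x y s).get i).lattice.im -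
      (scaled (x + a * s) (y + b * s)).im) ^ 2) = _ from
    sum_corners x y s _ fun u v => ((u : ℝ) / 1448 - (x + a * s) / 1448) ^ 2 +
      ((v : ℝ) / 1448 - (y + b * s) / 1448) ^ 2]
  simp only [bilinear, Matrix.cons_val]
  push_cast
  have h : 0 ≤ (s : ℝ) ^ 2 * ((a - 1 / 2) ^ 2 + (b - 1 / 2) ^ 2) := by positivity
  rw [le_div_iff₀ (by norm_num)]
  linarith

lemma interpolates_of_cell {x y s q E : ℕ} {a b : ℝ} (ha : 0 ≤ a) (ha' : a ≤ 1) (hb : 0 ≤ b)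
    (hb' : b ≤ 1) (hq : (x + s) ^ 2 + (y + s) ^ 2 ≤ q ^ 2) (hq' : 5 * q ≤ 5792)
    (hE : 1518338048 * s ^ 2 / (2 * ((1448 - q) * (1448 - q) ^ 2)) + 1 ≤ E) (n : ℕ) (E' : ℝ)
    (h : E + 1048576 * tailBound (scaled (x + a * s) (y + b * s)) n ≤ 1048576 * E') :
    Interpolates (scaled (x + a * s) (y + b * s)) (fun i => ((corners x y s).get i).lattice)
      (bilinear a b) n E' := by
  set z := scaled (x + a * s) (y + b * s) with hz
  have hq1 : (q : ℝ) / 1448 ≤ 4 / 5 := by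
    have : (5 * q : ℝ) ≤ 5792 := by exact_mod_cast hq'
    linarith
  have hp : ∀ i, ‖((corners x y s).get i).lattice‖ ≤ q / 1448 := fun i =>
    norm_lattice_le (corner_bounds x y s i).1 (corner_bounds x y s i).2 hq
  have hw := bilinear_nonneg ha ha' hb hb'
  have hzq : ‖z‖ ≤ q / 1448 := by
    rw [hz, ← sum_bilinear_corners]
    calc _ ≤ ∑ i, bilinear a b i * (q / 1448) := by
          refine norm_sum_le_of_le _ fun i _ => ?_
          rw [norm_mul, Complex.norm_real, Real.norm_of_nonneg (hw i)]
          exact mul_le_mul_of_nonneg_left (hp i) (hw i)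
      _ = _ := by rw [← sum_mul, sum_bilinear, one_mul]
  have hz1 : ‖z‖ < 1 := by linarith
  have hre : 0 ≤ z.re := by
    rw [hz]; simp only [scaled]; positivity
  refine ⟨hw, sum_bilinear a b, fun c M hc => ?_⟩
  have hM : 0 ≤ M := (abs_nonneg _).trans (hc 0)
  have h1 := norm_interp_sub_le hw (sum_bilinear a b) (sum_bilinear_corners x y s a b) hp hzq
    (by linarith) (variance_le x y s a b) hc n
  rw [← hz] at h1
  have h2 : ‖∑ j ∈ range n, (c j : ℂ) * z ^ j - ser c z‖ ≤ M * tailBound z n := by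
    rw [ser_eq_sum_add hc hz1 n, sub_add_cancel_left, norm_neg, norm_mul, norm_pow, tailBound]
    have := norm_ser_le_of_re_nonneg (c := shift n c) (fun j => hc (n + j)) hz1 hre
    calc _ ≤ ‖z‖ ^ n * (M * ‖1 + z‖ / (1 - ‖z‖ ^ 2)) := by gcongr
      _ = _ := by ring
  have h3 := norm_sub_le_norm_sub_add_norm_sub (∑ i, (bilinear a b i : ℂ) *
    ∑ j ∈ range n, (c j : ℂ) * ((corners x y s).get i).lattice ^ j)
    (∑ j ∈ range n, (c j : ℂ) * z ^ j) (ser c z)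
  have hq2 : q ≤ 1448 := by omega
  have h4 : 1048576 * ((s : ℝ) ^ 2 / (2 * 1448 ^ 2) / (1 - q / 1448) ^ 3) ≤ E := by
    have h5 := (cast_div_bounds (1518338048 * s ^ 2) (2 * ((1448 - q) * (1448 - q) ^ 2)) (by
      have : 0 < 1448 - q := by omega
      positivity)).1
    have h6 : ((1518338048 * s ^ 2 / (2 * ((1448 - q) * (1448 - q) ^ 2)) : ℕ) : ℝ) + 1 ≤ E := by
      exact_mod_cast hE
    push_cast [Nat.cast_sub hq2] at h5
    have h7 : (1448 - q : ℝ) ≠ 0 := by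
      have : (0 : ℝ) < 1448 - q := by linarith
      exact this.ne'
    have h8 : (1048576 * ((s : ℝ) ^ 2 / (2 * 1448 ^ 2) / (1 - q / 1448) ^ 3)) =
        1518338048 * (s : ℝ) ^ 2 / (2 * ((1448 - q) * (1448 - q) ^ 2)) := by
      rw [show (1 : ℝ) - q / 1448 = (1448 - q) / 1448 by ring]
      field_simp
      ring
    rw [h8]
    linarith
  have h9 : (s : ℝ) ^ 2 / (2 * 1448 ^ 2) / (1 - q / 1448) ^ 3 + tailBound z n ≤ E' := by linarith
  have h10 := mul_le_mul_of_nonneg_left h9 hM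
  linarith

/-- A tangent of the convex function `1/(1-r)`; the difference is a multiple of `(t(1-r) - 1)²`. -/
lemma tangent_le {r t : ℝ} (hr : r < 1) : 2 * t - t ^ 2 * (1 - r) ≤ 1 / (1 - r) := by
  have h : 0 < 1 - r := by linarith
  rw [le_div_iff₀ h]
  nlinarith [sq_nonneg (t * (1 - r) - 1)]

lemma cornerK_mk (cx cy m a b : ℕ) : cornerK cx cy m (.mk a b) =
    6073352192 * (((2896 - m) * m + (cx * a + cy * b)) - m * 1448) /
      ((2896 - m) * (2896 - m) * m) := by
  have h : cornerK cx cy m (.mk a b) = Nat.div (Nat.mul 6073352192 (Nat.sub (Nat.add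
    (Nat.mul (Nat.sub 2896 m) m) (Nat.add (Nat.mul cx a) (Nat.mul cy b))) (Nat.mul m 1448)))
      (Nat.mul (Nat.mul (Nat.sub 2896 m) (Nat.sub 2896 m)) m) := rfl
  rw [h]; simp only [Nat.add_eq, Nat.mul_eq, Nat.sub_eq, natDiv_eq]

/-- Positivity rules out division by zero and truncated subtractions, so the integer formula is the
real one rounded down. -/
lemma cornerK_le {cx cy m : ℕ} {c : Pt} (h : 0 < cornerK cx cy m c) :
    (0 : ℝ) < m ∧ (cornerK cx cy m c : ℝ) ≤ 1048576 * (2 * (2896 / (2896 - m)) -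
      (2896 / (2896 - m)) ^ 2 * (1 - (cx / m * c.lattice.re + cy / m * c.lattice.im))) := by
  obtain ⟨a, b⟩ := c
  rw [cornerK_mk] at h ⊢
  have hm : 0 < m := by
    by_contra hcon
    obtain rfl : m = 0 := by omega
    simp at h
  have hd : m < 2896 := by
    by_contra hcon
    rw [Nat.sub_eq_zero_of_le (show 2896 ≤ m by omega)] at h
    simp at h
  have hle : m * 1448 ≤ (2896 - m) * m + (cx * a + cy * b) := by
    by_contra hcon
    rw [Nat.sub_eq_zero_of_le (show (2896 - m) * m + (cx * a + cy * b) ≤ m * 1448 by omega)] at h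
    simp at h
  have hm' : (0 : ℝ) < m := by exact_mod_cast hm
  refine ⟨hm', (Nat.cast_div_le).trans (le_of_eq ?_)⟩
  push_cast [Nat.cast_sub hle, Nat.cast_sub hd.le]
  have hd' : (2896 : ℝ) - m ≠ 0 := by
    have : (m : ℝ) < 2896 := by exact_mod_cast hd
    linarith
  have l1 : (Pt.mk a b).lattice = ⟨(a : ℝ) / 1448, (b : ℝ) / 1448⟩ := rfl
  rw [l1]
  field_simp
  ring

/-- The unrounded corner bound is affine in the point, so averaging reproduces its value at `z`
exactly. As `(cx, cy)/m` has norm at most `1`, the linear part is at most `|z|`, and `tangent_le`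
applies. -/
lemma sum_cornerK_le {x y s cx cy m : ℕ} {a b : ℝ} (ha : 0 ≤ a) (ha' : a ≤ 1) (hb : 0 ≤ b)
    (hb' : b ≤ 1) (hm : cx ^ 2 + cy ^ 2 ≤ m ^ 2) (hz : ‖scaled (x + a * s) (y + b * s)‖ < 1)
    (h : ∀ i, 0 < ((corners x y s).map (cornerK cx cy m)).get i) :
    ∑ i, bilinear a b i * ((corners x y s).map (cornerK cx cy m)).get i ≤
      1048576 * (1 / (1 - ‖scaled (x + a * s) (y + b * s)‖)) := by
  have hw := bilinear_nonneg ha ha' hb hb'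
  set t : ℝ := 2896 / (2896 - m)
  have h1 : ∀ i, (0 : ℝ) < m ∧ (((corners x y s).map (cornerK cx cy m)).get i : ℝ) ≤
      1048576 * (2 * t - t ^ 2 * (1 - (cx / m * ((corners x y s).get i).lattice.re +
        cy / m * ((corners x y s).get i).lattice.im))) := by
    intro i
    have := h i
    rw [Four.get_map] at this ⊢
    exact cornerK_le this
  have hm0 : (0 : ℝ) < m := (h1 0).1
  have h2 : ∑ i, bilinear a b i * ((corners x y s).map (cornerK cx cy m)).get i ≤
      1048576 * (2 * t - t ^ 2 * (1 - (cx / m * (scaled (x + a * s) (y + b * s)).re +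
        cy / m * (scaled (x + a * s) (y + b * s)).im))) := by
    calc _ ≤ ∑ i, bilinear a b i * (1048576 * (2 * t - t ^ 2 * (1 -
          (cx / m * ((corners x y s).get i).lattice.re +
          cy / m * ((corners x y s).get i).lattice.im)))) :=
          sum_le_sum fun i _ => mul_le_mul_of_nonneg_left (h1 i).2 (hw i)
      _ = _ := by
          rw [show ∑ i, bilinear a b i * (1048576 * (2 * t - t ^ 2 * (1 -
            (cx / m * ((corners x y s).get i).lattice.re +
            cy / m * ((corners x y s).get i).lattice.im)))) = _ from
            sum_corners x y s _ fun u v => 1048576 * (2 * t - t ^ 2 * (1 -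
              (cx / m * ((u : ℝ) / 1448) + cy / m * ((v : ℝ) / 1448))))]
          simp only [bilinear, Matrix.cons_val, scaled]
          push_cast
          ring
  refine h2.trans (mul_le_mul_of_nonneg_left ?_ (by norm_num))
  refine le_trans ?_ (tangent_le (t := t) hz)
  have h3 : ‖(⟨cx / m, cy / m⟩ : ℂ)‖ ≤ 1 := by
    refine le_of_sq_le_sq ?_ (by norm_num)
    rw [norm_sq_eq]
    simp only [div_pow]
    rw [← add_div, one_pow, div_le_one (by positivity)]
    exact_mod_cast hm
  have h4 := (le_abs_self _).trans (abs_ip_le ⟨cx / m, cy / m⟩ (scaled (x + a * s) (y + b * s)))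
  have h5 := mul_le_mul_of_nonneg_right h3 (norm_nonneg (scaled (x + a * s) (y + b * s)))
  simp only [ip] at h4
  have h6 : (cx / m * (scaled (x + a * s) (y + b * s)).re +
        cy / m * (scaled (x + a * s) (y + b * s)).im) ≤ ‖scaled (x + a * s) (y + b * s)‖ := by
    linarith
  nlinarith [mul_le_mul_of_nonneg_left h6 (sq_nonneg t)]

lemma one_near (z : ℂ) : one.Near (z ^ 0) := by
  have : one.vec = 1048576 := by
    apply Complex.ext
    · simp only [Pt.vec, one, Pt.fst_mk]; norm_num
    · simp only [Pt.vec, one, Pt.snd_mk]; norm_num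
  rw [pow_zero, Pt.Near, this]
  norm_num

lemma covers_one (z : ℂ) (C : Four Pt) : Covers z C 1 [.mk .nil (.mk one one one one)] := by
  intro c _ hc0
  refine ⟨_, List.mem_singleton_self _, trivial, rfl, fun i => ?_⟩
  have h1 : (Four.mk one one one one).get i = one := by fin_cases i <;> rfl
  have h2 := one_near (C.get i).lattice
  rw [h1]
  simpa [hc0] using h2

/-- The initial tail bound. -/
lemma tailBound_one_le {z : ℂ} {p r : ℕ} (hp : ‖1 + z‖ ≤ p / 1448) (hr : ‖z‖ ≤ r / 1448)
    (hr' : r ≤ 1024) : 1048576 * tailBound z 1 ≤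
      ((1518338048 * p / (2096704 - r ^ 2) + 1) * r / 1448 + 1 : ℕ) := by
  have hr1 : (r : ℝ) ≤ 1024 := by exact_mod_cast hr'
  have hz : ‖z‖ < 1 := by linarith
  refine tail_step hz hr ?_
  have hr2 : r ^ 2 < 2096704 := lt_of_le_of_lt (Nat.pow_le_pow_left hr' 2) (by norm_num)
  have h1 := (cast_div_bounds (1518338048 * p) (2096704 - r ^ 2) (by omega)).1
  push_cast [Nat.cast_sub hr2.le] at h1 ⊢
  refine le_trans ?_ (by linarith : 1518338048 * (p : ℝ) / (2096704 - r ^ 2) ≤ _)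
  have hr3 : (r : ℝ) ^ 2 < 2096704 := by exact_mod_cast hr2
  have h2 : ‖z‖ ^ 2 ≤ r ^ 2 / 2096704 := by
    have := pow_le_pow_left₀ (norm_nonneg z) hr 2
    rw [div_pow] at this
    norm_num at this ⊢
    exact this
  have h3 : (2096704 - (r : ℝ) ^ 2) / 2096704 ≤ 1 - ‖z‖ ^ 2 := by
    rw [sub_div]; norm_num; linarith
  have h4 : (0 : ℝ) < (2096704 - (r : ℝ) ^ 2) / 2096704 := by
    apply div_pos <;> linarith
  simp only [tailBound, pow_zero, one_mul]
  calc 1048576 * (‖1 + z‖ / (1 - ‖z‖ ^ 2)) ≤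
        1048576 * (p / 1448 / ((2096704 - (r : ℝ) ^ 2) / 2096704)) := by gcongr
    _ = _ := by
      have : (2096704 - (r : ℝ) ^ 2) ≠ 0 := by linarith
      field_simp
      ring

/-- Every normalised admissible sequence at `z` has the two separation properties. -/
def Good (z : ℂ) : Prop :=
  ∀ c, Admissible z c → c 0 = 1 → SeparatesTails z c ∧ SeparatesEdge z c

lemma cellAux_eq (C : Four Pt) (cx cy xs ys s D q p m r : ℕ) : cellAux C cx cy xs ys s D q p m r =
    band (Nat.ble (xs ^ 2 + ys ^ 2) (q ^ 2)) (band (Nat.ble (5 * q) 5792)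
    (band (Nat.ble ((1448 + xs) ^ 2 + ys ^ 2) (p ^ 2)) (band (Nat.ble (cx ^ 2 + cy ^ 2) (m ^ 2))
    (run C (C.map (cornerK cx cy m)) (C.map (fun c => table c D one))
      (1518338048 * s ^ 2 / (2 * ((1448 - q) * (1448 - q) ^ 2)) + 1) r (Nat.pred D) 1
      ((1518338048 * p / (2096704 - r ^ 2) + 1) * r / 1448 + 1)
      [.mk .nil (.mk one one one one)])))) := by
  have h : cellAux C cx cy xs ys s D q p m r =
    band (Nat.ble (Nat.add (sq xs) (sq ys)) (sq q)) (band (Nat.ble (Nat.mul 5 q) 5792)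
    (band (Nat.ble (Nat.add (sq (Nat.add 1448 xs)) (sq ys)) (sq p))
    (band (Nat.ble (Nat.add (sq cx) (sq cy)) (sq m))
    (run C (Four.map (cornerK cx cy m) C) (Four.map (fun c => table c D one) C)
      (Nat.add (Nat.div (Nat.mul 1518338048 (sq s)) (Nat.mul 2 (Nat.mul (Nat.sub 1448 q)
        (sq (Nat.sub 1448 q))))) 1) r (Nat.pred D) 1
      (Nat.add (Nat.div (Nat.mul (Nat.add (Nat.div (Nat.mul 1518338048 p)
        (Nat.sub 2096704 (sq r))) 1) r) 1448) 1)
      (List.cons (Word.mk Signs.nil (Four.mk one one one one)) List.nil))))) := rfl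
  rw [h]; simp only [sq_eq, Nat.add_eq, Nat.mul_eq, Nat.sub_eq, natDiv_eq]

lemma cellAux_sound {x y s cx cy D q p m r : ℕ} (hr : r ≤ 1024) (hr' : r = q ∨ r = 1024)
    (h : cellAux (corners x y s) cx cy (x + s) (y + s) s D q p m r = true) {a b : ℝ} (ha : 0 ≤ a)
    (ha' : a ≤ 1) (hb : 0 ≤ b) (hb' : b ≤ 1)
    (hz : ‖scaled (x + a * s) (y + b * s)‖ ^ 2 ≤ 1 / 2) : Good (scaled (x + a * s) (y + b * s)) := by
  rw [cellAux_eq] at h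
  simp only [band_eq_true, Nat.ble_eq] at h
  obtain ⟨hq, hq', hp, hm, hrun⟩ := h
  have hX : (x + a * s) ≤ ((x + s : ℕ) : ℝ) := by
    push_cast
    nlinarith [(Nat.cast_nonneg s : (0 : ℝ) ≤ s)]
  have hY : (y + b * s) ≤ ((y + s : ℕ) : ℝ) := by
    push_cast
    nlinarith [(Nat.cast_nonneg s : (0 : ℝ) ≤ s)]
  have hX0 : (0 : ℝ) ≤ x + a * s := by positivity
  have hY0 : (0 : ℝ) ≤ y + b * s := by positivity
  have hsq : ((x + s : ℕ) : ℝ) ^ 2 + ((y + s : ℕ) : ℝ) ^ 2 ≤ q ^ 2 := by exact_mod_cast hq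
  have hzq : ‖scaled (x + a * s) (y + b * s)‖ ≤ q / 1448 :=
    norm_scaled_le (Nat.cast_nonneg q) ((add_le_add (pow_le_pow_left₀ hX0 hX 2)
      (pow_le_pow_left₀ hY0 hY 2)).trans hsq)
  have hzr : ‖scaled (x + a * s) (y + b * s)‖ ≤ r / 1448 := by
    rcases hr' with rfl | rfl
    · exact hzq
    · refine le_of_sq_le_sq (hz.trans (by norm_num)) (by norm_num)
  have hr1 : (r : ℝ) ≤ 1024 := by exact_mod_cast hr
  have hz1 : ‖scaled (x + a * s) (y + b * s)‖ < 1 := by linarith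
  have hzp : ‖1 + scaled (x + a * s) (y + b * s)‖ ≤ p / 1448 := by
    have e : 1 + scaled (x + a * s) (y + b * s) = scaled (1448 + (x + a * s)) (y + b * s) := by
      apply Complex.ext
      · simp only [scaled, Complex.add_re, Complex.one_re]; ring
      · simp only [scaled, Complex.add_im, Complex.one_im]; ring
    rw [e]
    have hp1 : (1448 + ((x + s : ℕ) : ℝ)) ^ 2 + ((y + s : ℕ) : ℝ) ^ 2 ≤ p ^ 2 := by
      exact_mod_cast hp
    exact norm_scaled_le (Nat.cast_nonneg p) ((add_le_add (pow_le_pow_left₀ (by linarith)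
      (by linarith) 2) (pow_le_pow_left₀ hY0 hY 2)).trans hp1)
  have hq1 : (q : ℝ) / 1448 ≤ 4 / 5 := by
    have : (5 * q : ℝ) ≤ 5792 := by exact_mod_cast hq'
    linarith
  have hdata : CellData (scaled (x + a * s) (y + b * s)) (corners x y s) (bilinear a b)
      ((corners x y s).map (cornerK cx cy m))
      (1518338048 * s ^ 2 / (2 * ((1448 - q) * (1448 - q) ^ 2)) + 1) r := by
    refine ⟨hz1, fun i => ?_, fun i => ?_, fun n E' h => ?_, fun h => ?_, hzr⟩
    · have h1 := corner_bounds x y s i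
      -- `5 q ≤ 5792` gives `q ≤ 1158`, and two coordinates of that size stay below `2896`.
      have h2 : (x + s) ^ 2 ≤ 1158 ^ 2 :=
        (Nat.le_add_right _ _).trans (hq.trans (Nat.pow_le_pow_left (by omega) 2))
      have h3 : (y + s) ^ 2 ≤ 1158 ^ 2 :=
        (Nat.le_add_left _ _).trans (hq.trans (Nat.pow_le_pow_left (by omega) 2))
      have h4 := lt_of_pow_lt_pow_left₀ 2 (Nat.zero_le _) (h2.trans_lt (by norm_num : _ < 1159 ^ 2))
      have h5 := lt_of_pow_lt_pow_left₀ 2 (Nat.zero_le _) (h3.trans_lt (by norm_num : _ < 1159 ^ 2))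
      omega
    · exact (norm_lattice_le (corner_bounds x y s i).1 (corner_bounds x y s i).2 hq).trans hq1
    · exact interpolates_of_cell ha ha' hb hb' hq hq' le_rfl n E' h
    · refine sum_cornerK_le ha ha' hb hb' hm hz1 fun i => ?_
      have := h i
      have h0 : (0 : ℝ) < ((corners x y s).map (cornerK cx cy m)).get i := by linarith
      exact_mod_cast h0
  intro c hc hc0
  refine hdata.run_sound (fun i => ?_) (covers_one _ _) (tailBound_one_le hzp hzr hr) hrun hc hc0
  rw [Four.get_map]
  exact table_near (hdata.corner_le i) (hdata.corner_norm i) D (one_near _)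

lemma cell_sound {x y s D : ℕ} (h : cell x y s D = true) {a b : ℝ} (ha : 0 ≤ a)
    (ha' : a ≤ 1) (hb : 0 ≤ b) (hb' : b ≤ 1)
    (hz : ‖scaled (x + a * s) (y + b * s)‖ ^ 2 ≤ 1 / 2) : Good (scaled (x + a * s) (y + b * s)) := by
  have h1 : cell x y s D = (fun q => cellAux (corners x y s) (Nat.add (Nat.mul 2 x) s)
      (Nat.add (Nat.mul 2 y) s) (x + s) (y + s) s D q
      (sqrtUp (Nat.add (sq (Nat.add 1448 (Nat.add x s))) (sq (Nat.add y s))))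
      (sqrtUp (Nat.add (sq (Nat.add (Nat.mul 2 x) s)) (sq (Nat.add (Nat.mul 2 y) s))))
      (sel (Nat.ble q 1024) q 1024)) (sqrtUp (Nat.add (sq (Nat.add x s)) (sq (Nat.add y s)))) := rfl
  rw [h1] at h
  -- The value of `sqrtUp` is irrelevant, because `cellAux` rechecks the inequality that `q` should
  -- satisfy.
  generalize sqrtUp (Nat.add (sq (Nat.add x s)) (sq (Nat.add y s))) = q at h
  have h2 : sel (Nat.ble q 1024) q 1024 ≤ 1024 ∧
      (sel (Nat.ble q 1024) q 1024 = q ∨ sel (Nat.ble q 1024) q 1024 = 1024) := by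
    rw [sel_eq]
    simp only [Nat.ble_eq]
    split_ifs with hq
    · exact ⟨hq, Or.inl rfl⟩
    · exact ⟨le_rfl, Or.inr rfl⟩
  exact cellAux_sound h2.1 h2.2 h ha ha' hb hb' hz

lemma outside_sound {x y s : ℕ} (h : outside x y s = true) {X Y : ℝ} (hX : x ≤ X)
    (hX' : X ≤ x + s) (hY : y ≤ Y) (hY' : Y ≤ y + s) :
    1 / 2 < ‖scaled X Y‖ ^ 2 ∨ ‖scaled X Y‖ < 1 / 2 := by
  have h1 : outside x y s = sel (Nat.blt 2096704 (Nat.mul 2 (Nat.add (sq x) (sq y)))) true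
    (Nat.blt (Nat.mul 4 (Nat.add (sq (Nat.add x s)) (sq (Nat.add y s)))) 2096704) := rfl
  rw [h1, sel_eq] at h
  simp only [natBlt_eq_true, sq_eq, Nat.add_eq, Nat.mul_eq] at h
  have e : ‖scaled X Y‖ ^ 2 = (X ^ 2 + Y ^ 2) / 2096704 := by
    rw [norm_sq_eq]; simp only [scaled]; ring
  have hx0 : (0 : ℝ) ≤ x := Nat.cast_nonneg x
  have hy0 : (0 : ℝ) ≤ y := Nat.cast_nonneg y
  by_cases h2 : 2096704 < 2 * (x ^ 2 + y ^ 2)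
  · left
    have h3 : (2096704 : ℝ) < 2 * ((x : ℝ) ^ 2 + (y : ℝ) ^ 2) := by exact_mod_cast h2
    rw [e, lt_div_iff₀ (by norm_num)]
    have := pow_le_pow_left₀ hx0 hX 2
    have := pow_le_pow_left₀ hy0 hY 2
    linarith
  · right
    rw [if_neg h2, natBlt_eq_true] at h
    have h3 : 4 * (((x : ℝ) + s) ^ 2 + ((y : ℝ) + s) ^ 2) < 2096704 := by exact_mod_cast h
    refine lt_of_pow_lt_pow_left₀ 2 (by norm_num) ?_
    rw [e, div_lt_iff₀ (by norm_num)]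
    have := pow_le_pow_left₀ (hx0.trans hX) hX' 2
    have := pow_le_pow_left₀ (hy0.trans hY) hY' 2
    linarith

lemma exists_affine {x s X : ℝ} (h1 : x ≤ X) (h2 : X ≤ x + s) :
    ∃ a, 0 ≤ a ∧ a ≤ 1 ∧ X = x + a * s := by
  rcases (by linarith : 0 ≤ s).eq_or_lt with rfl | hs
  · exact ⟨0, le_rfl, zero_le_one, by linarith⟩
  · refine ⟨(X - x) / s, by apply div_nonneg <;> linarith, ?_, ?_⟩
    · rw [div_le_one hs]; linarith
    · rw [div_mul_cancel₀ _ hs.ne']; ring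

lemma check_l_zero (x y s : ℕ) : check (.l 0) x y s = outside x y s := rfl

lemma check_l_succ (D x y s : ℕ) : check (.l (D + 1)) x y s = cell x y s (D + 1) := rfl

lemma check_n (A B C D : Cert) (x y s : ℕ) : check (.n A B C D) x y s =
    band (Nat.beq (2 * (s / 2)) s) (band (check A x y (s / 2)) (band (check B (x + s / 2) y (s / 2))
      (band (check C x (y + s / 2) (s / 2)) (check D (x + s / 2) (y + s / 2) (s / 2))))) := rfl

lemma check_sound {T : Cert} {x y s : ℕ} (h : check T x y s = true) {X Y : ℝ} (hX : x ≤ X)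
    (hX' : X ≤ x + s) (hY : y ≤ Y) (hY' : Y ≤ y + s) (h1 : ‖scaled X Y‖ ^ 2 ≤ 1 / 2)
    (h2 : 1 / 2 ≤ ‖scaled X Y‖) : Good (scaled X Y) := by
  induction T generalizing x y s with
  | l D =>
    rcases D with _ | D
    · rw [check_l_zero] at h
      rcases outside_sound h hX hX' hY hY' with h3 | h3 <;> linarith
    · rw [check_l_succ] at h
      obtain ⟨a, ha, ha', rfl⟩ := exists_affine hX hX'
      obtain ⟨b, hb, hb', rfl⟩ := exists_affine hY hY'
      exact cell_sound h ha ha' hb hb' h1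
  | n A B C D hA hB hC hD =>
    rw [check_n] at h
    simp only [band_eq_true, Nat.beq_eq] at h
    obtain ⟨hs, kA, kB, kC, kD⟩ := h
    generalize s / 2 = u at hs kA kB kC kD
    subst hs
    push_cast at hX' hY'
    rcases le_total X (x + u) with h3 | h3 <;> rcases le_total Y (y + u) with h4 | h4
    · exact hA kA hX h3 hY h4
    · exact hC kC hX h3 (by push_cast; exact h4) (by push_cast; linarith)
    · exact hB kB (by push_cast; exact h3) (by push_cast; linarith) hY h4
    · exact hD kD (by push_cast; exact h3) (by push_cast; linarith) (by push_cast; exact h4)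
        (by push_cast; linarith)

end CellCheck

end

/-! ### Separation in the first quadrant -/

section

namespace CellCheck
open TwoMapIFS

lemma check_cert : check cert 0 0 1024 = true := by
  have h0 : ∀ x y, outside x y 256 = true → check (.l 0) x y 256 = true := fun _ _ h => h
  rw [cert, check_n]
  norm_num only [check_n, band_eq_true, check_cert_256_256, check_cert_512_0, check_cert_768_0,
    check_cert_512_256, check_cert_768_256, check_cert_0_512, check_cert_256_512,
    check_cert_0_768, check_cert_256_768, check_cert_512_512, check_cert_768_512,
    check_cert_512_768, Nat.beq_eq, and_true, true_and]
  -- What remains are the four leaves `l 0` occurring directly in `cert`.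
  refine ⟨⟨?_, ?_, ?_⟩, ?_⟩ <;> decide +kernel

/-- Separation in the first quadrant of the annulus. -/
theorem good_of_quadrant {z : ℂ} (hre : 0 ≤ z.re) (him : 0 ≤ z.im) (h1 : ‖z‖ ^ 2 ≤ 1 / 2)
    (h2 : 1 / 2 ≤ ‖z‖) : Good z := by
  have e : z = scaled (1448 * z.re) (1448 * z.im) := by
    apply Complex.ext
    · simp only [scaled]; ring
    · simp only [scaled]; ring
  have h3 := h1
  rw [norm_sq_eq] at h3
  rw [e] at h1 h2 ⊢
  refine check_sound check_cert ?_ ?_ ?_ ?_ h1 h2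
  · push_cast; linarith
  -- The side `1024` suffices because `1448² / 2 ≤ 1024²`.
  · push_cast; nlinarith [sq_nonneg z.im]
  · push_cast; linarith
  · push_cast; nlinarith [sq_nonneg z.re]

end CellCheck

end

/-! ### Symmetries: conjugation, `z ↦ -z`, global sign -/

section

open Finset ComplexConjugate

namespace TwoMapIFS

lemma ser_conj (c : ℕ → ℝ) (z : ℂ) : ser c (conj z) = conj (ser c z) := by
  simp only [ser]
  rw [Complex.conj_tsum]
  simp

lemma ip_conj (e z : ℂ) : ip (conj e) (conj z) = ip e z := by simp [ip]

lemma Admissible.conj {z : ℂ} {c : ℕ → ℝ} (h : Admissible z c) : Admissible (conj z) c := by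
  refine ⟨h.1, fun k => ?_⟩
  simp only [ser_conj, Complex.norm_conj, Complex.conj_re]
  exact h.2 k

lemma SeparatesTails.conj {z : ℂ} {c : ℕ → ℝ} (h : SeparatesTails z c) :
    SeparatesTails (conj z) c := by
  obtain ⟨e, η, h0, h⟩ := h
  refine ⟨starRingEnd ℂ e, η, h0, fun d hd hd0 n => ?_⟩
  rw [ser_conj, ip_conj]
  exact h d hd hd0 n

lemma SeparatesEdge.conj {z : ℂ} {c : ℕ → ℝ} (h : SeparatesEdge z c) :
    SeparatesEdge (conj z) c := by
  obtain ⟨e, η, h0, h⟩ := h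
  refine ⟨starRingEnd ℂ e, η, h0, fun d hd hd0 n hn => ?_⟩
  rw [ser_conj, ip_conj]
  exact h d hd hd0 n hn

/-- The sequence with alternating sign changes. -/
def alternate (c : ℕ → ℝ) : ℕ → ℝ := fun j => (-1) ^ j * c j

lemma ser_alternate (c : ℕ → ℝ) (z : ℂ) : ser (alternate c) (-z) = ser c z := by
  simp only [ser, alternate]
  refine tsum_congr fun j => ?_
  have h : ((-1 : ℂ) * -z) ^ j = z ^ j := by simp
  rw [mul_pow] at h
  push_cast
  rw [← h]
  ring

lemma shift_alternate (k : ℕ) (c : ℕ → ℝ) :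
    shift k (alternate c) = fun j => (-1) ^ k * alternate (shift k c) j := by
  funext j; simp only [shift, alternate, pow_add]; ring

lemma ser_const_mul (a : ℝ) (c : ℕ → ℝ) (z : ℂ) : ser (fun j => a * c j) z = a * ser c z := by
  simp only [ser, Complex.ofReal_mul, mul_assoc, tsum_mul_left]

lemma ser_shift_alternate (k : ℕ) (c : ℕ → ℝ) (z : ℂ) :
    ser (shift k (alternate c)) (-z) = ((-1) ^ k : ℝ) * ser (shift k c) z := by
  rw [shift_alternate, ser_const_mul, ser_alternate]

/-- At `-z` the `k`-th tail of the alternated sequence acquires the factor `(-1)^k`, which cancels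
against the one in its `k`-th coefficient. -/
lemma Admissible.alternating {z : ℂ} {c : ℕ → ℝ} (h : Admissible z c) :
    Admissible (-z) (alternate c) := by
  refine ⟨fun j => ?_, fun k => ?_⟩
  · rcases neg_one_pow_eq_or ℝ j with h1 | h1 <;> rcases h.1 j with h2 | h2 <;>
      simp [alternate, h1, h2]
  · have h1 := h.2 k
    rw [ser_shift_alternate, ser_shift_alternate, norm_mul, norm_mul, Complex.re_ofReal_mul,
      Complex.norm_real, Complex.norm_real, norm_neg, norm_pow, norm_pow, norm_neg, norm_one,
      one_pow, one_pow, one_mul, one_mul]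
    refine ⟨h1.1, ?_⟩
    have h2 : ((-1 : ℝ) ^ k) * (-1) ^ k = 1 := by rw [← mul_pow]; simp
    have h3 : alternate c k * ((-1) ^ k * (ser (shift k c) z).re) =
        (((-1 : ℝ) ^ k) * (-1) ^ k) * (c k * (ser (shift k c) z).re) := by
      simp only [alternate]; ring
    rw [h3, h2, one_mul]
    exact h1.2

lemma ser_mul_alternate (g c : ℕ → ℝ) (z : ℂ) :
    ser (fun j => g j * alternate c j) (-z) = ser (fun j => g j * c j) z := by
  rw [← ser_alternate (fun j => g j * c j)]
  congr 1
  funext j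
  simp only [alternate]; ring

lemma SeparatesTails.of_alternate {z : ℂ} {c : ℕ → ℝ} (h : SeparatesTails (-z) (alternate c)) :
    SeparatesTails z c := by
  obtain ⟨e, η, h0, h⟩ := h
  refine ⟨e, η, h0, fun d hd hd0 n => ?_⟩
  rw [← ser_mul_alternate]
  exact h d hd hd0 n

lemma SeparatesEdge.of_alternate {z : ℂ} {c : ℕ → ℝ} (h : SeparatesEdge (-z) (alternate c)) :
    SeparatesEdge z c := by
  obtain ⟨e, η, h0, h⟩ := h
  refine ⟨e, η, h0, fun d hd hd0 n hn => ?_⟩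
  rw [← ser_mul_alternate]
  exact h d hd hd0 n hn

lemma ser_mul_neg (g c : ℕ → ℝ) (z : ℂ) :
    ser (fun j => g j * -c j) z = -ser (fun j => g j * c j) z := by
  simp only [mul_neg, ser_neg]

lemma ip_neg_neg (e z : ℂ) : ip (-e) (-z) = ip e z := by simp [ip]

lemma SeparatesTails.of_neg {z : ℂ} {c : ℕ → ℝ} (h : SeparatesTails z fun j => -c j) :
    SeparatesTails z c := by
  obtain ⟨e, η, h0, h⟩ := h
  refine ⟨-e, η, h0, fun d hd hd0 n => ?_⟩
  have := h d hd hd0 n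
  rw [ser_mul_neg] at this
  rw [← ip_neg_neg, neg_neg]
  exact this

lemma SeparatesEdge.of_neg {z : ℂ} {c : ℕ → ℝ} (h : SeparatesEdge z fun j => -c j) :
    SeparatesEdge z c := by
  obtain ⟨e, η, h0, h⟩ := h
  refine ⟨-e, η, h0, fun d hd hd0 n hn => ?_⟩
  have := h d hd hd0 n hn
  rw [ser_mul_neg] at this
  rw [← ip_neg_neg, neg_neg]
  exact this

/-- The separation properties of an admissible sequence. -/
theorem Admissible.separates {z : ℂ} {c : ℕ → ℝ} (hc : Admissible z c) (h1 : ‖z‖ ^ 2 ≤ 1 / 2)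
    (h2 : 1 / 2 ≤ ‖z‖) : SeparatesTails z c ∧ SeparatesEdge z c := by
  have upper : ∀ (z : ℂ) (c : ℕ → ℝ), Admissible z c → ‖z‖ ^ 2 ≤ 1 / 2 → 1 / 2 ≤ ‖z‖ →
      c 0 = 1 → 0 ≤ z.re → SeparatesTails z c ∧ SeparatesEdge z c := by
    intro z c hc h1 h2 hc0 hre
    rcases le_total 0 z.im with him | him
    · exact CellCheck.good_of_quadrant hre him h1 h2 c hc hc0
    · have := CellCheck.good_of_quadrant (z := starRingEnd ℂ z) (by simpa using hre)
        (by simpa using him) (by rwa [Complex.norm_conj]) (by rwa [Complex.norm_conj]) c hc.conj hc0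
      have h3 := this.1.conj
      have h4 := this.2.conj
      rw [Complex.conj_conj] at h3 h4
      exact ⟨h3, h4⟩
  have right : ∀ (z : ℂ) (c : ℕ → ℝ), Admissible z c → ‖z‖ ^ 2 ≤ 1 / 2 → 1 / 2 ≤ ‖z‖ →
      c 0 = 1 → SeparatesTails z c ∧ SeparatesEdge z c := by
    intro z c hc h1 h2 hc0
    rcases le_total 0 z.re with hre | hre
    · exact upper z c hc h1 h2 hc0 hre
    · have := upper (-z) (alternate c) hc.alternating (by rwa [norm_neg]) (by rwa [norm_neg])
        (by simpa [alternate] using hc0) (by simpa using hre)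
      exact ⟨this.1.of_alternate, this.2.of_alternate⟩
  rcases hc.1 0 with h0 | h0
  · exact right z c hc h1 h2 h0
  · have := right z _ hc.neg h1 h2 (by simp [h0])
    exact ⟨this.1.of_neg, this.2.of_neg⟩

end TwoMapIFS

end

/-! ### From Taylor polynomials to admissibility -/

section

open Finset

namespace TwoMapIFS

/-- The real coefficient sequence of an integer power series. -/
noncomputable def coeffSeq (f : PowerSeries ℤ) (j : ℕ) : ℝ := (PowerSeries.coeff j f : ℤ)

lemma coeffSeq_mem {f : PowerSeries ℤ} (hf : f ∈ normalizedSeries) (j : ℕ) :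
    coeffSeq f j ∈ ({-1, 0, 1} : Set ℝ) := by
  have h := hf.1 j
  simp only [Set.mem_insert_iff, Set.mem_singleton_iff] at h
  rcases h with h | h | h <;> simp [coeffSeq, h]

lemma abs_le_one_of_mem {x : ℝ} (h : x ∈ ({-1, 0, 1} : Set ℝ)) : |x| ≤ 1 := by
  simp only [Set.mem_insert_iff, Set.mem_singleton_iff] at h
  rcases h with h | h | h <;> simp [h]

lemma abs_coeffSeq_le {f : PowerSeries ℤ} (hf : f ∈ normalizedSeries) (j : ℕ) :
    |coeffSeq f j| ≤ 1 := abs_le_one_of_mem (coeffSeq_mem hf j)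

lemma taylorPoly_eq_sum (f : PowerSeries ℤ) (k : ℕ) :
    taylorPoly f k = ∑ j ∈ range (k + 1), Polynomial.monomial j (PowerSeries.coeff j f) := by
  ext t
  rw [taylorPoly, PowerSeries.coeff_trunc, Polynomial.finsetSum_coeff]
  simp only [Polynomial.coeff_monomial]
  rw [sum_ite_eq']
  simp only [mem_range]

lemma evalAt_taylorPoly (z : ℂ) (f : PowerSeries ℤ) (k : ℕ) :
    evalAt z (taylorPoly f k) = ∑ j ∈ range (k + 1), (coeffSeq f j : ℂ) * z ^ j := by
  rw [evalAt, taylorPoly_eq_sum, map_sum]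
  refine sum_congr rfl fun j _ => ?_
  rw [Polynomial.aeval_monomial]
  simp [coeffSeq]

lemma ser_coeffSeq_eq_zero {z : ℂ} {f : PowerSeries ℤ} (hf : f ∈ seriesVanishingAt z) :
    ser (coeffSeq f) z = 0 := by
  have h := hf.2.tsum_eq
  rw [ser, ← h]
  refine tsum_congr fun j => ?_
  simp [coeffSeq]

lemma evalAt_taylorPoly_eq_tail {z : ℂ} (hz : ‖z‖ < 1) {f : PowerSeries ℤ}
    (hf : f ∈ seriesVanishingAt z) (k : ℕ) :
    evalAt z (taylorPoly f k) = -(z ^ (k + 1) * ser (shift (k + 1) (coeffSeq f)) z) := by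
  have h := ser_eq_sum_add (abs_coeffSeq_le hf.1) hz (k + 1)
  rw [ser_coeffSeq_eq_zero hf, ← evalAt_taylorPoly] at h
  exact eq_neg_of_add_eq_zero_left h.symm

lemma HasRationalForm.coeff_add {f : PowerSeries ℤ} {l p : ℕ} (h : HasRationalForm f l p) {j : ℕ}
    (hj : l + 1 ≤ j) : PowerSeries.coeff (j + p) f = PowerSeries.coeff j f := by
  have h1 := congrArg (PowerSeries.coeff (j + p)) h.2
  rw [sub_mul, one_mul, map_sub, map_sub, mul_comm, PowerSeries.coeff_mul_X_pow, map_sub, map_sum,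
    Polynomial.coeff_coe, Polynomial.coeff_coe, taylorPoly, PowerSeries.coeff_trunc,
    PowerSeries.coeff_trunc, if_neg (by omega), if_neg (by omega), sum_eq_zero] at h1
  · linarith
  · intro i hi
    rw [mem_Icc] at hi
    rw [PowerSeries.coeff_monomial, if_neg (by omega)]

lemma HasRationalForm.coeff_add_mul {f : PowerSeries ℤ} {l p : ℕ} (h : HasRationalForm f l p)
    {j : ℕ} (hj : l + 1 ≤ j) (k : ℕ) :
    PowerSeries.coeff (j + k * p) f = PowerSeries.coeff j f := by
  induction k with
  | zero => simp
  | succ k ih => rw [add_mul, one_mul, ← add_assoc, h.coeff_add (by omega), ih]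

lemma HasRationalForm.coeff_ne_zero {f : PowerSeries ℤ} {l p : ℕ} (h : HasRationalForm f l p)
    (hz : {j : ℕ | PowerSeries.coeff j f = 0}.Finite) {j : ℕ} (hj : l + 1 ≤ j) :
    PowerSeries.coeff j f ≠ 0 := by
  intro h0
  refine Set.infinite_of_injective_forall_mem (f := fun k : ℕ => j + k * p) ?_ (fun k => ?_) hz
  · intro a b hab
    have hp := h.1
    exact Nat.eq_of_mul_eq_mul_right hp (Nat.add_left_cancel hab)
  · exact (h.coeff_add_mul hj k).trans h0

lemma HasRationalForm.shift_coeffSeq {f : PowerSeries ℤ} {l p : ℕ} (h : HasRationalForm f l p)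
    {n : ℕ} (hn : l + 1 ≤ n) (k : ℕ) :
    shift (n + k * p) (coeffSeq f) = shift n (coeffSeq f) := by
  funext j
  simp only [shift, coeffSeq]
  rw [show n + k * p + j = n + j + k * p by ring, h.coeff_add_mul (by omega)]

/-- Every index beyond the preperiod is congruent to one in any given window of length `p`. -/
lemma HasRationalForm.exists_shift_eq {f : PowerSeries ℤ} {l p : ℕ} (h : HasRationalForm f l p)
    {N n : ℕ} (hN : l + 1 ≤ N) (hn : l + 1 ≤ n) : ∃ i < p, 
      ∀ j, shift (n + j) (coeffSeq f) = shift (N + i + j) (coeffSeq f) := by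
  have hp := h.1
  -- This is `n - N` modulo `p`, written without subtraction.
  refine ⟨(n + N * (p - 1)) % p, Nat.mod_lt _ (by omega), fun j => ?_⟩
  have h1 := Nat.mod_add_div (n + N * (p - 1)) p
  set i := (n + N * (p - 1)) % p
  set q := (n + N * (p - 1)) / p
  obtain ⟨p', rfl⟩ : ∃ p', p = p' + 1 := ⟨p - 1, by omega⟩
  simp only [Nat.add_sub_cancel] at h1
  rw [← h.shift_coeffSeq (n := n + j) (by omega) N, ← h.shift_coeffSeq (n := N + i + j)
    (by omega) q]
  congr 1
  nlinarith

/-- Vanishing forces `1 = |z u_1| ≤ |z|/(1-|z|)`. -/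
lemma half_le_norm {z : ℂ} (hz : ‖z‖ < 1) {f : PowerSeries ℤ} (hf : f ∈ seriesVanishingAt z) :
    1 / 2 ≤ ‖z‖ := by
  have h := ser_eq_head_add (abs_coeffSeq_le hf.1) hz
  have h0 : coeffSeq f 0 = 1 := by simp [coeffSeq, hf.1.2]
  rw [ser_coeffSeq_eq_zero hf, h0] at h
  have h1 : ‖z * ser (shift 1 (coeffSeq f)) z‖ = 1 := by
    have : z * ser (shift 1 (coeffSeq f)) z = -1 := by
      push_cast at h
      linear_combination -h
    rw [this]; simp
  have h2 := norm_ser_le (c := shift 1 (coeffSeq f)) (fun j => abs_coeffSeq_le hf.1 (1 + j)) hz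
  rw [norm_mul] at h1
  have h3 : 1 ≤ ‖z‖ * (1 / (1 - ‖z‖)) := by
    exact h1.symm.le.trans (mul_le_mul_of_nonneg_left h2 (norm_nonneg z))
  rw [mul_one_div, le_div_iff₀ (by linarith)] at h3
  linarith

/-- The perpendicular bisector of `1/2` and `1` is the line `Re v = 3/4`. -/
lemma re_gt_of_norm_lt {v : ℂ} (h : ‖v - 1‖ < ‖v - 1 / 2‖) : 3 / 4 < v.re := by
  have h1 : ‖v - 1‖ ^ 2 < ‖v - 1 / 2‖ ^ 2 := pow_lt_pow_left₀ h (norm_nonneg _) (by norm_num)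
  rw [CellCheck.norm_sq_eq, CellCheck.norm_sq_eq] at h1
  simp at h1
  nlinarith

/-- The tail conditions imposed on the Taylor polynomials make the periodic part admissible. -/
theorem admissible_of_taylorPoly {lam : ℂ} (hlam : ‖lam‖ < 1) {f : PowerSeries ℤ}
    (hf : f ∈ seriesVanishingAt lam) {l p : ℕ} (hform : HasRationalForm f l p)
    (hzeros : {j : ℕ | PowerSeries.coeff j f = 0}.Finite)
    (h2 : ∀ n : ℕ, n < p →
      ‖evalAt lam (taylorPoly f (l + 1 + n))‖ + ‖evalAt lam (taylorPoly f (l + 1 + n + 1))‖ >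
        ‖lam ^ (l + 1 + n + 1)‖ / (1 - ‖lam‖))
    (h3 : ∀ n : ℕ, n < p → ∀ Q : Polynomial ℤ,
      2 * taylorPoly f l + Polynomial.X ^ (l + 1) * Q = 2 * taylorPoly f (l + 1 + n) →
      ∀ P : Polynomial ℤ, P.natDegree ≤ n →
        (∀ j, P.coeff j ∈ ({-2, -1, 0, 1, 2} : Set ℤ)) → P ≠ Q →
        2 * ‖evalAt lam (taylorPoly f (l + 1 + n))‖ <
          ‖2 * evalAt lam (taylorPoly f l) + lam ^ (l + 1) * evalAt lam P‖) :
    Admissible lam (shift (l + 1) (coeffSeq f)) := by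
  have hlam0 : 0 < ‖lam‖ := by have := half_le_norm hlam hf; linarith
  have hsign : ∀ j, l + 1 ≤ j → PowerSeries.coeff j f = 1 ∨ PowerSeries.coeff j f = -1 := by
    intro j hj
    have h4 := hf.1.1 j
    simp only [Set.mem_insert_iff, Set.mem_singleton_iff] at h4
    have h5 := hform.coeff_ne_zero hzeros hj
    tauto
  have hsign' : ∀ j, l + 1 ≤ j → coeffSeq f j = 1 ∨ coeffSeq f j = -1 := by
    intro j hj
    rcases hsign j hj with h | h <;> simp [coeffSeq, h]
  refine ⟨fun j => hsign' _ (by omega), fun k => ⟨?_, ?_⟩⟩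
  · rw [shift_shift, shift_shift]
    -- The window starts at `l + 2` because the Taylor polynomial of index `l + 1 + n` gives the
    -- tail from `l + 2 + n` on.
    obtain ⟨i, hi, hi'⟩ := hform.exists_shift_eq (N := l + 2) (n := l + 1 + k) (by omega) (by omega)
    have e0 := hi' 0
    have e1 := hi' 1
    simp only [add_zero] at e0
    rw [show l + 1 + (k + 1) = l + 1 + k + 1 by ring, e0, e1]
    have h4 := h2 i hi
    rw [evalAt_taylorPoly_eq_tail hlam hf, evalAt_taylorPoly_eq_tail hlam hf, norm_neg, norm_neg,
      norm_mul, norm_mul, gt_iff_lt, show l + 1 + i + 1 = l + 2 + i by ring, pow_succ lam (l + 2 + i),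
      norm_mul, div_eq_mul_one_div, mul_assoc, ← mul_add] at h4
    exact lt_of_mul_lt_mul_left h4 (norm_nonneg _)
  · obtain ⟨i, hi, hi'⟩ := hform.exists_shift_eq (N := l + 1) (n := l + 1 + k) (by omega) (by omega)
    rw [shift_shift]
    have e0 := hi' 0
    have e1 := hi' 1
    simp only [add_zero] at e0
    have e2 : shift (l + 1) (coeffSeq f) k = coeffSeq f (l + 1 + i) := by
      have := congrFun e0 0
      simpa [shift] using this
    rw [e2, e0]
    set Q : Polynomial ℤ := 2 * ∑ t ∈ range (i + 1),
      Polynomial.monomial t (PowerSeries.coeff (l + 1 + t) f) with hQ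
    have hsum : taylorPoly f (l + 1 + i) = taylorPoly f l + Polynomial.X ^ (l + 1) *
        ∑ t ∈ range (i + 1), Polynomial.monomial t (PowerSeries.coeff (l + 1 + t) f) := by
      rw [taylorPoly_eq_sum, taylorPoly_eq_sum, show l + 1 + i + 1 = (l + 1) + (i + 1) by ring,
        sum_range_add _ (l + 1) (i + 1), mul_sum]
      congr 1
      refine sum_congr rfl fun t _ => ?_
      rw [Polynomial.X_pow_mul_monomial, add_comm]
    have hQcoeff : ∀ t, Q.coeff t = if t < i + 1 then 2 * PowerSeries.coeff (l + 1 + t) f else 0 := by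
      intro t
      rw [hQ, two_mul, Polynomial.coeff_add, Polynomial.finsetSum_coeff]
      simp only [Polynomial.coeff_monomial]
      rw [sum_ite_eq']
      simp only [mem_range]
      split_ifs <;> ring
    -- The competitor lowers the top coefficient of `Q` from `2σ` to `σ`, with `σ = ±1`. After
    -- division by `2 λ^{l+1+i}`, minimality says that `σu` is closer to `1` than to `1/2`.
    set P : Polynomial ℤ := Q - Polynomial.monomial i (PowerSeries.coeff (l + 1 + i) f) with hP
    have hPcoeff : ∀ t, P.coeff t = (if t < i + 1 then 2 * PowerSeries.coeff (l + 1 + t) f else 0) -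
        if i = t then PowerSeries.coeff (l + 1 + i) f else 0 := by
      intro t
      rw [hP, Polynomial.coeff_sub, hQcoeff, Polynomial.coeff_monomial]
    have h4 := h3 i hi Q (by rw [hsum, hQ]; ring) P ?_ ?_ ?_
    · have h5 : 2 * evalAt lam (taylorPoly f l) + lam ^ (l + 1) * evalAt lam P =
          2 * evalAt lam (taylorPoly f (l + 1 + i)) -
            lam ^ (l + 1) * (coeffSeq f (l + 1 + i) * lam ^ i) := by
        rw [hsum, hP, hQ]
        simp only [evalAt, map_add, map_sub, map_mul, Polynomial.aeval_monomial, map_pow,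
          Polynomial.aeval_X, map_ofNat, coeffSeq]
        simp
        ring
      rw [h5, evalAt_taylorPoly_eq_tail hlam hf] at h4
      have h6 := ser_eq_head_add (c := shift (l + 1 + i) (coeffSeq f))
        (fun j => abs_coeffSeq_le hf.1 (l + 1 + i + j)) hlam
      rw [shift_shift] at h6
      have e3 : shift (l + 1 + i) (coeffSeq f) 0 = coeffSeq f (l + 1 + i) := by simp [shift]
      rw [e3] at h6
      set u := ser (shift (l + 1 + i) (coeffSeq f)) lam
      set u' := ser (shift (l + 1 + i + 1) (coeffSeq f)) lam
      set σ := coeffSeq f (l + 1 + i) with hσ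
      have h7 : ((σ : ℂ)) * σ = 1 := by
        rcases hsign' (l + 1 + i) (by omega) with h | h <;> simp [hσ, h]
      have h8 : ‖(σ : ℂ)‖ = 1 := by
        rcases hsign' (l + 1 + i) (by omega) with h | h <;> simp [hσ, h]
      have h9 : -(lam ^ (l + 1 + i + 1) * u') = -(lam ^ (l + 1 + i) * σ) * (σ * u - 1) := by
        linear_combination lam ^ (l + 1 + i) * h6 + lam ^ (l + 1 + i) * u * h7
      have h10 : 2 * -(lam ^ (l + 1 + i + 1) * u') - lam ^ (l + 1) * (σ * lam ^ i) =
          -(2 * lam ^ (l + 1 + i) * σ) * (σ * u - 1 / 2) := by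
        rw [h9]; ring
      rw [h10, h9, norm_mul, norm_mul, norm_neg, norm_neg, norm_mul, norm_mul, norm_mul, h8] at h4
      have h11 : ‖(σ : ℂ) * u - 1‖ < ‖(σ : ℂ) * u - 1 / 2‖ := by
        have h12 : 0 < 2 * ‖lam ^ (l + 1 + i)‖ := by
          rw [norm_pow]; positivity
        refine lt_of_mul_lt_mul_left ?_ h12.le
        simp only [RCLike.norm_ofNat] at h4
        linarith
      have := re_gt_of_norm_lt h11
      rwa [Complex.re_ofReal_mul] at this
    · refine Polynomial.natDegree_le_iff_coeff_eq_zero.2 fun t ht => ?_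
      rw [hPcoeff, if_neg (by omega), if_neg (by omega), sub_zero]
    · intro t
      rw [hPcoeff]
      simp only [Set.mem_insert_iff, Set.mem_singleton_iff]
      rcases hsign (l + 1 + t) (by omega) with h | h <;> split_ifs with h5 h6 h6 <;>
        first
        | (subst h6; rw [h]; norm_num)
        | (rw [h]; norm_num)
        | omega
    · intro hPQ
      have h5 := congrArg (fun R => Polynomial.coeff R i) hPQ
      simp only [hPcoeff, hQcoeff, if_pos (Nat.lt_succ_self i), if_true] at h5
      have h6 := hform.coeff_ne_zero hzeros (j := l + 1 + i) (by omega)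
      omega

end TwoMapIFS

end

/-! ### Vanishing series: compactness and connectedness -/

section

open Finset Filter Topology

namespace TwoMapIFS

lemma continuousOn_ser (M : ℝ) {ρ : ℝ} (hρ : ρ < 1) :
    ContinuousOn (fun p : (ℕ → ℝ) × ℂ => ser p.1 p.2)
      {p | (∀ j, |p.1 j| ≤ M) ∧ ‖p.2‖ ≤ ρ} := by
  rcases lt_or_ge ρ 0 with h0 | h0
  · convert continuousOn_empty _
    ext p
    simp only [Set.mem_ofPred_eq, Set.mem_empty_iff_false, iff_false, not_and, not_le]
    exact fun _ => h0.trans_le (norm_nonneg _)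
  · refine continuousOn_tsum (u := fun j => M * ρ ^ j) (fun j => ?_)
      ((summable_geometric_of_lt_one h0 hρ).mul_left M) fun j p hp => ?_
    · exact Continuous.continuousOn (by fun_prop)
    · rw [norm_mul, norm_pow, Complex.norm_real, Real.norm_eq_abs]
      exact mul_le_mul (hp.1 j) (pow_le_pow_left₀ (norm_nonneg _) hp.2 j) (by positivity)
        ((abs_nonneg _).trans (hp.1 j))

/-- A closed subset of a product of finite sets with a closed disc. Its projection makes the
parameters having such a zero a closed set. -/
lemma isCompact_zeros {S : ℕ → Set ℝ} (hS : ∀ j, (S j).Finite) {M ρ : ℝ}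
    (hM : ∀ j, ∀ x ∈ S j, |x| ≤ M) (hρ : ρ < 1) :
    IsCompact {p : (ℕ → ℝ) × ℂ | p ∈ Set.pi Set.univ S ×ˢ Metric.closedBall 0 ρ ∧
      ser p.1 p.2 = 0} := by
  have h1 : IsCompact (Set.pi Set.univ S ×ˢ Metric.closedBall (0 : ℂ) ρ) :=
    (isCompact_univ_pi fun j => (hS j).isCompact).prod (isCompact_closedBall 0 ρ)
  have hsub : Set.pi Set.univ S ×ˢ Metric.closedBall (0 : ℂ) ρ ⊆
      {p : (ℕ → ℝ) × ℂ | (∀ j, |p.1 j| ≤ M) ∧ ‖p.2‖ ≤ ρ} := by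
    rintro p ⟨hp, hp'⟩
    exact ⟨fun j => hM j _ (hp j (Set.mem_univ j)), by simpa using hp'⟩
  have h2 := ((continuousOn_ser M hρ).mono hsub).preimage_isClosed_of_isClosed h1.isClosed
    (isClosed_singleton (x := (0 : ℂ)))
  exact h1.of_isClosed_subset h2 fun p hp => hp.1

/-- If `c` is the only normalised series vanishing at `z₀`, then the series vanishing at nearby
points agree with it to any prescribed order. -/
lemma eventually_eq_coeff {z₀ : ℂ} (hz₀ : ‖z₀‖ < 1) {c : ℕ → ℝ}
    (huniq : ∀ g : ℕ → ℝ, (∀ j, g j ∈ ({-1, 0, 1} : Set ℝ)) → g 0 = 1 → ser g z₀ = 0 → g = c)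
    (j : ℕ) : ∀ᶠ z in 𝓝 z₀, ∀ g : ℕ → ℝ, (∀ j, g j ∈ ({-1, 0, 1} : Set ℝ)) → g 0 = 1 →
      ser g z = 0 → g j = c j := by
  obtain ⟨ρ, hρ0, hρ⟩ := exists_between hz₀
  -- Normalised sequences that disagree with `c` at index `j`; by uniqueness none of them vanishes
  -- at `z₀`.
  set S : ℕ → Set ℝ := fun i => {x | x ∈ ({-1, 0, 1} : Set ℝ) ∧ (i = 0 → x = 1) ∧
    (i = j → x ≠ c j)} with hS
  have h1 := isCompact_zeros (S := S) (M := 1) (fun i => (Set.toFinite ({-1, 0, 1} : Set ℝ)).subset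
    fun x hx => hx.1) (fun i x hx => abs_le_one_of_mem hx.1) hρ
  have h2 := (h1.image continuous_snd).isClosed
  have h3 : z₀ ∉ Prod.snd '' {p : (ℕ → ℝ) × ℂ | p ∈ Set.pi Set.univ S ×ˢ Metric.closedBall 0 ρ ∧
      ser p.1 p.2 = 0} := by
    rintro ⟨⟨g, z⟩, ⟨⟨hg, -⟩, h0⟩, rfl⟩
    have hg' := fun i => hg i (Set.mem_univ i)
    exact (hg' j).2.2 rfl (congrFun (huniq g (fun i => (hg' i).1) ((hg' 0).2.1 rfl) h0) j)
  have hball : ∀ᶠ z in 𝓝 z₀, ‖z‖ < ρ := continuous_norm.continuousAt.eventually_lt_const hρ0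
  filter_upwards [h2.isOpen_compl.mem_nhds h3, hball] with z hz hzρ g hg hg0 hgz
  by_contra hne
  refine hz ⟨(g, z), ⟨⟨fun i _ => ⟨hg i, ?_, ?_⟩, by simpa using hzρ.le⟩, hgz⟩, rfl⟩
  · rintro rfl; exact hg0
  · rintro rfl; exact hne

lemma shift_one_consSeq (x : ℝ) (c : ℕ → ℝ) : shift 1 (CellCheck.consSeq x c) = c := by
  funext j
  rw [shift, add_comm, CellCheck.consSeq_succ]

lemma hasSum_ser {c : ℕ → ℝ} {M : ℝ} (hc : ∀ j, |c j| ≤ M) {z : ℂ} (hz : ‖z‖ < 1) :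
    HasSum (fun j => (c j : ℂ) * z ^ j) (ser c z) := (summable_ser hc hz).hasSum

lemma attractor_eq_image {z : ℂ} (hz : ‖z‖ < 1) : attractor z =
    (fun c => ser c z) '' Set.pi Set.univ fun _ : ℕ => ({-1, 1} : Set ℝ) := by
  ext w
  constructor
  · rintro ⟨a, ha, hw⟩
    refine ⟨fun j => a j, fun j _ => ?_, ?_⟩
    · have := ha j
      simp only [Set.mem_insert_iff, Set.mem_singleton_iff] at this ⊢
      rcases this with h | h <;> simp [h]
    · rw [← hw.tsum_eq]
      simp [ser]
  · rintro ⟨c, hc, rfl⟩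
    have hc' := fun j => hc j (Set.mem_univ j)
    simp only [Set.mem_insert_iff, Set.mem_singleton_iff] at hc'
    refine ⟨fun j => if c j = 1 then 1 else -1, fun j => ?_, ?_⟩
    · by_cases h : c j = 1 <;> simp [h]
    · have := hasSum_ser (c := c) (M := 1) (fun j => by rcases hc' j with h | h <;> simp [h]) hz
      convert this using 2 with j
      rcases hc' j with h | h <;> norm_num [h]

lemma isCompact_attractor {z : ℂ} (hz : ‖z‖ < 1) : IsCompact (attractor z) := by
  rw [attractor_eq_image hz]
  refine (isCompact_univ_pi fun _ => (Set.toFinite _).isCompact).image_of_continuousOn ?_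
  refine (continuousOn_ser 1 hz).comp (f := fun c : ℕ → ℝ => (c, z)) (by fun_prop) fun c hc => ?_
  refine ⟨fun j => ?_, le_rfl⟩
  have := hc j (Set.mem_univ j)
  simp only [Set.mem_insert_iff, Set.mem_singleton_iff] at this
  rcases this with h | h <;> simp [h]

/-- At a parameter of the connectedness locus some normalised series vanishes. -/
lemma exists_vanishing {z : ℂ} (h : z ∈ connectednessLocus) : ∃ g : ℕ → ℝ,
    (∀ j, g j ∈ ({-1, 0, 1} : Set ℝ)) ∧ g 0 = 1 ∧ ser g z = 0 := by
  obtain ⟨hz, ⟨w₀, hw₀⟩, hconn⟩ := h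
  rw [mem_ball_zero_iff] at hz
  have hpart : ∀ σ : ℂ, IsClosed ((fun w => σ + z * w) '' attractor z) := fun σ =>
    ((isCompact_attractor hz).image (by fun_prop)).isClosed
  have hsub : ∀ σ : ℝ, σ = 1 ∨ σ = -1 → (fun w => (σ : ℂ) + z * w) '' attractor z ⊆ attractor z := by
    rintro σ hσ - ⟨w, hw, rfl⟩
    rw [attractor_eq_image hz] at hw ⊢
    obtain ⟨c, hc, rfl⟩ := hw
    have habs : ∀ j, |CellCheck.consSeq σ c j| ≤ 1 := by
      rintro (_ | j)
      · rcases hσ with rfl | rfl <;> simp [CellCheck.consSeq_zero]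
      · have := hc j (Set.mem_univ j)
        simp only [Set.mem_insert_iff, Set.mem_singleton_iff] at this
        rcases this with h | h <;> simp [CellCheck.consSeq_succ, h]
    refine ⟨CellCheck.consSeq σ c, ?_, ?_⟩
    · rintro (_ | j) -
      · rcases hσ with rfl | rfl <;> simp [CellCheck.consSeq_zero]
      · exact hc j (Set.mem_univ j)
    · simp only
      rw [ser_eq_head_add habs hz, shift_one_consSeq]
      rfl
  have hcover : attractor z ⊆ (fun w => ((-1 : ℝ) : ℂ) + z * w) '' attractor z ∪
      (fun w => ((1 : ℝ) : ℂ) + z * w) '' attractor z := by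
    intro w hw
    rw [attractor_eq_image hz] at hw
    obtain ⟨c, hc, rfl⟩ := hw
    have hc' := fun j => hc j (Set.mem_univ j)
    simp only [Set.mem_insert_iff, Set.mem_singleton_iff] at hc'
    have hs : ser (shift 1 c) z ∈ attractor z := by
      rw [attractor_eq_image hz]
      exact ⟨shift 1 c, fun j _ => hc (1 + j) (Set.mem_univ _), rfl⟩
    have he := ser_eq_head_add (c := c) (M := 1)
      (fun j => by rcases hc' j with h | h <;> simp [h]) hz
    rcases hc' 0 with h | h
    · exact Or.inl ⟨_, hs, by simp only; rw [he, h]⟩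
    · exact Or.inr ⟨_, hs, by simp only; rw [he, h]⟩
  -- A connected set covered by its two closed pieces has a common point `-1 + z x = 1 + z y`;
  -- halving the difference gives the series with coefficients `1` and then `(b j - a j)/2`.
  obtain ⟨w, -, ⟨x, hx, h1⟩, y, hy, h2⟩ := isPreconnected_closed_iff.1 hconn _ _
    (hpart _) (hpart _) hcover
    ⟨_, hsub (-1) (Or.inr rfl) ⟨w₀, hw₀, rfl⟩, w₀, hw₀, rfl⟩
    ⟨_, hsub 1 (Or.inl rfl) ⟨w₀, hw₀, rfl⟩, w₀, hw₀, rfl⟩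
  rw [attractor_eq_image hz] at hx hy
  obtain ⟨a, ha, rfl⟩ := hx
  obtain ⟨b, hb, rfl⟩ := hy
  have hmem : ∀ j, (b j - a j) / 2 ∈ ({-1, 0, 1} : Set ℝ) := by
    intro j
    have h3 := ha j (Set.mem_univ j)
    have h4 := hb j (Set.mem_univ j)
    simp only [Set.mem_insert_iff, Set.mem_singleton_iff] at h3 h4 ⊢
    rcases h3 with h3 | h3 <;> rcases h4 with h4 | h4 <;> norm_num [h3, h4]
  have hab : ser (fun j => (b j - a j) / 2) z = (ser b z - ser a z) / 2 := by
    have h3 := hasSum_ser (c := a) (M := 1) (fun j => by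
      have h3 := ha j (Set.mem_univ j)
      simp only [Set.mem_insert_iff, Set.mem_singleton_iff] at h3
      rcases h3 with h | h <;> simp [h]) hz
    have h4 := hasSum_ser (c := b) (M := 1) (fun j => by
      have h3 := hb j (Set.mem_univ j)
      simp only [Set.mem_insert_iff, Set.mem_singleton_iff] at h3
      rcases h3 with h | h <;> simp [h]) hz
    rw [← ((h4.sub h3).div_const 2).tsum_eq, ser]
    refine tsum_congr fun j => ?_
    push_cast
    ring
  have hg : ∀ j, CellCheck.consSeq 1 (fun j => (b j - a j) / 2) j ∈ ({-1, 0, 1} : Set ℝ) := by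
    rintro (_ | j)
    · simp [CellCheck.consSeq_zero]
    · exact hmem j
  refine ⟨CellCheck.consSeq 1 fun j => (b j - a j) / 2, hg, rfl, ?_⟩
  rw [ser_eq_head_add (fun j => abs_le_one_of_mem (hg j)) hz]
  rw [shift_one_consSeq, hab, CellCheck.consSeq_zero]
  have h3 : ((-1 : ℝ) : ℂ) + z * ser a z = ((1 : ℝ) : ℂ) + z * ser b z := h1.trans h2.symm
  push_cast at h3 ⊢
  linear_combination -h3 / 2

/-- Uniqueness in terms of real coefficient sequences. -/
lemma eq_coeffSeq_of_unique {z : ℂ} (hz : ‖z‖ < 1) {f : PowerSeries ℤ}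
    (hf : seriesVanishingAt z = {f}) (g : ℕ → ℝ) (hg : ∀ j, g j ∈ ({-1, 0, 1} : Set ℝ))
    (hg0 : g 0 = 1) (hgz : ser g z = 0) : g = coeffSeq f := by
  have h1 : ∀ j, ∃ a : ℤ, a ∈ ({-1, 0, 1} : Set ℤ) ∧ (a : ℝ) = g j := by
    intro j
    have := hg j
    simp only [Set.mem_insert_iff, Set.mem_singleton_iff] at this
    rcases this with h | h | h
    · exact ⟨-1, by simp, by simp [h]⟩
    · exact ⟨0, by simp, by simp [h]⟩
    · exact ⟨1, by simp, by simp [h]⟩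
  choose a ha hag using h1
  have h2 : PowerSeries.mk a ∈ seriesVanishingAt z := by
    refine ⟨⟨fun j => by rw [PowerSeries.coeff_mk]; exact ha j, ?_⟩, ?_⟩
    · rw [PowerSeries.coeff_mk]
      have := hag 0
      rw [hg0] at this
      exact_mod_cast this
    · have := hasSum_ser (fun j => abs_le_one_of_mem (hg j)) hz
      rw [hgz] at this
      convert this using 2 with j
      rw [PowerSeries.coeff_mk, ← hag]
      simp
  rw [hf, Set.mem_singleton_iff] at h2
  funext j
  rw [← hag, ← h2, coeffSeq, PowerSeries.coeff_mk]

end TwoMapIFS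

end

/-! ### Perturbation of the parameter and the first-difference argument -/

section

open Finset Filter Topology

namespace TwoMapIFS

lemma norm_pow_sub_pow_le_of_norm_le {z w : ℂ} (hz : ‖z‖ ≤ 4 / 5) (hw : ‖w‖ ≤ 4 / 5) (j : ℕ) :
    ‖w ^ j - z ^ j‖ ≤ 5 / 4 * ‖w - z‖ * (j * (4 / 5) ^ j) := by
  induction j with
  | zero => simp
  | succ j ih =>
    have e : w ^ (j + 1) - z ^ (j + 1) = w * (w ^ j - z ^ j) + (w - z) * z ^ j := by ring
    rw [e]
    refine (norm_add_le _ _).trans ?_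
    rw [norm_mul, norm_mul, norm_pow]
    have h1 := mul_le_mul hw ih (norm_nonneg _) (by norm_num)
    have h2 := mul_le_mul_of_nonneg_left (pow_le_pow_left₀ (norm_nonneg z) hz j) (norm_nonneg (w - z))
    rw [pow_succ]
    push_cast
    linarith

/-- The constant is `25 = (5/4) ∑ j (4/5)^j`. -/
lemma norm_ser_sub_ser_le {b : ℕ → ℝ} {M : ℝ} (hb : ∀ j, |b j| ≤ M) {z w : ℂ} (hz : ‖z‖ ≤ 4 / 5)
    (hw : ‖w‖ ≤ 4 / 5) : ‖ser b w - ser b z‖ ≤ 25 * M * ‖w - z‖ := by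
  have h1 := (hasSum_ser hb (hw.trans_lt (by norm_num))).sub
    (hasSum_ser hb (hz.trans_lt (by norm_num)))
  have h2 := (hasSum_coe_mul_geometric_of_norm_lt_one (𝕜 := ℝ) (r := 4 / 5)
    (by rw [Real.norm_of_nonneg] <;> norm_num)).mul_left (M * (5 / 4 * ‖w - z‖))
  rw [← h1.tsum_eq]
  refine (tsum_of_norm_bounded h2 fun j => ?_).trans (le_of_eq (by ring))
  rw [← mul_sub, norm_mul, Complex.norm_real, Real.norm_eq_abs, mul_assoc]
  exact mul_le_mul (hb j) (norm_pow_sub_pow_le_of_norm_le hz hw j) (norm_nonneg _)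
    ((abs_nonneg _).trans (hb j))

lemma norm_one_add_pow_sub_one_le (x : ℂ) (q : ℕ) : ‖(1 + x) ^ q - 1‖ ≤ (1 + ‖x‖) ^ q - 1 := by
  induction q with
  | zero => simp
  | succ q ih =>
    have e : (1 + x) ^ (q + 1) - 1 = (1 + x) * ((1 + x) ^ q - 1) + x := by ring
    rw [e]
    refine (norm_add_le _ _).trans ?_
    rw [norm_mul]
    have h1 : ‖1 + x‖ ≤ 1 + ‖x‖ := (norm_add_le _ _).trans (by simp)
    have h2 := mul_le_mul h1 ih (norm_nonneg _) (by positivity)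
    rw [pow_succ]
    linarith

lemma norm_one_add_pow_sub_one_le_mul {x : ℂ} {q : ℕ} (h : q * ‖x‖ ≤ 1) :
    ‖(1 + x) ^ q - 1‖ ≤ 2 * (q * ‖x‖) := by
  have h0 : 0 ≤ q * ‖x‖ := by positivity
  have h1 : (1 + ‖x‖) ^ q ≤ Real.exp (q * ‖x‖) := by
    rw [Real.exp_nat_mul]
    refine pow_le_pow_left₀ (by positivity) ?_ q
    have := Real.add_one_le_exp ‖x‖
    linarith
  have h2 := (le_abs_self _).trans (Real.abs_exp_sub_one_le (x := q * ‖x‖) (by rwa [abs_of_nonneg h0]))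
  rw [abs_of_nonneg h0] at h2
  linarith [norm_one_add_pow_sub_one_le x q]

/-- Perturbation of a power series with leading factor `z ^ q`, relative to `z ^ q`. -/
lemma norm_perturb_le {b : ℕ → ℝ} (hb : ∀ j, |b j| ≤ 2) {z w : ℂ} (hz : ‖z‖ ≤ 4 / 5)
    (hz' : 1 / 2 ≤ ‖z‖) (hw : ‖w‖ ≤ 4 / 5) {q : ℕ} (hq : 2 * q * ‖w - z‖ ≤ 1) :
    ‖ser b z - (w / z) ^ q * ser b w‖ ≤ 50 * (q + 1) * ‖w - z‖ := by
  have hz0 : z ≠ 0 := by rintro rfl; norm_num at hz'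
  have e1 : w / z = 1 + (w - z) / z := by field_simp; ring
  have h1 : ‖(w - z) / z‖ ≤ 2 * ‖w - z‖ := by
    rw [norm_div, div_le_iff₀ (by linarith)]
    nlinarith [norm_nonneg (w - z)]
  have hq' : q * ‖(w - z) / z‖ ≤ 2 * q * ‖w - z‖ := by
    have := mul_le_mul_of_nonneg_left h1 (Nat.cast_nonneg (α := ℝ) q)
    linarith
  have h2 := norm_one_add_pow_sub_one_le_mul (hq'.trans hq)
  rw [← e1] at h2
  have h3 : ‖ser b w‖ ≤ 10 := by
    refine (norm_ser_le hb (hw.trans_lt (by norm_num))).trans ?_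
    rw [div_le_iff₀ (by linarith)]
    linarith
  have h4 := norm_ser_sub_ser_le hb hz hw
  have e2 : ser b z - (w / z) ^ q * ser b w =
      -(((w / z) ^ q - 1) * ser b w + (ser b w - ser b z)) := by ring
  rw [e2, norm_neg]
  refine (norm_add_le _ _).trans ?_
  rw [norm_mul]
  -- The factor `(w/z)^q` contributes `40 q ‖w - z‖` and the series `50 ‖w - z‖`.
  have h5 := mul_le_mul h2 h3 (norm_nonneg _) (by positivity)
  have h6 : 0 ≤ (q : ℝ) * ‖w - z‖ := by positivity
  linarith

/-- A quantitative form of the two separation properties. -/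
def Separated (z : ℂ) (κ : ℝ) (c : ℕ → ℝ) : Prop :=
  ∀ d : ℕ → ℝ, (∀ j, 0 ≤ d j ∧ d j ≤ 2) → ∀ n : ℕ, 1 ≤ d 0 ∨ d 0 = 0 ∧ n = 0 →
    ∀ s : ℝ, 0 ≤ s → s ≤ 1 → κ ≤ ‖5 * ser (fun j => d j * c j) z +
      2 * ((1 - s) * (z ^ n * ser (shift n c) z) + s * (z ^ (n + 1) * ser (shift (n + 1) c) z))‖

lemma ser_weight {z : ℂ} (hz : ‖z‖ < 1) {c d : ℕ → ℝ} (hc : ∀ j, |c j| ≤ 1)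
    (hd : ∀ j, 0 ≤ d j ∧ d j ≤ 2) (n : ℕ) :
    ser (fun j => (5 * d j + if n ≤ j then 2 else 0) * c j) z =
      5 * ser (fun j => d j * c j) z + 2 * (z ^ n * ser (shift n c) z) := by
  have h1 : ∀ j, |d j * c j| ≤ 2 := fun j => by
    rw [abs_mul, abs_of_nonneg (hd j).1]
    nlinarith [hd j, hc j, abs_nonneg (c j)]
  have h2 : ∀ j, |(if n ≤ j then 1 else 0) * c j| ≤ 1 := fun j => by
    split_ifs
    · simpa using hc j
    · simp
  have h3 : ser (fun j => (if n ≤ j then 1 else 0) * c j) z = z ^ n * ser (shift n c) z := by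
    rw [ser_eq_sum_add h2 hz n, sum_eq_zero, zero_add]
    · congr 2
      funext j
      simp [shift]
    · intro j hj
      rw [if_neg (by have := mem_range.1 hj; omega)]
      simp
  rw [← h3, ← (((hasSum_ser h1 hz).mul_left 5).add ((hasSum_ser h2 hz).mul_left 2)).tsum_eq, ser]
  refine tsum_congr fun j => ?_
  split_ifs <;> push_cast <;> ring

/-- One functional is bounded below at both ends `n` and `n + 1` of an edge, hence along the edge; a
lower bound on a functional gives one on the norm. -/
lemma exists_separated {z : ℂ} (hz : ‖z‖ < 1) {c : ℕ → ℝ} (hc : ∀ j, |c j| ≤ 1)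
    (hA : SeparatesTails z c) (hB : SeparatesEdge z c) : ∃ κ, 0 < κ ∧ Separated z κ c := by
  obtain ⟨e, η, h0, hA⟩ := hA
  obtain ⟨e', η', h0', hB⟩ := hB
  have key : ∀ (e X Y : ℂ) (s η : ℝ), 0 < η → 0 ≤ s → s ≤ 1 → η ≤ ip e X → η ≤ ip e Y →
      η / (‖e‖ + 1) ≤ ‖(1 - s) * X + s * Y‖ := by
    intro e X Y s η h0 hs hs' h1 h2
    have h3 : ip e ((1 - s) * X + s * Y) = (1 - s) * ip e X + s * ip e Y := by
      rw [ip_add, ip_smul, ← ip_smul e X]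
      push_cast
      rfl
    have h4 := (le_abs_self _).trans (abs_ip_le e ((1 - s) * X + s * Y))
    rw [h3] at h4
    have h5 := mul_le_mul_of_nonneg_left h1 (by linarith : 0 ≤ 1 - s)
    have h6 := mul_le_mul_of_nonneg_left h2 hs
    rw [div_le_iff₀ (by positivity)]
    linarith [norm_nonneg ((1 - s) * X + s * Y)]
  have split : ∀ (d : ℕ → ℝ), (∀ j, 0 ≤ d j ∧ d j ≤ 2) → ∀ (n : ℕ) (s : ℝ),
      5 * ser (fun j => d j * c j) z + 2 * ((1 - s) * (z ^ n * ser (shift n c) z) +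
        s * (z ^ (n + 1) * ser (shift (n + 1) c) z)) =
      (1 - s) * ser (fun j => (5 * d j + if n ≤ j then 2 else 0) * c j) z +
        s * ser (fun j => (5 * d j + if n + 1 ≤ j then 2 else 0) * c j) z := by
    intro d hd n s
    rw [ser_weight hz hc hd, ser_weight hz hc hd]
    ring
  refine ⟨min (η / (‖e‖ + 1)) (η' / (‖e'‖ + 1)), by positivity, fun d hd n hn s hs hs' => ?_⟩
  rw [split d hd]
  rcases hn with hn | ⟨hn, rfl⟩
  · exact (min_le_left _ _).trans (key e _ _ s η h0 hs hs' (hA d hd hn n) (hA d hd hn (n + 1)))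
  · exact (min_le_right _ _).trans (key e' _ _ s η' h0' hs hs' (hB d hd hn 0 zero_le_one)
      (hB d hd hn 1 le_rfl))

lemma Separated.mono {z : ℂ} {κ κ' : ℝ} {c : ℕ → ℝ} (h : Separated z κ c) (hκ : κ' ≤ κ) :
    Separated z κ' c := fun d hd n hn s hs hs' => hκ.trans (h d hd n hn s hs hs')

/-- Near `z`, no series that agrees with `c` to a fixed order vanishes where `c` takes a value on
the polygon with vertices `-2/5` times the tails of `c` at `z`. -/
lemma not_vanishing {z w : ℂ} (hz : ‖z‖ ≤ 4 / 5) (hz' : 1 / 2 ≤ ‖z‖) (hw : ‖w‖ ≤ 4 / 5) {c : ℕ → ℝ}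
    (hc : ∀ j, |c j| ≤ 1) {N : ℕ} (hN : ∀ j, N ≤ j → c j = 1 ∨ c j = -1) {κ : ℝ}
    (hκ : ∀ q, N ≤ q → Separated z κ (shift q c)) {m : ℕ} (hm : N ≤ m) {s : ℝ} (hs : 0 ≤ s)
    (hs' : s ≤ 1) (hval : ser c w = -(2 / 5) * ((1 - s) * (z ^ m * ser (shift m c) z) +
      s * (z ^ (m + 1) * ser (shift (m + 1) c) z)))
    (h1 : 2 * m * ‖w - z‖ ≤ 1) (h2 : 250 * (m + 1) * ‖w - z‖ < κ) {g : ℕ → ℝ}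
    (hg : ∀ j, g j ∈ ({-1, 0, 1} : Set ℝ)) (hgc : ∀ j < N, g j = c j) : ser g w ≠ 0 := by
  intro hgw
  have hz0 : z ≠ 0 := by rintro rfl; norm_num at hz'
  have hw1 : ‖w‖ < 1 := hw.trans_lt (by norm_num)
  have hz1 : ‖z‖ < 1 := hz.trans_lt (by norm_num)
  -- `q` is the first index where `g` and `c` differ, giving leading digit at least `1`. If they
  -- agree through `m`, then `q = m`, with leading digit `0`.
  suffices H : ∀ q, N ≤ q → q ≤ m → (∀ j < q, g j = c j) →
      1 ≤ (c q - g q) * c q ∨ (c q - g q) * c q = 0 ∧ m - q = 0 → False by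
    have hd : ∀ k, N ≤ k → g k ≠ c k → 1 ≤ (c k - g k) * c k := by
      intro k hk hne
      have h3 := hg k
      simp only [Set.mem_insert_iff, Set.mem_singleton_iff] at h3
      rcases hN k hk with h4 | h4 <;> rcases h3 with h3 | h3 | h3 <;> rw [h3, h4] at hne ⊢ <;>
        first | norm_num; done | exact absurd rfl hne
    by_cases hex : ∃ k, g k ≠ c k ∧ k ≤ m
    · classical
      obtain ⟨h3, h4⟩ := Nat.find_spec hex
      have h5 : ∀ j < Nat.find hex, g j = c j := fun j hj => by
        by_contra hne
        exact Nat.find_min hex hj ⟨hne, hj.le.trans h4⟩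
      have h6 : N ≤ Nat.find hex := by
        by_contra hcon
        exact h3 (hgc _ (by omega))
      exact H _ h6 h4 h5 (Or.inl (hd _ h6 h3))
    · push Not at hex
      have h3 : ∀ j ≤ m, g j = c j := fun j hj => by
        by_contra hne
        exact absurd hj (not_le.2 (hex j hne))
      exact H m hm le_rfl (fun j hj => h3 j hj.le) (Or.inr ⟨by rw [h3 m le_rfl]; ring, by omega⟩)
  intro q hq hqm hagree hlead
  set d : ℕ → ℝ := fun j => (c (q + j) - g (q + j)) * c (q + j) with hd
  have hgabs : ∀ j, |g j| ≤ 1 := fun j => abs_le_one_of_mem (hg j)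
  have hd2 : ∀ j, 0 ≤ d j ∧ d j ≤ 2 := by
    intro j
    have h3 := abs_le.1 (hgabs (q + j))
    simp only [hd]
    rcases hN (q + j) (by omega) with h4 | h4 <;> rw [h4] <;> constructor <;> linarith
  have hdc : (fun j => d j * shift q c j) = fun j => c (q + j) - g (q + j) := by
    funext j
    simp only [hd, shift]
    rcases hN (q + j) (by omega) with h4 | h4 <;> rw [h4] <;> ring
  have hdiff : ser c w = w ^ q * ser (fun j => d j * shift q c j) w := by
    have h3 := ser_eq_sum_add hc hw1 q
    have h4 := ser_eq_sum_add hgabs hw1 q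
    rw [hgw] at h4
    have h5 : ∑ j ∈ range q, (g j : ℂ) * w ^ j = ∑ j ∈ range q, (c j : ℂ) * w ^ j :=
      sum_congr rfl fun j hj => by rw [hagree j (mem_range.1 hj)]
    rw [h5] at h4
    have h6 := ((hasSum_ser (c := shift q c) (fun j => hc (q + j)) hw1).sub
      (hasSum_ser (c := shift q g) (fun j => hgabs (q + j)) hw1)).tsum_eq
    have h7 : ser (fun j => d j * shift q c j) w = ser (shift q c) w - ser (shift q g) w := by
      rw [hdc, ← h6, ser]
      refine tsum_congr fun j => ?_
      simp only [shift]
      push_cast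
      ring
    rw [h7]
    linear_combination h3 - h4
  have hsep := hκ q hq d hd2 (m - q) (by simpa [hd] using hlead) s hs hs'
  rw [shift_shift, shift_shift, show q + (m - q) = m by omega,
    show q + (m - q + 1) = m + 1 by omega] at hsep
  have hpow : z ^ m = z ^ q * z ^ (m - q) := by rw [← pow_add]; congr 1; omega
  -- The prescribed value equals `w^q` times the digit series at `w`. Dividing by `z^q` puts the
  -- separation bound on the difference between that series at `z` and its perturbation.
  have e1 : 2 * ((1 - s) * (z ^ (m - q) * ser (shift m c) z) +
      s * (z ^ (m - q + 1) * ser (shift (m + 1) c) z)) =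
      -5 * ((w / z) ^ q * ser (fun j => d j * shift q c j) w) := by
    rw [div_pow, div_mul_eq_mul_div, ← hdiff, hval, pow_succ z m, hpow, pow_succ]
    field_simp
  rw [e1, show 5 * ser (fun j => d j * shift q c j) z +
    -5 * ((w / z) ^ q * ser (fun j => d j * shift q c j) w) =
    5 * (ser (fun j => d j * shift q c j) z - (w / z) ^ q * ser (fun j => d j * shift q c j) w) by
      ring, norm_mul] at hsep
  have hq' : (q : ℝ) ≤ m := by exact_mod_cast hqm
  have h3 := norm_perturb_le (b := fun j => d j * shift q c j) (fun j => by
    rw [congrFun hdc j]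
    exact (abs_sub _ _).trans (by linarith [hc (q + j), hgabs (q + j)])) hz hz' hw (q := q)
    ((by gcongr : 2 * (q : ℝ) * ‖w - z‖ ≤ 2 * m * ‖w - z‖).trans h1)
  have h4 : 50 * ((q : ℝ) + 1) * ‖w - z‖ ≤ 50 * (m + 1) * ‖w - z‖ := by gcongr
  simp only [RCLike.norm_ofNat] at hsep
  linarith

end TwoMapIFS

end

/-! ### Local coordinates and continuous roots -/

section

open Finset Filter Topology

namespace TwoMapIFS

/-- A holomorphic function with a zero is a power of a local coordinate near it. -/
lemma exists_local_root {f : ℂ → ℂ} {z₀ : ℂ} (hf : AnalyticAt ℂ f z₀) (h0 : f z₀ = 0)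
    (hne : ¬ ∀ᶠ z in 𝓝 z₀, f z = 0) : ∃ (M : ℕ) (ψ : ℂ → ℂ) (ε C : ℝ), M ≠ 0 ∧ 0 < ε ∧ 0 < C ∧
      ContinuousOn ψ (Metric.ball 0 ε) ∧
      ∀ ξ ∈ Metric.ball (0 : ℂ) ε, f (ψ ξ) = ξ ^ M ∧ ‖ψ ξ - z₀‖ ≤ C * ‖ξ‖ := by
  obtain ⟨M, g, hg, hg0, hfg⟩ := hf.exists_eventuallyEq_pow_smul_nonzero_iff.2 hne
  have hM : M ≠ 0 := by
    rintro rfl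
    have := hfg.self_of_nhds
    rw [h0] at this
    simp at this
    exact hg0 this.symm
  set a : ℂ := g z₀ ^ ((M : ℂ)⁻¹) with ha
  have haM : a ^ M = g z₀ := Complex.cpow_nat_inv_pow _ hM
  have ha0 : a ≠ 0 := by
    intro h
    rw [h, zero_pow hM] at haM
    exact hg0 haM.symm
  -- An analytic `M`-th root of `g`: dividing by `g z₀` keeps the base near `1`, off the branch cut.
  -- Then `(z - z₀) k z` is the local coordinate.
  set k : ℂ → ℂ := fun z => a * (g z / g z₀) ^ ((M : ℂ)⁻¹) with hk
  have hk_an : AnalyticAt ℂ k z₀ := by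
    refine analyticAt_const.mul ((hg.div analyticAt_const hg0).cpow analyticAt_const ?_)
    simp only [Pi.div_apply]
    rw [div_self hg0]
    exact Complex.one_mem_slitPlane
  have hkz : k z₀ = a := by simp only [hk]; rw [div_self hg0, Complex.one_cpow, mul_one]
  have hkM : ∀ z, k z ^ M = g z := by
    intro z
    simp only [hk]
    rw [mul_pow, haM, Complex.cpow_nat_inv_pow _ hM, mul_div_cancel₀ _ hg0]
  set φ : ℂ → ℂ := fun z => (z - z₀) * k z with hφ
  have hderiv : HasStrictDerivAt φ a z₀ := by
    have h1 : HasStrictDerivAt (fun z => z - z₀) 1 z₀ := (hasStrictDerivAt_id z₀).sub_const z₀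
    have h2 := h1.mul hk_an.hasStrictDerivAt
    simp only [sub_self, zero_mul, add_zero, one_mul, hkz] at h2
    exact h2
  have hF := hderiv.hasStrictFDerivAt_equiv ha0
  set e := hF.toOpenPartialHomeomorph φ
  have hsrc : z₀ ∈ e.source := hF.mem_toOpenPartialHomeomorph_source
  have hφ0 : φ z₀ = 0 := by simp [hφ]
  have htgt : (0 : ℂ) ∈ e.target := by
    have := e.map_source hsrc
    rwa [show e z₀ = 0 from hφ0] at this
  have hsymm0 : e.symm 0 = z₀ := by
    rw [← e.left_inv hsrc]
    exact congrArg _ hφ0.symm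
  have hcont : ContinuousAt e.symm 0 := e.continuousAt_symm htgt
  have hk_near : ∀ᶠ z in 𝓝 z₀, ‖a‖ / 2 < ‖k z‖ := by
    refine hk_an.continuousAt.norm.eventually_const_lt ?_
    simp only [hkz]
    have := norm_pos_iff.2 ha0
    linarith
  have hev : ∀ᶠ ξ in 𝓝 (0 : ℂ), ξ ∈ e.target ∧ f (e.symm ξ) = (e.symm ξ - z₀) ^ M • g (e.symm ξ) ∧
      ‖a‖ / 2 < ‖k (e.symm ξ)‖ := by
    have h1 : Tendsto e.symm (𝓝 0) (𝓝 z₀) := by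
      have := hcont.tendsto
      rwa [hsymm0] at this
    have h2 : ∀ᶠ ξ in 𝓝 (0 : ℂ), ξ ∈ e.target := e.open_target.mem_nhds htgt
    exact h2.and ((h1.eventually hfg).and (h1.eventually hk_near))
  obtain ⟨ε, hε, hball⟩ := Metric.eventually_nhds_iff_ball.1 hev
  refine ⟨M, e.symm, ε, 2 / ‖a‖, hM, hε, div_pos two_pos (norm_pos_iff.2 ha0),
    e.continuousOn_symm.mono fun ξ hξ => (hball ξ hξ).1, fun ξ hξ => ?_⟩
  obtain ⟨h1, h2, h3⟩ := hball ξ hξ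
  have h4 : (e.symm ξ - z₀) * k (e.symm ξ) = ξ := e.right_inv h1
  constructor
  · rw [h2, smul_eq_mul, ← hkM, ← mul_pow, h4]
  · have h5 := congrArg norm h4
    rw [norm_mul] at h5
    rw [div_mul_eq_mul_div, le_div_iff₀ (norm_pos_iff.2 ha0), ← h5]
    nlinarith [norm_nonneg (e.symm ξ - z₀)]

/-- The projection of the real line to the unit interval. -/
noncomputable def clamp (x : ℝ) : ℝ := max 0 (min 1 x)

lemma clamp_of_le {x : ℝ} (h : x ≤ 0) : clamp x = 0 := by
  rw [clamp, min_eq_right (h.trans zero_le_one), max_eq_left h]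

lemma clamp_of_ge {x : ℝ} (h : 1 ≤ x) : clamp x = 1 := by
  rw [clamp, min_eq_left h, max_eq_right zero_le_one]

lemma clamp_of_mem {x : ℝ} (h0 : 0 ≤ x) (h1 : x ≤ 1) : clamp x = x := by
  rw [clamp, min_eq_right h1, max_eq_right h0]

lemma one_add_clamp_mem {q : ℂ} (hq : q ∈ Complex.slitPlane) (x : ℝ) :
    1 + clamp x * (q - 1) ∈ Complex.slitPlane := by
  have h1 : 0 ≤ clamp x := le_max_left _ _
  have h2 : clamp x ≤ 1 := max_le zero_le_one (min_le_left _ _)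
  rw [Complex.mem_slitPlane_iff] at hq ⊢
  have hre : (1 + (clamp x : ℂ) * (q - 1)).re = 1 + clamp x * (q.re - 1) := by simp
  have him : (1 + (clamp x : ℂ) * (q - 1)).im = clamp x * q.im := by simp
  rw [hre, him]
  rcases h1.eq_or_lt with h | h
  · left; rw [← h]; norm_num
  · rcases hq with hq | hq
    · left; nlinarith
    · exact Or.inr (mul_ne_zero h.ne' hq)

/-- Continuous `M`-th roots along a polygonal line whose consecutive vertices have ratios off the
negative real axis. -/
lemma exists_root_along_polygon {w : ℕ → ℂ} (h0 : ∀ n, w n ≠ 0)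
    (hw : ∀ n, w (n + 1) / w n ∈ Complex.slitPlane) {M : ℕ} (hM : M ≠ 0) :
    ∃ F : ℝ → ℂ, Continuous F ∧ ∀ (n : ℕ) (s : ℝ), 0 ≤ s → s ≤ 1 →
      F (n + s) ^ M = (1 - s) * w n + s * w (n + 1) := by
  -- The `n`-th base moves from `1` to `w (n+1) / w n` while `x` crosses `[n, n+1]`, and this
  -- segment avoids the branch cut, so principal roots are continuous. Later factors are `1`, making
  -- the product locally finite.
  set G : ℕ → ℝ → ℂ := fun N x => w 0 ^ ((M : ℂ)⁻¹) *
    ∏ n ∈ range N, (1 + clamp (x - n) * (w (n + 1) / w n - 1)) ^ ((M : ℂ)⁻¹) with hG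
  have hclamp : Continuous clamp := continuous_const.max (continuous_const.min continuous_id)
  have hGcont : ∀ N, Continuous (G N) := by
    intro N
    refine continuous_const.mul (continuous_finsetProd _ fun n _ => ?_)
    refine Continuous.cpow ?_ continuous_const fun x => one_add_clamp_mem (hw n) _
    have : Continuous fun x : ℝ => clamp (x - n) := hclamp.comp (by fun_prop)
    fun_prop
  have hGeq : ∀ (x : ℝ) (N K : ℕ), x ≤ N → G (N + K) x = G N x := by
    intro x N K hx
    simp only [hG]
    rw [prod_range_add, prod_eq_one (s := range K), mul_one]
    intro n _
    rw [clamp_of_le (by push_cast; linarith [(Nat.cast_nonneg n : (0 : ℝ) ≤ n)])]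
    simp
  have hF : ∀ (x : ℝ) (N : ℕ), x ≤ N → G ⌈x⌉₊ x = G N x := by
    intro x N hx
    obtain ⟨K, hK⟩ := Nat.exists_eq_add_of_le (Nat.ceil_le.2 hx)
    rw [hK, hGeq x _ K (Nat.le_ceil x)]
  refine ⟨fun x => G ⌈x⌉₊ x, ?_, fun n s hs hs' => ?_⟩
  · refine continuous_iff_continuousAt.2 fun x => ?_
    obtain ⟨N, hN⟩ := exists_nat_gt x
    refine (hGcont N).continuousAt.congr ?_
    filter_upwards [Iio_mem_nhds hN] with y hy using (hF y N hy.le).symm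
  · simp only
    rw [hF _ (n + 1) (by push_cast; linarith)]
    simp only [hG]
    rw [mul_pow, Complex.cpow_nat_inv_pow _ hM, ← prod_pow]
    simp only [Complex.cpow_nat_inv_pow _ hM]
    rw [prod_range_succ, add_sub_cancel_left, clamp_of_mem hs hs']
    have h1 : w 0 * ∏ i ∈ range n, (1 + (clamp (n + s - i) : ℂ) * (w (i + 1) / w i - 1)) = w n := by
      have h2 : ∀ i ∈ range n, (1 + (clamp (n + s - i) : ℂ) * (w (i + 1) / w i - 1)) =
          w (i + 1) / w i := by
        intro i hi
        have h3 : (i : ℝ) + 1 ≤ n := by exact_mod_cast mem_range.1 hi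
        rw [clamp_of_ge (by linarith)]
        simp
      rw [prod_congr rfl h2]
      clear h2
      induction n with
      | zero => simp
      | succ n ih =>
        rw [prod_range_succ, ← mul_assoc, ih, mul_div_cancel₀ _ (h0 n)]
    rw [← mul_assoc, h1]
    have := h0 n
    field_simp
    ring

lemma analyticAt_ser {c : ℕ → ℝ} {M : ℝ} (hc : ∀ j, |c j| ≤ M) {z : ℂ} (hz : ‖z‖ < 1) :
    AnalyticAt ℂ (ser c) z := by
  obtain ⟨ρ, hρ, hρ1⟩ := exists_between hz
  have h0 : 0 ≤ ρ := (norm_nonneg z).trans hρ.le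
  have h1 : DifferentiableOn ℂ (fun z => ∑' j, (c j : ℂ) * z ^ j) (Metric.ball 0 ρ) := by
    refine Complex.differentiableOn_tsum_of_summable_norm (u := fun j => M * ρ ^ j)
      ((summable_geometric_of_lt_one h0 hρ1).mul_left M) (fun j => by fun_prop)
      Metric.isOpen_ball fun j w hw => ?_
    rw [norm_mul, norm_pow, Complex.norm_real, Real.norm_eq_abs]
    exact mul_le_mul (hc j) (pow_le_pow_left₀ (norm_nonneg _) (mem_ball_zero_iff.1 hw).le j)
      (by positivity) ((abs_nonneg _).trans (hc j))
  exact h1.analyticAt (Metric.isOpen_ball.mem_nhds (by simpa using hρ))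

lemma not_eventually_ser_eq_zero {c : ℕ → ℝ} {M : ℝ} (hc : ∀ j, |c j| ≤ M) (hc0 : c 0 ≠ 0) {z : ℂ}
    (hz : ‖z‖ < 1) : ¬ ∀ᶠ w in 𝓝 z, ser c w = 0 := by
  intro h
  have h1 : AnalyticOnNhd ℂ (ser c) (Metric.ball 0 1) := fun w hw =>
    analyticAt_ser hc (by simpa using hw)
  have h2 := h1.eqOn_of_preconnected_of_eventuallyEq (g := fun _ => 0) (fun w _ => analyticAt_const)
    (convex_ball 0 1).isPreconnected (by simpa using hz) h
  have h3 := h2 (Metric.mem_ball_self one_pos)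
  have h4 : ser c 0 = c 0 := by
    rw [ser_eq_head_add hc (by simp)]; simp
  rw [h4] at h3
  exact hc0 (by simpa using h3)

end TwoMapIFS

end

/-! ### Construction of the path -/

section

open Finset Filter Topology

namespace TwoMapIFS

/-- The tail of the series `c` at `z` from the index `m` on. -/
noncomputable def tailAt (z : ℂ) (c : ℕ → ℝ) (m : ℕ) : ℂ := z ^ m * ser (shift m c) z

lemma norm_tailAt_le {z : ℂ} (hz : ‖z‖ ≤ 4 / 5) {c : ℕ → ℝ} (hc : ∀ j, |c j| ≤ 1) (m : ℕ) :
    ‖tailAt z c m‖ ≤ 5 * (4 / 5) ^ m := by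
  rw [tailAt, norm_mul, norm_pow, mul_comm]
  refine mul_le_mul ?_ (pow_le_pow_left₀ (norm_nonneg _) hz m) (by positivity) (by norm_num)
  refine (norm_ser_le (c := shift m c) (fun j => hc (m + j)) (hz.trans_lt (by norm_num))).trans ?_
  rw [div_le_iff₀ (by linarith)]
  linarith

/-- Consecutive tails of an admissible sequence are nonzero and their ratio stays off the negative
real axis. -/
lemma Admissible.tail_ratio {z : ℂ} {c : ℕ → ℝ} (h : Admissible z c) (hz : ‖z‖ < 1)
    (hz' : 1 / 2 ≤ ‖z‖) : ser c z ≠ 0 ∧ z * ser (shift 1 c) z / ser c z ∈ Complex.slitPlane := by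
  obtain ⟨h1, h2⟩ := h.2 0
  rw [shift_zero] at h1 h2
  have h3 := ser_eq_head_add h.abs_le hz
  set u := ser c z
  have hu : u ≠ 0 := by
    rintro h0
    rw [h0] at h2
    norm_num at h2
  refine ⟨hu, ?_⟩
  have h4 : 2 ≤ 1 / (1 - ‖z‖) := by
    rw [le_div_iff₀ (by linarith)]; linarith
  rw [zero_add, ← norm_mul] at h1
  by_contra hcon
  rw [Complex.mem_slitPlane_iff] at hcon
  push Not at hcon
  set q := z * ser (shift 1 c) z / u with hq
  have hq1 : z * ser (shift 1 c) z = q * u := by rw [hq, div_mul_cancel₀ _ hu]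
  have hqr : q = (q.re : ℂ) := by
    apply Complex.ext
    · simp
    · simpa using hcon.2
  have h5 : u * (1 - q) = c 0 := by linear_combination h3 + hq1
  -- For a nonpositive ratio, `u` and `z u_1` point in opposite directions, so their moduli add up
  -- to `|u - z u_1| = |c 0| = 1`, below the admissible `1/(1-|z|) ≥ 2`.
  have h6 : ‖u‖ * (1 - q.re) = 1 := by
    have h7 := congrArg norm h5
    rw [norm_mul, hqr, ← Complex.ofReal_one, ← Complex.ofReal_sub, Complex.norm_real,
      Complex.norm_real, Real.norm_of_nonneg (by linarith [hcon.1])] at h7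
    rw [h7]
    rcases h.1 0 with h8 | h8 <;> simp [h8]
  have h7 : ‖z * ser (shift 1 c) z‖ = -q.re * ‖u‖ := by
    rw [hq1, norm_mul, hqr, Complex.norm_real, Real.norm_of_nonpos hcon.1, Complex.ofReal_re]
  rw [h7] at h1
  linarith

/-- `θ` is the decay rate of the local coordinate `ξ` when `ξ ^ M` decays like `(4/5)^m`. -/
lemma exists_geometric_root (M : ℕ) (hM : M ≠ 0) : ∃ θ : ℝ, 0 < θ ∧ θ < 1 ∧ θ ^ M = 4 / 5 := by
  refine ⟨(4 / 5 : ℝ) ^ ((M : ℝ)⁻¹), by positivity, ?_, ?_⟩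
  · exact Real.rpow_lt_one (by norm_num) (by norm_num) (by positivity)
  · exact Real.rpow_inv_natCast_pow (by norm_num) hM

lemma norm_le_of_norm_pow_le {ξ : ℂ} {M m : ℕ} (hM : M ≠ 0) {θ : ℝ} (hθ : 0 < θ)
    (hθM : θ ^ M = 4 / 5) (h : ‖ξ ^ M‖ ≤ 2 * (4 / 5) ^ m) : ‖ξ‖ ≤ 2 * θ ^ m := by
  refine le_of_pow_le_pow_left₀ hM (by positivity) ?_
  rw [← norm_pow, mul_pow, ← pow_mul, mul_comm m M, pow_mul, hθM]
  refine h.trans ?_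
  gcongr
  exact le_self_pow₀ one_le_two hM

lemma exists_forall_mul_geometric_lt {θ τ : ℝ} (h0 : 0 < θ) (h1 : θ < 1) (hτ : 0 < τ) (N : ℕ) :
    ∃ m₁, N ≤ m₁ ∧ ∀ m, m₁ ≤ m → (m + 1) * (2 * θ ^ m) < τ := by
  have h2 := (tendsto_self_mul_const_pow_of_lt_one h0.le h1).add
    (tendsto_pow_atTop_nhds_zero_of_lt_one h0.le h1)
  have h3 := (h2.const_mul 2).eventually_lt_const (u := τ) (by simpa using hτ)
  obtain ⟨m₁, hm₁⟩ := (h3.and (eventually_ge_atTop N)).exists_forall_of_atTop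
  exact ⟨m₁, (hm₁ m₁ le_rfl).2, fun m hm => lt_of_eq_of_lt (by ring) (hm₁ m hm).1⟩

/-- A point at which the tails of a series are separated can be approached along a path that avoids
every set whose points near it are zeros of series agreeing with the given one to a fixed order. -/
theorem exists_path {z : ℂ} (hz : ‖z‖ < 4 / 5) (hz' : 1 / 2 ≤ ‖z‖) {c : ℕ → ℝ}
    (hc : ∀ j, |c j| ≤ 1) (hc0 : c 0 ≠ 0) (hcz : ser c z = 0) {N : ℕ}
    (hadm : Admissible z (shift N c)) {κ : ℝ} (hκ0 : 0 < κ)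
    (hκ : ∀ q, N ≤ q → Separated z κ (shift q c)) {S : Set ℂ}
    (hS : ∀ᶠ w in 𝓝 z, w ∈ S → ∃ g : ℕ → ℝ, (∀ j, g j ∈ ({-1, 0, 1} : Set ℝ)) ∧ ser g w = 0 ∧
      ∀ j < N, g j = c j) :
    ∃ γ : ℝ → ℂ, ContinuousOn γ (Set.Icc 0 1) ∧ γ 1 = z ∧
      ∀ t, 0 ≤ t → t < 1 → γ t ∈ Metric.ball (0 : ℂ) 1 \ S := by
  have hz1 : ‖z‖ < 1 := hz.trans (by norm_num)
  have hz0 : z ≠ 0 := by rintro rfl; norm_num at hz'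
  obtain ⟨M, ψ, ε, C, hM, hε, hC, hψc, hψ⟩ := exists_local_root (analyticAt_ser hc hz1) hcz
    (not_eventually_ser_eq_zero hc hc0 hz1)
  obtain ⟨θ, hθ0, hθ1, hθM⟩ := exists_geometric_root M hM
  have hz_near : ∀ᶠ w in 𝓝 z, ‖w‖ < 4 / 5 := continuous_norm.continuousAt.eventually_lt_const hz
  obtain ⟨δ, hδ, hnear⟩ := Metric.eventually_nhds_iff.1 (hS.and hz_near)
  -- The bounds keep `ξ` in the domain of `ψ`, keep `ψ ξ` in the neighbourhood given by `hS`, and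
  -- supply the two smallness conditions of `not_vanishing`. The latter are weighted by `m` and `m +
  -- 1`, which the geometric decay absorbs.
  obtain ⟨m₁, hm₁N, hm₁⟩ := exists_forall_mul_geometric_lt (τ := min ε (min (δ / C)
    (min (1 / (2 * C)) (κ / (250 * C))))) hθ0 hθ1 (by positivity) N
  have hratio : ∀ n, tailAt z c (m₁ + n) ≠ 0 ∧
      tailAt z c (m₁ + n + 1) / tailAt z c (m₁ + n) ∈ Complex.slitPlane := by
    intro n
    have h1 := (hadm.tail (m₁ + n - N)).tail_ratio hz1 hz'
    rw [shift_shift, shift_shift, show N + (m₁ + n - N) = m₁ + n by omega] at h1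
    have h2 : z ^ (m₁ + n) ≠ 0 := pow_ne_zero _ hz0
    refine ⟨mul_ne_zero h2 h1.1, ?_⟩
    have h3 := h1.2
    rw [tailAt, tailAt, pow_succ, mul_assoc, mul_div_mul_left _ _ h2]
    exact h3
  obtain ⟨F, hFc, hF⟩ := exists_root_along_polygon (w := fun n => -(2 / 5) * tailAt z c (m₁ + n))
    (fun n => mul_ne_zero (by norm_num) (hratio n).1) (fun n => by
      rw [mul_div_mul_left _ _ (by norm_num)]
      exact (hratio n).2) hM
  have hFbound : ∀ (n : ℕ) (s : ℝ), 0 ≤ s → s ≤ 1 → ‖F (n + s)‖ ≤ 2 * θ ^ (m₁ + n) := by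
    intro n s hs hs'
    refine norm_le_of_norm_pow_le hM hθ0 hθM ?_
    rw [hF n s hs hs']
    have h1 := norm_tailAt_le hz.le hc (m₁ + n)
    have h2 := norm_tailAt_le hz.le hc (m₁ + (n + 1))
    rw [← add_assoc, pow_succ] at h2
    have h3 : (0 : ℝ) < (4 / 5) ^ (m₁ + n) := by positivity
    have e1 : ‖(1 - s : ℂ)‖ = 1 - s := by
      rw [← Complex.ofReal_one, ← Complex.ofReal_sub, Complex.norm_real, Real.norm_of_nonneg]
      linarith
    have e2 : ‖(s : ℂ)‖ = s := by rw [Complex.norm_real, Real.norm_of_nonneg hs]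
    have e3 : ‖(-(2 / 5) : ℂ)‖ = 2 / 5 := by norm_num
    refine (norm_add_le _ _).trans ?_
    rw [norm_mul, norm_mul, norm_mul, norm_mul, e1, e2, e3]
    have h4 := mul_le_mul_of_nonneg_left h1 (by linarith : 0 ≤ 1 - s)
    have h5 := mul_le_mul_of_nonneg_left h2 hs
    have h6 : 0 ≤ s * (4 / 5) ^ (m₁ + n) := by positivity
    rw [← add_assoc]
    linarith
  have hdecomp : ∀ x : ℝ, 0 ≤ x → ∃ (n : ℕ) (s : ℝ), 0 ≤ s ∧ s ≤ 1 ∧ x = n + s ∧ n = ⌊x⌋₊ :=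
    fun x hx => ⟨⌊x⌋₊, x - ⌊x⌋₊, by linarith [Nat.floor_le hx], by linarith [Nat.lt_floor_add_one x],
      by ring, rfl⟩
  have hsmall : ∀ n : ℕ, (m₁ + n + 1 : ℝ) * (2 * θ ^ (m₁ + n)) < min ε (min (δ / C)
      (min (1 / (2 * C)) (κ / (250 * C)))) := by
    intro n
    have := hm₁ (m₁ + n) (by omega)
    push_cast at this
    exact this
  have hle : ∀ n : ℕ, 2 * θ ^ (m₁ + n) ≤ (m₁ + n + 1 : ℝ) * (2 * θ ^ (m₁ + n)) := by
    intro n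
    have h1 : (1 : ℝ) ≤ m₁ + n + 1 := by
      have h2 : (0 : ℝ) ≤ m₁ := Nat.cast_nonneg _
      have h3 : (0 : ℝ) ≤ n := Nat.cast_nonneg _
      linarith
    exact le_mul_of_one_le_left (by positivity) h1
  have hFball : ∀ x : ℝ, 0 ≤ x → F x ∈ Metric.ball (0 : ℂ) ε := by
    intro x hx
    obtain ⟨n, s, hs, hs', rfl, -⟩ := hdecomp x hx
    rw [mem_ball_zero_iff]
    exact (hFbound n s hs hs').trans_lt ((hle n).trans_lt ((hsmall n).trans_le (min_le_left _ _)))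
  have hdist : ∀ (n : ℕ) (s : ℝ), 0 ≤ s → s ≤ 1 → ‖ψ (F (n + s)) - z‖ ≤ C * (2 * θ ^ (m₁ + n)) := by
    intro n s hs hs'
    refine ((hψ _ (hFball _ (by positivity))).2).trans ?_
    exact mul_le_mul_of_nonneg_left (hFbound n s hs hs') hC.le
  have havoid : ∀ x : ℝ, 0 ≤ x → ψ (F x) ∈ Metric.ball (0 : ℂ) 1 \ S := by
    intro x hx
    have hval := (hψ _ (hFball x hx)).1
    obtain ⟨n, s, hs, hs', rfl, -⟩ := hdecomp x hx
    have h1 := hdist n s hs hs'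
    obtain ⟨-, h2⟩ := lt_min_iff.1 (hsmall n)
    obtain ⟨h3, h2⟩ := lt_min_iff.1 h2
    obtain ⟨h4, h5⟩ := lt_min_iff.1 h2
    rw [lt_div_iff₀ (by positivity)] at h3 h4 h5
    have h6 := mul_le_mul_of_nonneg_right (hle n) hC.le
    have h7 : (m₁ + n + 1 : ℝ) * ‖ψ (F (n + s)) - z‖ ≤
        (m₁ + n + 1 : ℝ) * (C * (2 * θ ^ (m₁ + n))) :=
      mul_le_mul_of_nonneg_left h1 (by positivity)
    obtain ⟨h8, h9⟩ := hnear (y := ψ (F (n + s))) (by rw [dist_eq_norm]; linarith)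
    refine ⟨by rw [mem_ball_zero_iff]; linarith, fun hmem => ?_⟩
    obtain ⟨g, hg, hg0, hgc⟩ := h8 hmem
    refine not_vanishing hz.le hz' h9.le hc (N := N) (fun j hj => ?_) hκ (m := m₁ + n) (by omega)
      hs hs' ?_ ?_ ?_ hg hgc hg0
    · have := hadm.1 (j - N)
      simpa [shift, show N + (j - N) = j by omega] using this
    · rw [hval, hF n s hs hs']
      simp only [tailAt, ← add_assoc]
      ring
    · push_cast
      linarith [norm_nonneg (ψ (F (n + s)) - z)]
    · push_cast
      linarith
  -- `t / (1 - t)` maps `[0, 1)` onto the half-line parametrising the polygonal line.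
  refine ⟨fun t => if t < 1 then ψ (F (t / (1 - t))) else z, fun t ht => ?_, by simp,
    fun t ht ht' => ?_⟩
  · rcases ht.2.lt_or_eq with ht1 | rfl
    · have h1 : ContinuousWithinAt (fun t : ℝ => ψ (F (t / (1 - t)))) (Set.Ico 0 1) t := by
        have h2 : ContinuousOn (fun t : ℝ => F (t / (1 - t))) (Set.Ico 0 1) := by
          refine hFc.comp_continuousOn (ContinuousOn.div (by fun_prop) (by fun_prop) ?_)
          intro u hu
          have := hu.2
          linarith
        refine (hψc.comp h2 ?_) t ⟨ht.1, ht1⟩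
        intro u hu
        exact hFball _ (div_nonneg hu.1 (by linarith [hu.2]))
      have h3 : Set.Ico (0 : ℝ) 1 ∈ 𝓝[Set.Icc 0 1] t := by
        rw [show Set.Ico (0 : ℝ) 1 = Set.Icc 0 1 ∩ Set.Iio 1 by
          ext u; simp only [Set.mem_Ico, Set.mem_inter_iff, Set.mem_Icc, Set.mem_Iio]
          constructor
          · exact fun h => ⟨⟨h.1, h.2.le⟩, h.2⟩
          · exact fun h => ⟨h.1.1, h.2⟩]
        exact inter_mem_nhdsWithin _ (Iio_mem_nhds ht1)
      have h4 := h1.mono_of_mem_nhdsWithin h3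
      refine h4.congr_of_eventuallyEq ?_ (if_pos ht1)
      filter_upwards [h3] with u hu using if_pos hu.2
    · rw [Metric.continuousWithinAt_iff]
      intro ε' hε'
      have hlim := (tendsto_pow_atTop_nhds_zero_of_lt_one hθ0.le hθ1).const_mul (C * 2)
      rw [mul_zero] at hlim
      obtain ⟨n₀, hn₀⟩ := eventually_atTop.1 (hlim.eventually_lt_const hε')
      -- If `1 - u < 1/(n₀ + 2)`, then `u/(1 - u) ≥ n₀`, so the path has passed vertex `n₀`.
      refine ⟨1 / (n₀ + 2), by positivity, fun {u} hu hdu => ?_⟩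
      rw [if_neg (lt_irrefl _)]
      split_ifs with hu1
      · have hpos : 0 < 1 - u := by linarith
        have hux : 0 ≤ u / (1 - u) := div_nonneg hu.1 hpos.le
        have hn : n₀ ≤ ⌊u / (1 - u)⌋₊ := by
          refine Nat.le_floor ?_
          rw [Real.dist_eq, abs_lt] at hdu
          have h5 : 1 - u < 1 / (n₀ + 2) := by linarith [hdu.1]
          rw [lt_div_iff₀ (by positivity)] at h5
          rw [le_div_iff₀ hpos]
          nlinarith
        obtain ⟨n, s, hs, hs', hx, hn'⟩ := hdecomp _ hux
        rw [dist_eq_norm, hx]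
        refine (hdist n s hs hs').trans_lt ?_
        rw [← mul_assoc]
        exact hn₀ _ (by omega)
      · rw [dist_self]; exact hε'
  · simp only [if_pos ht']
    exact havoid _ (div_nonneg ht (by linarith))

end TwoMapIFS

end

/-! ### Accessibility, boundary and conclusion -/

section

namespace TwoMapIFS
open Filter Topology

/-- The half-open end of a path, as a path from its starting point. -/
lemma pathAccessibleFrom_of_continuousOn {S : Set ℂ} {z : ℂ} {γ : ℝ → ℂ}
    (hγ : ContinuousOn γ (Set.Icc 0 1)) (h1 : γ 1 = z) (hS : ∀ t, 0 ≤ t → t < 1 → γ t ∈ S) :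
    ∃ U, IsComponentOf S U ∧ PathAccessibleFrom U z := by
  have hconn : γ '' Set.Ico 0 1 ⊆ connectedComponentIn S (γ 0) := by
    refine IsPreconnected.subset_connectedComponentIn ?_ ⟨0, by simp, rfl⟩ ?_
    · exact isPreconnected_Ico.image _ (hγ.mono Set.Ico_subset_Icc_self)
    · rintro - ⟨t, ht, rfl⟩
      exact hS t ht.1 ht.2
  refine ⟨connectedComponentIn S (γ 0), ⟨γ 0, hS 0 le_rfl one_pos, rfl⟩, γ 0,
    ⟨⟨fun t => γ t, continuousOn_iff_continuous_domRestrict.1 hγ⟩, by simp, by simpa using h1⟩,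
    fun t ht => hconn ⟨t, ⟨t.2.1, ht⟩, rfl⟩⟩

lemma mem_frontier_of_continuousOn {S : Set ℂ} {z : ℂ} {γ : ℝ → ℂ} (hz : z ∈ S)
    (hγ : ContinuousOn γ (Set.Icc 0 1)) (h1 : γ 1 = z) (hS : ∀ t, 0 ≤ t → t < 1 → γ t ∉ S) :
    z ∈ frontier S := by
  rw [frontier_eq_closure_inter_closure]
  refine ⟨subset_closure hz, ?_⟩
  have h2 : (1 : ℝ) ∈ closure (Set.Ico 0 1) := by
    rw [closure_Ico (by norm_num)]; simp
  have h3 : ContinuousWithinAt γ (Set.Ico 0 1) 1 :=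
    (hγ 1 (by simp)).mono Set.Ico_subset_Icc_self
  have h4 := h3.mem_closure_image h2
  rw [h1] at h4
  refine closure_mono ?_ h4
  rintro - ⟨t, ht, rfl⟩
  exact hS t ht.1 ht.2

/-- Periodicity leaves at most `p` distinct tails, so a minimum of finitely many constants works. -/
lemma exists_common_separated {z : ℂ} {f : PowerSeries ℤ} {l p : ℕ} (h : HasRationalForm f l p)
    (hsep : ∀ q, l + 1 ≤ q → ∃ κ, 0 < κ ∧ Separated z κ (shift q (coeffSeq f))) :
    ∃ κ, 0 < κ ∧ ∀ q, l + 1 ≤ q → Separated z κ (shift q (coeffSeq f)) := by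
  choose κ hκ0 hκ using fun i : ℕ => hsep (l + 1 + i) (by omega)
  have hne : (Finset.range p).Nonempty := Finset.nonempty_range_iff.2 (by have := h.1; omega)
  refine ⟨(Finset.range p).inf' hne κ, (Finset.lt_inf'_iff _).2 fun i _ => hκ0 i, fun q hq => ?_⟩
  obtain ⟨i, hi, hi'⟩ := h.exists_shift_eq (N := l + 1) (n := q) le_rfl hq
  have h0 := hi' 0
  rw [add_zero, add_zero] at h0
  rw [h0]
  exact (hκ i).mono (Finset.inf'_le _ (Finset.mem_range.2 hi))

lemma norm_sq_le_half {z : ℂ} (hz : ‖z‖ ≤ 1 / Real.sqrt 2) : ‖z‖ ^ 2 ≤ 1 / 2 := by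
  have := pow_le_pow_left₀ (norm_nonneg z) hz 2
  rwa [div_pow, one_pow, Real.sq_sqrt (by norm_num)] at this

end TwoMapIFS

open TwoMapIFS in
theorem theorem4p4 (lam : ℂ) (hM : lam ∈ connectednessLocus) (hreal : lam.im ≠ 0)
    (hnorm : ‖lam‖ ≤ 1 / Real.sqrt 2)
    (f : PowerSeries ℤ) (hf : seriesVanishingAt lam = {f})
    (l p : ℕ) (htype : IsRationalType f l p)
    (hzeros : {j : ℕ | PowerSeries.coeff j f = 0}.Finite)
    (h1 : ∀ n : ℕ, n < p →
      ‖evalAt lam (taylorPoly f (l + 1 + n))‖ >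
        1 / 2 * (‖lam ^ (l + 1 + n + 1)‖ / (1 - ‖lam‖)))
    (h2 : ∀ n : ℕ, n < p →
      ‖evalAt lam (taylorPoly f (l + 1 + n))‖ + ‖evalAt lam (taylorPoly f (l + 1 + n + 1))‖ >
        ‖lam ^ (l + 1 + n + 1)‖ / (1 - ‖lam‖))
    (h3 : ∀ n : ℕ, n < p → ∀ Q : Polynomial ℤ,
      2 * taylorPoly f l + Polynomial.X ^ (l + 1) * Q = 2 * taylorPoly f (l + 1 + n) →
      ∀ P : Polynomial ℤ, P.natDegree ≤ n →
        (∀ j, P.coeff j ∈ ({-2, -1, 0, 1, 2} : Set ℤ)) → P ≠ Q →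
        2 * ‖evalAt lam (taylorPoly f (l + 1 + n))‖ <
          ‖2 * evalAt lam (taylorPoly f l) + lam ^ (l + 1) * evalAt lam P‖) :
    lam ∈ frontier connectednessLocus ∧
      ∃ U : Set ℂ, IsComponentOf (Metric.ball (0 : ℂ) 1 \ connectednessLocus) U ∧
        PathAccessibleFrom U lam := by
  have hf' : f ∈ seriesVanishingAt lam := by rw [hf]; rfl
  have hsq := norm_sq_le_half hnorm
  have hlt : ‖lam‖ < 4 / 5 := lt_of_pow_lt_pow_left₀ 2 (by norm_num) (by linarith)
  have hlam1 : ‖lam‖ < 1 := hlt.trans (by norm_num)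
  have hhalf := half_le_norm hlam1 hf'
  have hform := htype.1
  have hadm := admissible_of_taylorPoly hlam1 hf' hform hzeros h2 h3
  have habs := abs_coeffSeq_le hf'.1
  obtain ⟨κ, hκ0, hκ⟩ := exists_common_separated (z := lam) hform fun q hq => by
    have h4 := hadm.tail (q - (l + 1))
    rw [shift_shift, show l + 1 + (q - (l + 1)) = q by omega] at h4
    exact exists_separated hlam1 h4.abs_le (h4.separates hsq hhalf).1 (h4.separates hsq hhalf).2
  have hnear : ∀ᶠ w in nhds lam, w ∈ connectednessLocus → ∃ g : ℕ → ℝ,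
      (∀ j, g j ∈ ({-1, 0, 1} : Set ℝ)) ∧ ser g w = 0 ∧ ∀ j < l + 1, g j = coeffSeq f j := by
    have h4 : ∀ᶠ w in nhds lam, ∀ j ∈ Finset.range (l + 1), ∀ g : ℕ → ℝ,
        (∀ j, g j ∈ ({-1, 0, 1} : Set ℝ)) → g 0 = 1 → ser g w = 0 → g j = coeffSeq f j :=
      (Finset.eventually_all _).2 fun j _ =>
        eventually_eq_coeff hlam1 (eq_coeffSeq_of_unique hlam1 hf) j
    filter_upwards [h4] with w hw hwM
    obtain ⟨g, hg, hg0, hgw⟩ := exists_vanishing hwM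
    exact ⟨g, hg, hgw, fun j hj => hw j (Finset.mem_range.2 hj) g hg hg0 hgw⟩
  obtain ⟨γ, hγ, hγ1, hγS⟩ := exists_path hlt hhalf habs
    (by simp [coeffSeq, hf'.1.2]) (ser_coeffSeq_eq_zero hf') hadm hκ0 hκ hnear
  exact ⟨mem_frontier_of_continuousOn hM hγ hγ1 fun t ht ht' => (hγS t ht ht').2,
    pathAccessibleFrom_of_continuousOn hγ hγ1 hγS⟩

end
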